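/- Let $\Sigma$ be the Disco surface: the closed affine surface of genus $2$ obtained from the rectangle $[0,6]\times[0,1]$ by gluing its two vertical sides by a translation and by gluing the points of its top side to points of its bottom side as follows: $$(x,1)\sim\begin{cases}(2x+1,\,0), & 0\le x\le 1,\\ \left(\tfrac{x-1}{2},\,0\right), & 1\le x\le 3,\\ \left(\tfrac{x-3}{2}+5,\,0\right), & 3\le x\le 5,\\ (2(x-5)+3,\,0), & 5\le x\le 6.\end{cases}$$ The vertices $(x,0),(x,1)$, $x\in\{0,1,3,5,6\}$, project to the two singular points of $\Sigma$. For $t\in\mathbb R$ let $\mathcal F_t$ be the oriented foliation of $\Sigma$ in the direction $[t:1]$, whose leaves are made of the oriented straight segments of direction $(t,1)$. Let $\rho:\Sigma\to\Sigma$ be the involution induced by the rotation $(x,y)\mapsto(6-x,1-y)$. A positive half-leaf (issued from a regular point) is called infinite if it does not run into a singular point. We say that $\mathcal F_t$ concentrates on a set $A\subset\Sigma$ if every infinite positive half-leaf that is not contained in $\rho(A)$ has $A$ as its $\omega$-limit set. A closed leaf $L$ is attracting if its dilatation parameter (the derivative of its return map on a transversal) is less than $1$ and all positive half-leaves issued from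 regular points of some neighbourhood of $L$ are infinite and have $L$ as $\omega$-limit set. A closed saddle connection is a leaf going from a singular point to the same singular point, together with that point. A closed set $A\subset\Sigma$ is transversely a Cantor set of zero measure if it meets each of the horizontal closed curves $\{y=c\}$, $0<c<1$ (which are transversals meeting every leaf), in a Cantor set of zero length. There is a set $H\subset[1,4]$ whose complement $[1,4]\setminus H$ is a Cantor set of zero Lebesgue measure and such that, denoting by $\mathring H$ the interior of $H$ in $\mathbb R$ and by $\partial H$ the set of the end points of the connected components of $\mathring H$ together with the end point $4$ of $[1,4]$: 1. for every $t\in\mathring H$ there is an attracting closed leaf $L$ of $\mathcal F_t$ such that every infinite positive half-leaf that is not part of a closed leaf has $L$ as its $\omega$-limit set; moreover, if $t\neq\frac43$, then $\mathcal F_t$ concentrates on $L$; 2. for every $t\in\partial H$ there is a closed saddle connection of $\mathcal F_t$ on which $\mathcal F_t$ concentrates; 3. for every other $t\in[1,4]$, that is, for $t\in[1,4]\setminus(\mathring H\cup\partial H)$, the foliation $\mathcal F_t$ concentrates on a set that is transversely a Cantor set of zero measure. -/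

import Mathlib

open Set MeasureTheory

namespace Disco

/-- A Cantor set in a topological space: non-empty, compact, without isolated points and totally
disconnected. -/
structure IsCantorSet {X : Type*} [TopologicalSpace X] (C : Set X) : Prop where
  nonempty : C.Nonempty
  isCompact : IsCompact C
  perfect : Perfect C
  totallyDisconnected : IsTotallyDisconnected C

/-! ### The surface -/

/-- The polygon: the rectangle `[0,6] × [0,1]`. -/
abbrev Polygon : Type := {z : ℝ × ℝ // z.1 ∈ Icc (0 : ℝ) 6 ∧ z.2 ∈ Icc (0 : ℝ) 1}

/-- The gluing of the sides of the rectangle. The two vertical sides are glued by a translation.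
The top sides over `[0,1]`, `[1,3]`, `[3,5]`, `[5,6]` are glued to the bottom sides under
`[1,3]`, `[0,1]`, `[5,6]`, `[3,5]`, respectively, by the orientation preserving affine maps, whose
ratios are `2`, `1/2`, `1/2`, `2`. -/
inductive Glue : Polygon → Polygon → Prop
  | side (z w : Polygon) (hz : z.1.1 = 0) (hw : w.1.1 = 6) (h : w.1.2 = z.1.2) : Glue z w
  | top₁ (z w : Polygon) (hz : z.1.2 = 1) (hw : w.1.2 = 0) (hx : z.1.1 ∈ Icc (0 : ℝ) 1)
      (h : w.1.1 = 2 * z.1.1 + 1) : Glue z w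
  | top₂ (z w : Polygon) (hz : z.1.2 = 1) (hw : w.1.2 = 0) (hx : z.1.1 ∈ Icc (1 : ℝ) 3)
      (h : w.1.1 = (z.1.1 - 1) / 2) : Glue z w
  | top₃ (z w : Polygon) (hz : z.1.2 = 1) (hw : w.1.2 = 0) (hx : z.1.1 ∈ Icc (3 : ℝ) 5)
      (h : w.1.1 = (z.1.1 - 3) / 2 + 5) : Glue z w
  | top₄ (z w : Polygon) (hz : z.1.2 = 1) (hw : w.1.2 = 0) (hx : z.1.1 ∈ Icc (5 : ℝ) 6)
      (h : w.1.1 = 2 * (z.1.1 - 5) + 3) : Glue z w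

/-- The Disco surface, with the quotient topology. -/
def Surface : Type := Quot Glue

instance : TopologicalSpace Surface := inferInstanceAs (TopologicalSpace (Quot Glue))

/-- The projection of the polygon onto the surface. -/
def proj (z : Polygon) : Surface := Quot.mk Glue z

/-- The singular points: the images of the vertices of the polygon. -/
def sing : Set Surface :=
  proj '' {z | (z.1.2 = 0 ∨ z.1.2 = 1) ∧ z.1.1 ∈ ({0, 1, 3, 5, 6} : Set ℝ)}

/-- The rotation by the angle `π` of the polygon. -/
def turn (z : Polygon) : Polygon :=
  ⟨(6 - z.1.1, 1 - z.1.2), by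
    obtain ⟨z, ⟨h1, h2⟩, h3, h4⟩ := z
    refine ⟨⟨?_, ?_⟩, ?_, ?_⟩ <;> simp <;> linarith⟩

/-- The involution `-Id` of the surface, induced by the rotation by the angle `π` of the
polygon. -/
def halfTurn : Surface → Surface :=
  Quot.lift (fun z => proj (turn z)) (by
    rintro z w (⟨hz, hw, h⟩ | ⟨hz, hw, hx, h⟩ | ⟨hz, hw, hx, h⟩ | ⟨hz, hw, hx, h⟩ |
      ⟨hz, hw, hx, h⟩) <;> refine (Quot.sound ?_).symm
    · exact Glue.side _ _ (by simp [turn, hw]) (by simp [turn, hz]) (by simp [turn, h])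
    · refine Glue.top₃ _ _ (by simp [turn, hw]) (by simp [turn, hz]) ⟨?_, ?_⟩ ?_ <;>
        simp only [turn, h] <;> linarith [hx.1, hx.2]
    · refine Glue.top₄ _ _ (by simp [turn, hw]) (by simp [turn, hz]) ⟨?_, ?_⟩ ?_ <;>
        simp only [turn, h] <;> linarith [hx.1, hx.2]
    · refine Glue.top₁ _ _ (by simp [turn, hw]) (by simp [turn, hz]) ⟨?_, ?_⟩ ?_ <;>
        simp only [turn, h] <;> linarith [hx.1, hx.2]
    · refine Glue.top₂ _ _ (by simp [turn, hw]) (by simp [turn, hz]) ⟨?_, ?_⟩ ?_ <;>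
        simp only [turn, h] <;> linarith [hx.1, hx.2])

/-! ### The oriented foliation in the direction `[t : 1]`, that is of the vector `(t, 1)`

All gluing maps are of the form `z ↦ a z + b` with `a > 0`, so the oriented straight segments of
direction `(t, 1)` in the polygon fit together to the oriented leaves. For `t > 0` a segment of
this direction in the rectangle meets the sides at most at its two ends. -/

/-- An oriented straight segment of direction `(t, 1)` in the polygon leads from `p` to `q`. -/
def Step (t : ℝ) (p q : Surface) : Prop :=
  ∃ (z w : Polygon) (r : ℝ), 0 ≤ r ∧ w.1 = (z.1.1 + r * t, z.1.2 + r) ∧ proj z = p ∧ proj w = q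

/-- `q` is on the positive half-leaf issued from `p`; the points `p`, `q` and all points between
them are regular unless `p = q`. -/
def Reach (t : ℝ) : Surface → Surface → Prop :=
  Relation.ReflTransGen fun p q => p ∉ sing ∧ q ∉ sing ∧ Step t p q

/-- The positive half-leaf issued from `p`. -/
def halfLeaf (t : ℝ) (p : Surface) : Set Surface := {q | Reach t p q}

/-- The leaf through `p`. -/
def leaf (t : ℝ) (p : Surface) : Set Surface := {q | Reach t p q ∨ Reach t q p}

/-- The positive half-leaf issued from the regular point `p` ends at the singular point `s`. -/
def EndsAt (t : ℝ) (p s : Surface) : Prop :=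
  p ∉ sing ∧ s ∈ sing ∧ ∃ q, Reach t p q ∧ Step t q s

/-- The leaf of the regular point `p`, followed backwards from `p`, ends at the singular
point `s`. -/
def StartsAt (t : ℝ) (p s : Surface) : Prop :=
  p ∉ sing ∧ s ∈ sing ∧ ∃ q, Step t s q ∧ Reach t q p

/-- `p` is a regular point and the positive half-leaf issued from `p` never meets a singular
point, hence has infinite length. -/
def InfiniteHalfLeaf (t : ℝ) (p : Surface) : Prop := p ∉ sing ∧ ∀ s, ¬ EndsAt t p s

/-- The `ω`-limit set of the positive half-leaf issued from `p`. -/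
def omega (t : ℝ) (p : Surface) : Set Surface := ⋂ q ∈ halfLeaf t p, closure (halfLeaf t q)

/-- The point `p` is regular and its leaf is closed: the leaf leaves `p` and comes back to `p`. -/
def OnClosedLeaf (t : ℝ) (p : Surface) : Prop :=
  p ∉ sing ∧ ∃ q, q ≠ p ∧ Reach t p q ∧ Reach t q p

/-- `L` is a (regular) closed leaf. -/
def IsClosedLeaf (t : ℝ) (L : Set Surface) : Prop := ∃ p, OnClosedLeaf t p ∧ L = leaf t p

/-- The ratio of the gluing map of the top side of the polygon over `x` (`x` not a vertex). -/
noncomputable def ratio (x : ℝ) : ℝ := open Classical in if x ∈ Icc (1 : ℝ) 5 then 1 / 2 else 2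

/-- The dilatation parameter of a closed leaf `L`, that is the derivative of its return map on a
transversal: the product of the ratios of the gluing maps over all points where `L` crosses the
top sides of the polygon. -/
noncomputable def dilatation (L : Set Surface) : ℝ :=
  ∏ᶠ z ∈ {z : Polygon | z.1.2 = 1 ∧ proj z ∈ L}, ratio z.1.1

/-- `L` is an attracting closed leaf: its dilatation parameter is less than one, and all
half-leaves issued from a neighbourhood of `L` are infinite and have `L` as `ω`-limit set. -/
def IsAttractingClosedLeaf (t : ℝ) (L : Set Surface) : Prop :=
  IsClosedLeaf t L ∧ dilatation L < 1 ∧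
    ∃ U, IsOpen U ∧ L ⊆ U ∧ ∀ p ∈ U, p ∉ sing → InfiniteHalfLeaf t p ∧ omega t p = L

/-- `L` is a closed saddle connection: a leaf that goes from a singular point to the same singular
point, together with this point. -/
def IsClosedSaddleConnection (t : ℝ) (L : Set Surface) : Prop :=
  ∃ p s, StartsAt t p s ∧ EndsAt t p s ∧ L = insert s (leaf t p)

/-- The foliation concentrates on `A`: the `ω`-limit set of every infinite positive half-leaf is
`A`, unless the half-leaf lies in the image of `A` under `-Id` (which is the corresponding
repelling set, as `-Id` reverses the orientation of the leaves). -/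
def ConcentratesOn (t : ℝ) (A : Set Surface) : Prop :=
  ∀ p, InfiniteHalfLeaf t p → omega t p = A ∨ halfLeaf t p ⊆ halfTurn '' A

/-- The horizontal closed curve at height `c`. For `0 < c < 1` it is a transversal that meets
every leaf. -/
def horizontal (c : ℝ) : Set Surface := proj '' {z | z.1.2 = c}

/-- `A` is transversely a Cantor set of zero measure: `A` is closed and meets each of the closed
transversals in a Cantor set of zero length. -/
def IsTransverselyNullCantor (A : Set Surface) : Prop :=
  IsClosed A ∧ ∀ c ∈ Ioo (0 : ℝ) 1, IsCantorSet (A ∩ horizontal c) ∧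
    volume {x : ℝ | ∃ z : Polygon, z.1 = (x, c) ∧ proj z ∈ A} = 0

/-- `t` is an end point of a component of (the interior of) `H`. -/
def IsEndpoint (H : Set ℝ) (t : ℝ) : Prop :=
  t ∉ interior H ∧ ∃ ε > 0, Ioo t (t + ε) ⊆ H ∨ Ioo (t - ε) t ⊆ H

end Disco

namespace Disco

/-! ### Coordinates on the surface -/

/-! Leaves are followed through the first return map `ret t` to the horizontal curve, in an abscissa
modulo 6 with values in [-1, 5). By `reach_iff`, `infiniteHalfLeaf_iff` and `omega_eq_susp`,
half-leaves become orbits of `ret t`, and the ω-limit set becomes the suspension of the cluster set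
of the orbit.

For 2 ≤ t ≤ 4 the interval [-1, 1) is mapped into itself, and x = 2v - 1 conjugates the return map
there to the contracted rotation v ↦ v/2 + δ modulo 1 with δ = t/4, whose lift is `F` (`ret_fract`).
An infinite orbit that never enters [-1, 1) stays where the gluing doubles; read through the
half-turn it is a backward orbit of the same rotation (`exists_back`). So it suffices to find one
limit set common to all forward orbits that avoid the discontinuity, and to show that it contains
the backward orbits (`concentratesOn_susp`).

The tool is `G`, the continuous monotone left inverse of `F`, which has slope 2 on the slots (the
closed images of the branches of `F`) and is constant on the gaps between them. The pair is a Galois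
connection (`gc_G_F`), so the time at which an `F`-orbit enters an interval can be read off iterates
of `G`. The `G`-orbit of 0 decides what happens. If it never returns to the integers (`Irr`), every
infinite orbit comes arbitrarily close to 0 from both sides, hence to every point whose `G`-orbit
avoids the open gaps; the limit set is `core`, a null Cantor set (`Irr.cl_eq`, `Irr.isCantorSet`).
If it returns after n steps (`Rat`), the finitely many points of that orbit modulo 1 cut the circle
into arcs on which all iterates of `F` contract, and all infinite orbits have the limit set of 0
(`Rat.cl_eq`). When the orbit returns through an open gap, the n-th iterate maps an arc strictly
into itself and there is an attracting periodic orbit (`Rat.exists_periodic`). When it returns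
through an edge of a gap, a separatrix closes up into a saddle connection.

For θ = 1 - δ, as long as no gap is met, the J-th point of the `G`-orbit of 0 is δ + (2^(J+1) - 1)θ
modulo 1. The hyperbolic parameters are thus those for which some (2^n - 1)θ has fractional part
greater than 1/2. They form an open set of full measure, by ergodicity of the doubling map; the ends
of its components are found in `exists_component`, and no two components abut
(`not_left_and_right`).

For 1 ≤ t < 2 the interval [0, 1) is contracted to the fixed point t - 1. Untrapped negative points
are translated by (3t - 4)/2 by the second return, which is why t = 4/3 is exceptional. -/

/-- The representative in `[0, 6)` of a real number modulo `6`. -/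
noncomputable def red (x : ℝ) : ℝ := x - 6 * ⌊x / 6⌋

lemma red_nonneg (x : ℝ) : 0 ≤ red x := by
  have := Int.floor_le (x / 6); unfold red; linarith

lemma red_lt (x : ℝ) : red x < 6 := by
  have := Int.lt_floor_add_one (x / 6); unfold red; linarith

lemma red_add_int (x : ℝ) (k : ℤ) : red (x + 6 * k) = red x := by
  have : (x + 6 * k) / 6 = x / 6 + k := by ring
  unfold red; rw [this, Int.floor_add_intCast]; push_cast; ring

lemma exists_red (x : ℝ) : ∃ k : ℤ, red x = x + 6 * k :=
  ⟨-⌊x / 6⌋, by unfold red; push_cast; ring⟩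

lemma red_of_mem {x : ℝ} (h0 : 0 ≤ x) (h6 : x < 6) : red x = x := by
  have : ⌊x / 6⌋ = 0 := Int.floor_eq_zero_iff.2 ⟨by positivity, by linarith⟩
  simp [red, this]

lemma red_eq_iff {x y : ℝ} : red x = red y ↔ ∃ k : ℤ, x = y + 6 * k := by
  constructor
  · intro h
    obtain ⟨k, hk⟩ := exists_red x
    obtain ⟨l, hl⟩ := exists_red y
    exact ⟨l - k, by push_cast; linarith⟩
  · rintro ⟨k, rfl⟩; exact red_add_int y k

lemma red_red (x : ℝ) : red (red x) = red x := red_of_mem (red_nonneg x) (red_lt x)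

lemma red_add_six (x : ℝ) : red (x + 6) = red x := by simpa using red_add_int x 1

lemma red_six : red 6 = 0 := by
  simpa [red_of_mem (le_refl (0 : ℝ)) (by norm_num)] using red_add_six 0

lemma red_eq_of_add {x y : ℝ} (k : ℤ) (h : x = y + 6 * k) (h0 : 0 ≤ y) (h6 : y < 6) :
    red x = y := by
  rw [h, red_add_int, red_of_mem h0 h6]

/-- The gluing of the top sides to the bottom sides, on the representatives in `[0, 6)`. -/
noncomputable def glueMap (y : ℝ) : ℝ :=
  if y < 1 then 2 * y + 1 else if y < 3 then (y - 1) / 2 else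
    if y < 5 then (y - 3) / 2 - 1 else 2 * y - 7

/-- The first return map of the foliation to the horizontal curve at height `0`. -/
noncomputable def ret (t x : ℝ) : ℝ := glueMap (red (x + t))

/-- The point of the surface with given coordinates, the first one being taken modulo `6`. -/
noncomputable def cyl (x y : ℝ) : Surface :=
  proj ⟨(red x, max 0 (min 1 y)), ⟨red_nonneg x, (red_lt x).le⟩, le_max_left _ _,
    max_le zero_le_one (min_le_left _ _)⟩

/-- `x` projects to a vertex on the bottom side of the polygon. -/
def Vert (x : ℝ) : Prop := red x = 0 ∨ red x = 1 ∨ red x = 3 ∨ red x = 5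

/-- A choice of one point of the bottom side in each class of glued bottom points. -/
noncomputable def canonB (x : ℝ) : ℝ :=
  if red x = 3 then 0 else if red x = 5 then 1 else red x

/-- The coordinates of a chosen representative of the class of a point of the polygon. -/
noncomputable def nf (z : Polygon) : ℝ × ℝ :=
  if z.1.2 = 1 then (canonB (glueMap (red z.1.1)), 0) else
    if z.1.2 = 0 then (canonB z.1.1, 0) else (red z.1.1, z.1.2)

lemma canonB_congr {x y : ℝ} (h : red x = red y) : canonB x = canonB y := by
  simp [canonB, h]

lemma canonB_of_vert {x : ℝ} (h : Vert x) : canonB x = 0 ∨ canonB x = 1 := by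
  rcases h with h | h | h | h <;> norm_num [canonB, h]

lemma canonB_of_not_vert {x : ℝ} (h : ¬ Vert x) : canonB x = red x := by
  simp only [Vert, not_or] at h
  simp [canonB, h]

lemma vert_iff_canonB {x : ℝ} : Vert x ↔ canonB x = 0 ∨ canonB x = 1 := by
  refine ⟨canonB_of_vert, fun h => ?_⟩
  by_contra hv
  rw [canonB_of_not_vert hv] at h
  simp only [Vert] at hv
  tauto

lemma vert_congr {x y : ℝ} (h : red x = red y) : Vert x ↔ Vert y := by simp [Vert, h]

/-- The only conflicts arise at end points shared by two of the glued intervals. They identify the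
bottom points 0, 3, 6 and the bottom points 1, 5, which is what `canonB` absorbs. Invariance under
the generators makes `nf` descend to the quotient, where it distinguishes points. -/
lemma nf_glue {z w : Polygon} (h : Glue z w) : nf z = nf w := by
  rcases h with ⟨hz, hw, h⟩ | ⟨hz, hw, hx, h⟩ | ⟨hz, hw, hx, h⟩ | ⟨hz, hw, hx, h⟩ | ⟨hz, hw, hx, h⟩
  · have : red z.1.1 = red w.1.1 := by
      rw [hz, hw, red_six, red_of_mem le_rfl (by norm_num)]
    simp only [nf, h, canonB_congr this, this]
  all_goals
    have e1 : nf z = (canonB (glueMap (red z.1.1)), 0) := if_pos hz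
    have e2 : nf w = (canonB w.1.1, 0) := by
      unfold nf; rw [if_neg (by rw [hw]; norm_num), if_pos hw]
    rw [e1, e2, h]
    refine congrArg (fun a => (a, (0 : ℝ))) ?_
    obtain ⟨h1, h2⟩ := hx
  · rw [red_of_mem h1 (by linarith)]
    rcases h2.lt_or_eq with h2 | h2
    · simp [glueMap, h2]
    · norm_num [glueMap, h2, canonB, red_of_mem]
  · rw [red_of_mem (by linarith) (by linarith)]
    rcases h2.lt_or_eq with h2 | h2
    · simp [glueMap, h2, h1.not_gt]
    · have : red (-1) = 5 := red_eq_of_add (-1) (by norm_num) (by norm_num) (by norm_num)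
      norm_num [glueMap, h2, canonB, red_of_mem, this]
  · rw [red_of_mem (by linarith) (by linarith)]
    rcases h2.lt_or_eq with h2 | h2
    · have : ¬ z.1.1 < 1 := by linarith
      simp only [glueMap, h2, h1.not_gt, this, if_true, if_false]
      exact canonB_congr (red_eq_iff.2 ⟨-1, by push_cast; ring⟩)
    · norm_num [glueMap, h2, canonB, red_of_mem, red_six]
  · rcases h2.lt_or_eq with h2 | h2
    · rw [red_of_mem (by linarith) (by linarith)]
      have : ¬ z.1.1 < 1 := by linarith
      have : ¬ z.1.1 < 3 := by linarith
      simp only [glueMap, h1.not_gt, *, if_false]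
      congr 1; ring
    · norm_num [glueMap, h2, canonB, red_of_mem, red_six]

/-- The chosen representative of a point of the surface. -/
noncomputable def nfS : Surface → ℝ × ℝ := Quot.lift nf fun _ _ => nf_glue

lemma nfS_proj (z : Polygon) : nfS (proj z) = nf z := rfl

lemma proj_glue {z w : Polygon} (h : Glue z w) : proj z = proj w := Quot.sound h

lemma cyl_eq_proj {x y : ℝ} (hx : x ∈ Icc (0 : ℝ) 6) (hy : y ∈ Icc (0 : ℝ) 1) :
    cyl x y = proj ⟨(x, y), hx, hy⟩ := by
  have h : max 0 (min 1 y) = y := by rw [min_eq_right hy.2, max_eq_right hy.1]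
  rcases hx.2.lt_or_eq with h6 | h6
  · unfold cyl; congr 3; exact red_of_mem hx.1 h6
  · subst h6
    exact proj_glue (Glue.side _ _ (by simpa using red_six) rfl (by simp [h]))

lemma cyl_val (z : Polygon) : cyl z.1.1 z.1.2 = proj z := cyl_eq_proj z.2.1 z.2.2

lemma cyl_congr {x x' : ℝ} (h : red x = red x') (y : ℝ) : cyl x y = cyl x' y := by
  simp only [cyl, h]

lemma cyl_red (x y : ℝ) : cyl (red x) y = cyl x y := cyl_congr (red_red x) y

lemma cyl_three : cyl 3 0 = cyl 0 0 := by
  rw [cyl_eq_proj (by norm_num) (by norm_num), cyl_eq_proj (by norm_num) (by norm_num)]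
  have h : ((1 : ℝ), (1 : ℝ)).1 ∈ Icc (0 : ℝ) 6 ∧ ((1 : ℝ), (1 : ℝ)).2 ∈ Icc (0 : ℝ) 1 := by norm_num
  rw [← proj_glue (Glue.top₁ ⟨(1, 1), h⟩ ⟨(3, 0), _⟩ rfl rfl (by norm_num) (by norm_num)),
    ← proj_glue (Glue.top₂ ⟨(1, 1), h⟩ ⟨(0, 0), _⟩ rfl rfl (by norm_num) (by norm_num))]

lemma cyl_five : cyl 5 0 = cyl 1 0 := by
  rw [cyl_eq_proj (by norm_num) (by norm_num), cyl_eq_proj (by norm_num) (by norm_num)]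
  have h : ((3 : ℝ), (1 : ℝ)).1 ∈ Icc (0 : ℝ) 6 ∧ ((3 : ℝ), (1 : ℝ)).2 ∈ Icc (0 : ℝ) 1 := by norm_num
  rw [← proj_glue (Glue.top₃ ⟨(3, 1), h⟩ ⟨(5, 0), _⟩ rfl rfl (by norm_num) (by norm_num)),
    ← proj_glue (Glue.top₂ ⟨(3, 1), h⟩ ⟨(1, 0), _⟩ rfl rfl (by norm_num) (by norm_num))]

lemma cyl_canonB (x : ℝ) : cyl (canonB x) 0 = cyl x 0 := by
  unfold canonB
  split_ifs with h h
  · rw [← cyl_red x, h, cyl_three]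
  · rw [← cyl_red x, h, cyl_five]
  · exact cyl_red x 0

/-- The third branch is lowered by 6 so that the part contracted by the gluing, the image of [1, 5),
is the single interval [-1, 1). -/
lemma glueMap_mem {y : ℝ} (h0 : 0 ≤ y) (h6 : y < 6) : glueMap y ∈ Ico (-1 : ℝ) 5 := by
  unfold glueMap
  split_ifs <;> constructor <;> linarith

lemma cyl_top (x : ℝ) : cyl x 1 = cyl (glueMap (red x)) 0 := by
  have h0 := red_nonneg x
  have h6 := red_lt x
  rw [← cyl_red x 1, cyl_eq_proj ⟨h0, h6.le⟩ (by norm_num)]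
  unfold glueMap
  split_ifs with h1 h2 h3
  · rw [cyl_eq_proj ⟨by linarith, by linarith⟩ (by norm_num)]
    exact proj_glue (Glue.top₁ _ _ rfl rfl ⟨h0, h1.le⟩ rfl)
  · rw [cyl_eq_proj ⟨by linarith, by linarith⟩ (by norm_num)]
    exact proj_glue (Glue.top₂ _ _ rfl rfl ⟨by simpa using h1, h2.le⟩ rfl)
  · rw [cyl_congr (x' := (red x - 3) / 2 + 5) (red_eq_iff.2 ⟨-1, by push_cast; ring⟩),
      cyl_eq_proj ⟨by linarith, by linarith⟩ (by norm_num)]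
    exact proj_glue (Glue.top₃ _ _ rfl rfl ⟨by simpa using h2, h3.le⟩ rfl)
  · rw [cyl_eq_proj ⟨by linarith, by linarith⟩ (by norm_num)]
    exact proj_glue (Glue.top₄ _ _ rfl rfl ⟨by simpa using h3, h6.le⟩ (by simp only; ring))

lemma cyl_nfS (p : Surface) : cyl (nfS p).1 (nfS p).2 = p := by
  obtain ⟨z, rfl⟩ := Quot.exists_rep p
  change cyl (nf z).1 (nf z).2 = proj z
  rw [← cyl_val z]
  unfold nf
  split_ifs with h1 h2
  · rw [h1, cyl_canonB, cyl_top]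
  · rw [h2, cyl_canonB]
  · exact cyl_red _ _

lemma nfS_cyl_zero (x : ℝ) : nfS (cyl x 0) = (canonB x, 0) := by
  rw [← cyl_red, cyl_eq_proj ⟨red_nonneg x, (red_lt x).le⟩ (by norm_num), nfS_proj]
  simp [nf, canonB_congr (red_red x)]

lemma nfS_cyl {x y : ℝ} (h0 : 0 < y) (h1 : y < 1) : nfS (cyl x y) = (red x, y) := by
  rw [← cyl_red, cyl_eq_proj ⟨red_nonneg x, (red_lt x).le⟩ ⟨h0.le, h1.le⟩, nfS_proj]
  simp [nf, h0.ne', h1.ne, red_red x]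

lemma nfS_cyl_one (x : ℝ) : nfS (cyl x 1) = (canonB (glueMap (red x)), 0) := by
  rw [cyl_top, nfS_cyl_zero]

lemma vert_glueMap {x : ℝ} : Vert (glueMap (red x)) ↔ Vert x := by
  have h0 := red_nonneg x
  have h6 := red_lt x
  constructor
  · intro h
    unfold glueMap at h
    unfold Vert
    split_ifs at h with h1 h2 h3
    · rw [Vert, red_of_mem (by linarith) (by linarith)] at h
      rcases h with h | h | h | h
      · linarith
      · left; linarith
      · linarith
      · linarith
    · rw [Vert, red_of_mem (by linarith) (by linarith)] at h
      rcases h with h | h | h | h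
      · right; left; linarith
      all_goals linarith
    · rw [Vert, red_eq_of_add (y := (red x - 3) / 2 + 5) (-1) (by push_cast; ring) (by linarith)
        (by linarith)] at h
      rcases h with h | h | h | h
      · linarith
      · linarith
      · linarith
      · right; right; left; linarith
    · rw [Vert, red_of_mem (by linarith) (by linarith)] at h
      rcases h with h | h | h | h
      · linarith
      · linarith
      · right; right; right; linarith
      · linarith
  · intro h
    have h5 : red (-1) = 5 := red_eq_of_add (-1) (by norm_num) (by norm_num) (by norm_num)
    rcases h with h | h | h | h <;> norm_num [h, glueMap, Vert, red_of_mem, h5]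

lemma mem_sing_iff_nfS (p : Surface) : p ∈ sing ↔ nfS p = (0, 0) ∨ nfS p = (1, 0) := by
  have hv : ∀ x : ℝ, x ∈ ({0, 1, 3, 5, 6} : Set ℝ) → Vert x := by
    rintro x (rfl | rfl | rfl | rfl | rfl) <;> norm_num [Vert, red_of_mem, red_six]
  constructor
  · rintro ⟨z, ⟨hz, hx⟩, rfl⟩
    have h := hv _ hx
    rw [← cyl_val]
    rcases hz with hz | hz <;> rw [hz]
    · rw [nfS_cyl_zero]
      rcases canonB_of_vert h with h | h <;> simp [h]
    · rw [nfS_cyl_one]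
      rcases canonB_of_vert (vert_glueMap.2 h) with h | h <;> simp [h]
  · rintro (h | h) <;> rw [← cyl_nfS p, h, cyl_eq_proj (by norm_num) (by norm_num)] <;>
      exact ⟨_, ⟨Or.inl rfl, by simp⟩, rfl⟩

lemma cyl_zero_mem_sing {x : ℝ} : cyl x 0 ∈ sing ↔ Vert x := by
  rw [mem_sing_iff_nfS, nfS_cyl_zero, vert_iff_canonB]; simp

lemma cyl_one_mem_sing {x : ℝ} : cyl x 1 ∈ sing ↔ Vert x := by
  rw [cyl_top, cyl_zero_mem_sing, vert_glueMap]

lemma cyl_not_mem_sing {x y : ℝ} (h0 : 0 < y) (h1 : y < 1) : cyl x y ∉ sing := by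
  rw [mem_sing_iff_nfS, nfS_cyl h0 h1]; simp [h0.ne']

/-- Points at the same height `< 1`, not singular, have the same abscissa modulo `6`. -/
lemma cyl_inj {x y x' y' : ℝ} (hy : y ∈ Ico (0 : ℝ) 1) (hy' : y' ∈ Ico (0 : ℝ) 1)
    (hp : cyl x y ∉ sing) (h : cyl x y = cyl x' y') : red x = red x' ∧ y = y' := by
  have h2 := congrArg nfS h
  rcases hy.1.lt_or_eq with h0 | h0 <;> rcases hy'.1.lt_or_eq with h0' | h0'
  · rw [nfS_cyl h0 hy.2, nfS_cyl h0' hy'.2] at h2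
    exact Prod.mk.inj h2
  · subst h0'; rw [nfS_cyl h0 hy.2, nfS_cyl_zero] at h2
    exact absurd (Prod.mk.inj h2).2 h0.ne'
  · subst h0; rw [nfS_cyl h0' hy'.2, nfS_cyl_zero] at h2
    exact absurd (Prod.mk.inj h2).2 h0'.ne
  · subst h0 h0'
    have hq := h ▸ hp
    rw [cyl_zero_mem_sing] at hp hq
    rw [nfS_cyl_zero, nfS_cyl_zero, canonB_of_not_vert hp, canonB_of_not_vert hq] at h2
    exact Prod.mk.inj h2

lemma glueMap_injOn {x y : ℝ} (h : red (glueMap (red x)) = red (glueMap (red y))) :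
    red x = red y := by
  have hx := red_nonneg x; have hx' := red_lt x
  have hy := red_nonneg y; have hy' := red_lt y
  obtain ⟨k, hk⟩ := red_eq_iff.1 h
  have m1 := glueMap_mem hx hx'
  have m2 := glueMap_mem hy hy'
  have k0 : k = 0 := by
    have h1 : (-1 : ℝ) < k := by linarith [m1.1, m2.2]
    have h2 : (k : ℝ) < 1 := by linarith [m1.2, m2.1]
    have h1' : (-1 : ℤ) < k := by exact_mod_cast h1
    have h2' : k < 1 := by exact_mod_cast h2
    omega
  rw [k0] at hk
  unfold glueMap at hk
  split_ifs at hk <;> norm_num at hk <;> linarith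

end Disco

namespace Disco

/-! ### The topology of the surface -/

lemma eq_or_of_red_eq {x y : ℝ} (hx : x ∈ Icc (0 : ℝ) 6) (hy : y ∈ Icc (0 : ℝ) 6)
    (h : red x = red y) : x = y ∨ (x = 0 ∧ y = 6) ∨ (x = 6 ∧ y = 0) := by
  rcases hx.2.lt_or_eq with h1 | h1 <;> rcases hy.2.lt_or_eq with h2 | h2
  · rw [red_of_mem hx.1 h1, red_of_mem hy.1 h2] at h; exact Or.inl h
  · rw [red_of_mem hx.1 h1, h2, red_six] at h; exact Or.inr (Or.inl ⟨h, h2⟩)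
  · rw [red_of_mem hy.1 h2, h1, red_six] at h; exact Or.inr (Or.inr ⟨h1, h.symm⟩)
  · exact Or.inl (h1.trans h2.symm)

/-- The vertices of the polygon and the marked points on its horizontal sides. -/
def vertices : Set Polygon :=
  {z | (z.1.2 = 0 ∨ z.1.2 = 1) ∧ z.1.1 ∈ ({0, 1, 3, 5, 6} : Set ℝ)}

lemma vertices_finite : vertices.Finite := by
  have h : (({0, 1, 3, 5, 6} : Set ℝ) ×ˢ ({0, 1} : Set ℝ)).Finite := by
    apply Set.Finite.prod <;> simp
  refine (h.preimage (Subtype.val_injective.injOn (s := Subtype.val ⁻¹' _))).subset ?_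
  rintro z ⟨h1, h2⟩
  exact ⟨h2, by simpa using h1⟩

lemma mem_vertices_of_mem_sing {z : Polygon} (h : proj z ∈ sing) : z ∈ vertices := by
  have key : Vert z.1.1 → z.1.1 ∈ ({0, 1, 3, 5, 6} : Set ℝ) := by
    intro hv
    rcases z.2.1.2.lt_or_eq with h6 | h6
    · simp only [Vert, red_of_mem z.2.1.1 h6] at hv
      simp only [mem_insert_iff, mem_singleton_iff]; tauto
    · rw [h6]; simp
  rcases z.2.2.1.lt_or_eq with h0 | h0 <;> rcases z.2.2.2.lt_or_eq with h1 | h1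
  · rw [← cyl_val] at h; exact absurd h (cyl_not_mem_sing h0 h1)
  · rw [← cyl_val, h1, cyl_one_mem_sing] at h; exact ⟨Or.inr h1, key h⟩
  · rw [← cyl_val, ← h0, cyl_zero_mem_sing] at h; exact ⟨Or.inl h0.symm, key h⟩
  · rw [← h0] at h1; norm_num at h1

lemma glue_of_top_bottom {z w : Polygon} (hz : z.1.2 = 1) (hw : w.1.2 < 1) (hs : proj z ∉ sing)
    (h : proj z = proj w) : Glue z w := by
  have hv : ¬ Vert z.1.1 := by rwa [← cyl_val, hz, cyl_one_mem_sing] at hs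
  have h' := h
  rw [← cyl_val, ← cyl_val w, hz, cyl_top] at h'
  have hs' := hs
  rw [← cyl_val, hz, cyl_top] at hs'
  obtain ⟨e1, e2⟩ := cyl_inj (by norm_num) ⟨w.2.2.1, hw⟩ hs' h'
  have h6 : z.1.1 < 6 := by
    refine lt_of_le_of_ne z.2.1.2 fun h6 => hv ?_
    left; rw [h6, red_six]
  have hr := red_of_mem z.2.1.1 h6
  rw [hr] at e1
  simp only [Vert, hr, not_or] at hv
  have hw6 : ∀ a, red a = red w.1.1 → 0 < a → a < 6 → w.1.1 = a := by
    intro a ha h1 h2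
    rcases eq_or_of_red_eq ⟨h1.le, h2.le⟩ w.2.1 ha with h | ⟨h, -⟩ | ⟨h, -⟩
    · exact h.symm
    · exact absurd h h1.ne'
    · exact absurd h h2.ne
  obtain ⟨n0, n1, n3, n5⟩ := hv
  have p0 : 0 < z.1.1 := lt_of_le_of_ne z.2.1.1 (Ne.symm n0)
  unfold glueMap at e1
  split_ifs at e1 with h1 h2 h3
  · exact Glue.top₁ _ _ hz e2.symm ⟨p0.le, h1.le⟩ (hw6 _ e1 (by linarith) (by linarith))
  · have := lt_of_le_of_ne (not_lt.1 h1) (Ne.symm n1)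
    exact Glue.top₂ _ _ hz e2.symm ⟨this.le, h2.le⟩ (hw6 _ e1 (by linarith) (by linarith))
  · have := lt_of_le_of_ne (not_lt.1 h2) (Ne.symm n3)
    refine Glue.top₃ _ _ hz e2.symm ⟨this.le, h3.le⟩ (hw6 _ ?_ (by linarith) (by linarith))
    rw [← e1]; exact red_eq_iff.2 ⟨1, by push_cast; ring⟩
  · have := lt_of_le_of_ne (not_lt.1 h3) (Ne.symm n5)
    refine Glue.top₄ _ _ hz e2.symm ⟨this.le, h6.le⟩ ?_
    rw [hw6 _ e1 (by linarith) (by linarith)]; ring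

/-- Off the vertices a class has at most two points, so the generated equivalence relation adds
nothing but reflexivity and symmetry. This makes it closed, since the vertices are finitely many. -/
lemma proj_eq_cases {z w : Polygon} (h : proj z = proj w) :
    z = w ∨ Glue z w ∨ Glue w z ∨ (z ∈ vertices ∧ w ∈ vertices) := by
  by_cases hs : proj z ∈ sing
  · exact Or.inr (Or.inr (Or.inr
      ⟨mem_vertices_of_mem_sing hs, mem_vertices_of_mem_sing (h ▸ hs)⟩))
  have side : red z.1.1 = red w.1.1 → z.1.2 = w.1.2 → z = w ∨ Glue z w ∨ Glue w z ∨
      (z ∈ vertices ∧ w ∈ vertices) := by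
    intro h1 h2
    rcases eq_or_of_red_eq z.2.1 w.2.1 h1 with h | ⟨h, h'⟩ | ⟨h, h'⟩
    · exact Or.inl (Subtype.ext (Prod.ext h h2))
    · exact Or.inr (Or.inl (Glue.side _ _ h h' h2.symm))
    · exact Or.inr (Or.inr (Or.inl (Glue.side _ _ h' h h2)))
  rcases z.2.2.2.lt_or_eq with h1 | h1 <;> rcases w.2.2.2.lt_or_eq with h2 | h2
  · rw [← cyl_val, ← cyl_val w] at h
    rw [← cyl_val] at hs
    obtain ⟨e1, e2⟩ := cyl_inj ⟨z.2.2.1, h1⟩ ⟨w.2.2.1, h2⟩ hs h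
    exact side e1 e2
  · exact Or.inr (Or.inr (Or.inl (glue_of_top_bottom h2 h1 (h ▸ hs) h.symm)))
  · exact Or.inr (Or.inl (glue_of_top_bottom h1 h2 hs h))
  · refine side ?_ (h1.trans h2.symm)
    rw [← cyl_val, ← cyl_val w, h1, h2, cyl_top, cyl_top w.1.1] at h
    rw [← cyl_val, h1, cyl_top] at hs
    exact glueMap_injOn (cyl_inj (by norm_num) (by norm_num) hs h).1

lemma isClosed_glue : IsClosed {p : Polygon × Polygon | Glue p.1 p.2} := by
  have e : {p : Polygon × Polygon | Glue p.1 p.2} =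
      {p | p.1.1.1 = 0 ∧ p.2.1.1 = 6 ∧ p.2.1.2 = p.1.1.2} ∪
      {p | p.1.1.2 = 1 ∧ p.2.1.2 = 0 ∧ p.1.1.1 ∈ Icc (0 : ℝ) 1 ∧ p.2.1.1 = 2 * p.1.1.1 + 1} ∪
      {p | p.1.1.2 = 1 ∧ p.2.1.2 = 0 ∧ p.1.1.1 ∈ Icc (1 : ℝ) 3 ∧ p.2.1.1 = (p.1.1.1 - 1) / 2} ∪
      {p | p.1.1.2 = 1 ∧ p.2.1.2 = 0 ∧ p.1.1.1 ∈ Icc (3 : ℝ) 5 ∧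
        p.2.1.1 = (p.1.1.1 - 3) / 2 + 5} ∪
      {p | p.1.1.2 = 1 ∧ p.2.1.2 = 0 ∧ p.1.1.1 ∈ Icc (5 : ℝ) 6 ∧
        p.2.1.1 = 2 * (p.1.1.1 - 5) + 3} := by
    ext ⟨z, w⟩
    constructor
    · rintro (⟨h1, h2, h3⟩ | ⟨h1, h2, h3, h4⟩ | ⟨h1, h2, h3, h4⟩ | ⟨h1, h2, h3, h4⟩ |
        ⟨h1, h2, h3, h4⟩)
      · exact Or.inl (Or.inl (Or.inl (Or.inl ⟨h1, h2, h3⟩)))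
      · exact Or.inl (Or.inl (Or.inl (Or.inr ⟨h1, h2, h3, h4⟩)))
      · exact Or.inl (Or.inl (Or.inr ⟨h1, h2, h3, h4⟩))
      · exact Or.inl (Or.inr ⟨h1, h2, h3, h4⟩)
      · exact Or.inr ⟨h1, h2, h3, h4⟩
    · rintro ((((⟨h1, h2, h3⟩ | ⟨h1, h2, h3, h4⟩) | ⟨h1, h2, h3, h4⟩) | ⟨h1, h2, h3, h4⟩) |
        ⟨h1, h2, h3, h4⟩)
      · exact Glue.side _ _ h1 h2 h3
      · exact Glue.top₁ _ _ h1 h2 h3 h4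
      · exact Glue.top₂ _ _ h1 h2 h3 h4
      · exact Glue.top₃ _ _ h1 h2 h3 h4
      · exact Glue.top₄ _ _ h1 h2 h3 h4
  have c11 : Continuous fun p : Polygon × Polygon => p.1.1.1 := by fun_prop
  have c12 : Continuous fun p : Polygon × Polygon => p.1.1.2 := by fun_prop
  have c21 : Continuous fun p : Polygon × Polygon => p.2.1.1 := by fun_prop
  have c22 : Continuous fun p : Polygon × Polygon => p.2.1.2 := by fun_prop
  have top : ∀ (a b : ℝ) (f : ℝ → ℝ), Continuous f → IsClosed {p : Polygon × Polygon |
      p.1.1.2 = 1 ∧ p.2.1.2 = 0 ∧ p.1.1.1 ∈ Icc a b ∧ p.2.1.1 = f p.1.1.1} := fun a b f hf =>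
    (isClosed_eq c12 continuous_const).inter ((isClosed_eq c22 continuous_const).inter
      ((isClosed_Icc.preimage c11).inter (isClosed_eq c21 (hf.comp c11))))
  rw [e]
  refine ((((IsClosed.union ?_ ?_).union ?_).union ?_).union ?_)
  · exact (isClosed_eq c11 continuous_const).inter ((isClosed_eq c21 continuous_const).inter
      (isClosed_eq c22 c12))
  · exact top 0 1 (fun x => 2 * x + 1) (by fun_prop)
  · exact top 1 3 (fun x => (x - 1) / 2) (by fun_prop)
  · exact top 3 5 (fun x => (x - 3) / 2 + 5) (by fun_prop)
  · exact top 5 6 (fun x => 2 * (x - 5) + 3) (by fun_prop)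

lemma isClosed_proj_eq : IsClosed {p : Polygon × Polygon | proj p.1 = proj p.2} := by
  have e : {p : Polygon × Polygon | proj p.1 = proj p.2} = {p | p.1 = p.2} ∪
      {p | Glue p.1 p.2} ∪ {p | Glue p.2 p.1} ∪
      ((vertices ×ˢ vertices) ∩ {p | proj p.1 = proj p.2}) := by
    ext ⟨z, w⟩
    constructor
    · intro h
      rcases proj_eq_cases h with h1 | h1 | h1 | h1
      · exact Or.inl (Or.inl (Or.inl h1))
      · exact Or.inl (Or.inl (Or.inr h1))
      · exact Or.inl (Or.inr h1)
      · exact Or.inr ⟨h1, h⟩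
    · rintro (((h | h) | h) | h)
      · exact congrArg proj h
      · exact proj_glue h
      · exact (proj_glue h).symm
      · exact h.2
  rw [e]
  refine ((isClosed_eq continuous_fst continuous_snd).union isClosed_glue |>.union
    (isClosed_glue.preimage continuous_swap)).union ?_
  exact ((vertices_finite.prod vertices_finite).subset inter_subset_left).isClosed

instance : CompactSpace Polygon := by
  have h : IsCompact {z : ℝ × ℝ | z.1 ∈ Icc (0 : ℝ) 6 ∧ z.2 ∈ Icc (0 : ℝ) 1} :=
    (isCompact_Icc (a := (0 : ℝ)) (b := 6)).prod (isCompact_Icc (a := (0 : ℝ)) (b := 1))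
  exact isCompact_iff_compactSpace.1 h

lemma isQuotientMap_proj : Topology.IsQuotientMap proj := isQuotientMap_quot_mk

lemma continuous_proj : Continuous proj := isQuotientMap_proj.continuous

lemma proj_surjective : Function.Surjective proj := isQuotientMap_proj.surjective

/-- The saturation of a closed set is the projection, along the compact polygon, of a closed subset
of the product. With normality of the polygon this yields the Hausdorff property. -/
lemma isClosedMap_proj : IsClosedMap proj := by
  intro K hK
  rw [← isQuotientMap_proj.isClosed_preimage]
  have e : proj ⁻¹' (proj '' K) =
      Prod.fst '' ({p : Polygon × Polygon | proj p.1 = proj p.2} ∩ Prod.snd ⁻¹' K) := by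
    ext z
    constructor
    · rintro ⟨w, hw, h⟩; exact ⟨(z, w), ⟨h.symm, hw⟩, rfl⟩
    · rintro ⟨⟨z', w⟩, ⟨h, hw⟩, rfl⟩; exact ⟨w, hw, h.symm⟩
  rw [e]
  exact ((isClosed_proj_eq.inter (hK.preimage continuous_snd)).isCompact.image
    continuous_fst).isClosed

instance : T2Space Surface := by
  refine ⟨fun p q hpq => ?_⟩
  have hp : IsClosed (proj ⁻¹' {p}) := by
    obtain ⟨z, rfl⟩ := proj_surjective p
    rw [← image_singleton]
    exact (isClosedMap_proj _ isClosed_singleton).preimage continuous_proj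
  have hq : IsClosed (proj ⁻¹' {q}) := by
    obtain ⟨z, rfl⟩ := proj_surjective q
    rw [← image_singleton]
    exact (isClosedMap_proj _ isClosed_singleton).preimage continuous_proj
  obtain ⟨U, V, hU, hV, hpU, hqV, hd⟩ := normal_separation hp hq
    (Disjoint.preimage _ (disjoint_singleton.2 hpq))
  refine ⟨(proj '' Uᶜ)ᶜ, (proj '' Vᶜ)ᶜ, (isClosedMap_proj _ hU.isClosed_compl).isOpen_compl,
    (isClosedMap_proj _ hV.isClosed_compl).isOpen_compl, ?_, ?_, ?_⟩
  · rintro ⟨z, hz, h⟩; exact hz (hpU h)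
  · rintro ⟨z, hz, h⟩; exact hz (hqV h)
  · rw [Set.disjoint_left]
    intro r h1 h2
    obtain ⟨z, rfl⟩ := proj_surjective r
    have hzU : z ∈ U := by by_contra h; exact h1 ⟨z, h, rfl⟩
    have hzV : z ∈ V := by by_contra h; exact h2 ⟨z, h, rfl⟩
    exact Set.disjoint_left.1 hd hzU hzV

/-- The reduction `red` jumps at the multiples of 6. On each closed strip between two of them the
map agrees with a continuous one, since the vertical sides are glued, and the closed strips are then
pasted. -/
lemma continuous_cyl : Continuous fun z : ℝ × ℝ => cyl z.1 z.2 := by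
  have piece : ∀ a : ℤ, ContinuousOn (fun z : ℝ × ℝ => cyl z.1 z.2)
      {z | z.1 ∈ Icc (6 * (a : ℝ)) (6 * a + 6)} := by
    intro a
    have hc : Continuous fun z : ℝ × ℝ => proj ⟨(max 0 (min 6 (z.1 - 6 * a)), max 0 (min 1 z.2)),
        ⟨le_max_left _ _, max_le (by norm_num) (min_le_left _ _)⟩, le_max_left _ _,
        max_le zero_le_one (min_le_left _ _)⟩ :=
      continuous_proj.comp (Continuous.subtype_mk (by fun_prop) _)
    refine hc.continuousOn.congr ?_
    rintro ⟨x, y⟩ ⟨h1, h2⟩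
    simp only at h1 h2 ⊢
    rw [← cyl_eq_proj (x := max 0 (min 6 (x - 6 * a))) (y := max 0 (min 1 y))
      ⟨le_max_left _ _, max_le (by norm_num) (min_le_left _ _)⟩ ⟨le_max_left _ _,
        max_le zero_le_one (min_le_left _ _)⟩]
    have e1 : max 0 (min 6 (x - 6 * a)) = x - 6 * a := by
      rw [min_eq_right (by linarith), max_eq_right (by linarith)]
    have e2 : max 0 (min 1 (max 0 (min 1 y))) = max 0 (min 1 y) := by
      rw [min_eq_right (max_le zero_le_one (min_le_left _ _)), max_eq_right (le_max_left _ _)]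
    rw [e1]
    have e3 : red x = red (x - 6 * a) := red_eq_iff.2 ⟨a, by ring⟩
    simp only [cyl, e2, e3]
  rw [continuous_iff_continuousAt]
  rintro ⟨x, y⟩
  set a := ⌊x / 6⌋
  have h1 : 6 * (a : ℝ) ≤ x := by have := Int.floor_le (x / 6); simp only [a]; linarith
  have h2 : x < 6 * (a : ℝ) + 6 := by
    have := Int.lt_floor_add_one (x / 6); simp only [a]; linarith
  have hcl : ∀ b : ℤ, IsClosed {z : ℝ × ℝ | z.1 ∈ Icc (6 * (b : ℝ)) (6 * b + 6)} := fun b =>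
    isClosed_Icc.preimage continuous_fst
  have hu := (piece (a - 1)).union_of_isClosed (piece a) (hcl _) (hcl _)
  refine hu.continuousAt ?_
  have : {z : ℝ × ℝ | z.1 ∈ Ioo (6 * (a : ℝ) - 6) (6 * a + 6)} ∈ nhds (x, y) :=
    (isOpen_Ioo.preimage continuous_fst).mem_nhds ⟨by simp only; linarith, h2⟩
  refine Filter.mem_of_superset this ?_
  rintro ⟨u, v⟩ ⟨h3, h4⟩
  simp only at h3 h4
  by_cases h : 6 * (a : ℝ) ≤ u
  · exact Or.inr ⟨h, h4.le⟩
  · refine Or.inl ⟨?_, ?_⟩ <;> push_cast <;> linarith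

lemma red_neg {x : ℝ} : red (6 - red x) = red (-x) := by
  obtain ⟨k, hk⟩ := exists_red x
  exact red_eq_iff.2 ⟨1 - k, by rw [hk]; push_cast; ring⟩

lemma halfTurn_cyl (x : ℝ) {y : ℝ} (hy : y ∈ Icc (0 : ℝ) 1) :
    halfTurn (cyl x y) = cyl (-x) (1 - y) := by
  rw [← cyl_red x, cyl_eq_proj ⟨red_nonneg x, (red_lt x).le⟩ hy,
    ← cyl_congr (red_neg (x := x)), cyl_eq_proj
      ⟨by linarith [red_lt x], by linarith [red_nonneg x]⟩
      ⟨by linarith [hy.2], by linarith [hy.1]⟩]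
  rfl

end Disco

namespace Disco

/-! ### Half-leaves -/

/-- The point at height `y` of the segment of direction `(t, 1)` issued from the bottom
point `x`. -/
noncomputable def E (t x y : ℝ) : Surface := cyl (x + t * y) y

variable {t x x' y y' : ℝ}

lemma red_add_congr (h : red x = red x') (c : ℝ) : red (x + c) = red (x' + c) := by
  obtain ⟨k, hk⟩ := red_eq_iff.1 h
  exact red_eq_iff.2 ⟨k, by rw [hk]; ring⟩

lemma E_congr (h : red x = red x') : E t x y = E t x' y := cyl_congr (red_add_congr h _) y

lemma red_ret_inj (h : red (ret t x) = red (ret t x')) : red x = red x' := by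
  have := red_add_congr (glueMap_injOn h) (-t)
  simpa using this

lemma ret_mem : ret t x ∈ Ico (-1 : ℝ) 5 := glueMap_mem (red_nonneg _) (red_lt _)

lemma vert_ret : Vert (ret t x) ↔ Vert (x + t) := vert_glueMap

lemma E_zero : E t x 0 = cyl x 0 := by simp [E]

lemma E_top : E t x 1 = E t (ret t x) 0 := by
  rw [E_zero, E, mul_one, cyl_top]; rfl

lemma E_zero_mem_sing : E t x 0 ∈ sing ↔ Vert x := by rw [E_zero, cyl_zero_mem_sing]

lemma E_top_mem_sing : E t x 1 ∈ sing ↔ Vert (ret t x) := by rw [E_top, E_zero_mem_sing]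

lemma E_not_mem_sing (h0 : 0 < y) (h1 : y < 1) : E t x y ∉ sing := cyl_not_mem_sing h0 h1

lemma E_inj (hy : y ∈ Ico (0 : ℝ) 1) (hy' : y' ∈ Ico (0 : ℝ) 1) (hp : E t x y ∉ sing)
    (h : E t x y = E t x' y') : red x = red x' ∧ y = y' := by
  obtain ⟨h1, rfl⟩ := cyl_inj hy hy' hp h
  have := red_add_congr h1 (-(t * y))
  simp only [add_neg_cancel_right] at this
  exact ⟨this, rfl⟩

lemma exists_E (t : ℝ) (p : Surface) :
    ∃ x ∈ Ico (-1 : ℝ) 5, ∃ y ∈ Ico (0 : ℝ) 1, p = E t x y := by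
  have main : ∃ x, ∃ y ∈ Ico (0 : ℝ) 1, p = E t x y := by
    obtain ⟨z, rfl⟩ := proj_surjective p
    rw [← cyl_val z]
    rcases z.2.2.2.lt_or_eq with h | h
    · exact ⟨z.1.1 - t * z.1.2, z.1.2, ⟨z.2.2.1, h⟩, by simp [E]⟩
    · rw [h, cyl_top, ← E_zero (t := t)]
      exact ⟨_, 0, by norm_num, rfl⟩
  obtain ⟨x, y, hy, rfl⟩ := main
  refine ⟨red (x + 1) - 1, ⟨by linarith [red_nonneg (x + 1)], by linarith [red_lt (x + 1)]⟩, y,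
    hy, E_congr ?_⟩
  obtain ⟨k, hk⟩ := exists_red (x + 1)
  exact red_eq_iff.2 ⟨-k, by rw [hk]; push_cast; ring⟩

lemma continuous_E (t : ℝ) : Continuous fun z : ℝ × ℝ => E t z.1 z.2 :=
  continuous_cyl.comp (f := fun z : ℝ × ℝ => (z.1 + t * z.2, z.2)) (by fun_prop)

/-- The turned segment starts where the top of the old one was, at abscissa x + t, with the sign
changed. -/
lemma halfTurn_E (hy : y ∈ Icc (0 : ℝ) 1) : halfTurn (E t x y) = E t (-x - t) (1 - y) := by
  rw [E, halfTurn_cyl _ hy, E]; congr 1; ring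

lemma exists_of_step {q : Surface} (hy : y ∈ Ico (0 : ℝ) 1) (hp : E t x y ∉ sing)
    (h : Step t (E t x y) q) : ∃ s ∈ Icc y 1, q = E t x s := by
  obtain ⟨z, w, r, hr, hw, hz, rfl⟩ := h
  have hw1 : w.1.1 = z.1.1 + r * t := by rw [hw]
  have hw2 : w.1.2 = z.1.2 + r := by rw [hw]
  rcases z.2.2.2.lt_or_eq with h1 | h1
  · have hz' := hz
    rw [← cyl_val z] at hz'
    obtain ⟨e1, e2⟩ := cyl_inj hy ⟨z.2.2.1, h1⟩ hp hz'.symm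
    refine ⟨y + r, ⟨by linarith, by linarith [w.2.2.2]⟩, ?_⟩
    rw [← cyl_val w, hw1, hw2, ← e2, E]
    refine cyl_congr ?_ _
    rw [← red_add_congr e1 (r * t)]
    congr 1; ring
  -- A representative on the top side only admits the segment of length zero.
  · have hr0 : r = 0 := by linarith [w.2.2.2]
    subst hr0
    refine ⟨y, ⟨le_rfl, hy.2.le⟩, ?_⟩
    rw [← hz]
    congr 1
    exact Subtype.ext (by rw [hw]; simp)

/-- Here `a` is the abscissa in the rectangle at which the segment starts, and `ha6` says that it
does not leave through the right side. The value `a = 0` serves for a segment restarting on the left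
side. -/
lemma step_mk {s a : ℝ} (ht : 0 ≤ t) (hy : 0 ≤ y) (hys : y ≤ s) (hs : s ≤ 1) (ha : 0 ≤ a)
    (ha6 : a + t * (s - y) ≤ 6) (h : red a = red (x + t * y)) : Step t (E t x y) (E t x s) := by
  have hts : 0 ≤ t * (s - y) := mul_nonneg ht (by linarith)
  refine ⟨⟨(a, y), ⟨ha, by linarith⟩, hy, by linarith⟩,
    ⟨(a + t * (s - y), s), ⟨by linarith, ha6⟩, by linarith, hs⟩, s - y, by linarith, ?_, ?_, ?_⟩
  · exact Prod.ext (by simp only; ring) (by simp only; ring)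
  · exact (cyl_eq_proj ⟨ha, by linarith⟩ ⟨hy, by linarith⟩).symm.trans (cyl_congr h _)
  · refine (cyl_eq_proj ⟨by linarith, ha6⟩ ⟨by linarith, hs⟩).symm.trans (cyl_congr ?_ _)
    rw [red_add_congr h]; congr 1; ring

/-- As t ≤ 4 < 6, a segment crosses the vertical sides at most once before reaching the top. The
point `q` is the crossing, or the starting point if there is none. -/
lemma exists_step {s : ℝ} (ht : 0 ≤ t) (ht4 : t ≤ 4) (hy : 0 ≤ y) (hys : y ≤ s)
    (hs : s ≤ 1) : ∃ q, (q = E t x y ∨ (q ∉ sing ∧ Step t (E t x y) q)) ∧ Step t q (E t x s) := by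
  by_cases h6 : red (x + t * y) + t * (s - y) ≤ 6
  · exact ⟨_, Or.inl rfl, step_mk ht hy hys hs (red_nonneg _) h6 (red_red _)⟩
  · push Not at h6
    have hr := red_lt (x + t * y)
    have ht0 : 0 < t := by
      refine lt_of_le_of_ne ht fun h => ?_
      rw [← h] at h6 hr; linarith
    -- The height at which the segment meets the right side.
    set s1 := y + (6 - red (x + t * y)) / t with hs1
    have e1 : t * (s1 - y) = 6 - red (x + t * y) := by rw [hs1]; field_simp; ring
    have hy1 : y < s1 := by rw [hs1]; have := div_pos (sub_pos.2 hr) ht0; linarith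
    have h1s : s1 < s := by
      by_contra h
      have : t * (s - y) ≤ t * (s1 - y) := by gcongr; linarith
      linarith
    refine ⟨E t x s1, Or.inr ⟨E_not_mem_sing (by linarith) (by linarith), ?_⟩, ?_⟩
    · exact step_mk ht hy hy1.le (by linarith) (red_nonneg _) (by linarith) (red_red _)
    · refine step_mk (a := 0) ht (by linarith) h1s.le hs le_rfl ?_ ?_
      · have : t * (s - s1) ≤ 4 * 1 := by gcongr; linarith
        linarith
      · obtain ⟨k, hk⟩ := exists_red (x + t * y)
        refine red_eq_iff.2 ⟨k - 1, ?_⟩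
        have : x + t * s1 = x + t * y + t * (s1 - y) := by ring
        rw [this, e1, hk]; push_cast; ring

lemma reach_cell {s : ℝ} (ht : 0 ≤ t) (ht4 : t ≤ 4) (hy : 0 ≤ y) (hys : y ≤ s) (hs : s ≤ 1)
    (hp : E t x y ∉ sing) (hq : E t x s ∉ sing) : Reach t (E t x y) (E t x s) := by
  obtain ⟨q, h | ⟨h1, h2⟩, h3⟩ := exists_step (x := x) ht ht4 hy hys hs
  · subst h; exact .single ⟨hp, hq, h3⟩
  · exact (Relation.ReflTransGen.single ⟨hp, h1, h2⟩).tail ⟨h1, hq, h3⟩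

lemma reach_next (ht : 0 ≤ t) (ht4 : t ≤ 4) (hy : y ∈ Ico (0 : ℝ) 1) (hp : E t x y ∉ sing)
    (h : ¬ Vert (ret t x)) : Reach t (E t x y) (E t (ret t x) 0) := by
  have := reach_cell ht ht4 hy.1 hy.2.le le_rfl hp (by rwa [E_top_mem_sing])
  rwa [E_top] at this

lemma reach_iterate (ht : 0 ≤ t) (ht4 : t ≤ 4) (hy : y ∈ Ico (0 : ℝ) 1) (hp : E t x y ∉ sing)
    {k : ℕ} (h : ∀ j < k + 1, ¬ Vert ((ret t)^[j + 1] x)) :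
    Reach t (E t x y) (E t ((ret t)^[k + 1] x) 0) := by
  induction k with
  | zero => exact reach_next ht ht4 hy hp (h 0 (by omega))
  | succ k ih =>
    refine (ih fun j hj => h j (by omega)).trans ?_
    rw [Function.iterate_succ_apply' _ (k + 1)]
    have h1 := h k (by omega)
    have h2 := h (k + 1) (by omega)
    rw [Function.iterate_succ_apply' _ (k + 1)] at h2
    exact reach_next ht ht4 (by norm_num) (by rwa [E_zero_mem_sing]) h2

/-- A point of the half-leaf is coded by the number `k` of returns made and the height `s` in the
current cell. Within the first cell one can only move up, whence the condition for `k = 0`. -/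
lemma reach_iff (ht : 0 ≤ t) (ht4 : t ≤ 4) (hy : y ∈ Ico (0 : ℝ) 1) (hp : E t x y ∉ sing)
    {q : Surface} : Reach t (E t x y) q ↔ ∃ k : ℕ, ∃ s ∈ Ico (0 : ℝ) 1, (k = 0 → y ≤ s) ∧
      (∀ j < k, ¬ Vert ((ret t)^[j + 1] x)) ∧ q = E t ((ret t)^[k] x) s := by
  constructor
  · intro h
    induction h with
    | refl => exact ⟨0, y, hy, fun _ => le_rfl, by simp, rfl⟩
    | tail _ h ih =>
      obtain ⟨k, s, hs, h1, h2, rfl⟩ := ih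
      obtain ⟨hb, hc, hst⟩ := h
      obtain ⟨s', hs', rfl⟩ := exists_of_step hs hb hst
      rcases hs'.2.lt_or_eq with h3 | rfl
      · exact ⟨k, s', ⟨hs.1.trans hs'.1, h3⟩, fun h => (h1 h).trans hs'.1, h2, rfl⟩
      · refine ⟨k + 1, 0, by norm_num, by simp, ?_, ?_⟩
        · intro j hj
          rcases (Nat.lt_succ_iff.1 hj).lt_or_eq with h4 | rfl
          · exact h2 j h4
          · rwa [E_top_mem_sing, ← Function.iterate_succ_apply' (ret t)] at hc
        · rw [E_top, Function.iterate_succ_apply']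
  · rintro ⟨k, s, hs, h1, h2, rfl⟩
    cases k with
    | zero =>
      have hq : E t x s ∉ sing := by
        rcases (h1 rfl).lt_or_eq with h | h
        · exact E_not_mem_sing (lt_of_le_of_lt hy.1 h) hs.2
        · rwa [← h]
      exact reach_cell ht ht4 hy.1 (h1 rfl) hs.2.le hp hq
    | succ k =>
      refine (reach_iterate ht ht4 hy hp h2).trans ?_
      have h0 : E t ((ret t)^[k + 1] x) 0 ∉ sing := by
        rw [E_zero_mem_sing]; exact h2 k (by omega)
      refine reach_cell ht ht4 le_rfl hs.1 hs.2.le h0 ?_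
      rcases hs.1.lt_or_eq with h | h
      · exact E_not_mem_sing h hs.2
      · rwa [← h]

lemma endsAt_iff (ht : 0 ≤ t) (ht4 : t ≤ 4) (hy : y ∈ Ico (0 : ℝ) 1) (hp : E t x y ∉ sing)
    {s : Surface} : EndsAt t (E t x y) s ↔ ∃ k : ℕ, (∀ j < k, ¬ Vert ((ret t)^[j + 1] x)) ∧
      Vert ((ret t)^[k + 1] x) ∧ s = E t ((ret t)^[k + 1] x) 0 := by
  constructor
  · rintro ⟨-, hs, q, hr, hst⟩
    have hq : q ∉ sing := by
      rcases Relation.ReflTransGen.cases_tail hr with h | ⟨b, -, h⟩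
      · rwa [h]
      · exact h.2.1
    obtain ⟨k, s1, hs1, h1, h2, rfl⟩ := (reach_iff ht ht4 hy hp).1 hr
    obtain ⟨s', hs', rfl⟩ := exists_of_step hs1 hq hst
    have h3 : s' = 1 := by
      by_contra h
      rcases (hs1.1.trans hs'.1).lt_or_eq with h0 | h0
      · exact E_not_mem_sing h0 (lt_of_le_of_ne hs'.2 h) hs
      · have : s1 = s' := le_antisymm hs'.1 (h0 ▸ hs1.1)
        exact hq (this ▸ hs)
    subst h3
    rw [E_top, ← Function.iterate_succ_apply' (ret t)] at hs ⊢
    exact ⟨k, h2, E_zero_mem_sing.1 hs, rfl⟩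
  · rintro ⟨k, h1, h2, rfl⟩
    refine ⟨hp, E_zero_mem_sing.2 h2, ?_⟩
    have key : ∃ s, s ∈ Ico (0 : ℝ) 1 ∧ E t ((ret t)^[k] x) s ∉ sing ∧
        Reach t (E t x y) (E t ((ret t)^[k] x) s) := by
      cases k with
      | zero => exact ⟨y, hy, hp, .refl⟩
      | succ k =>
        refine ⟨0, by norm_num, ?_, reach_iterate ht ht4 hy hp h1⟩
        rw [E_zero_mem_sing]; exact h1 k (by omega)
    obtain ⟨s, hs, hss, hr⟩ := key
    obtain ⟨q, h3, h4⟩ := exists_step (x := (ret t)^[k] x) ht ht4 hs.1 hs.2.le le_rfl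
    rw [E_top, ← Function.iterate_succ_apply' (ret t)] at h4
    rcases h3 with rfl | ⟨h5, h6⟩
    · exact ⟨_, hr, h4⟩
    · exact ⟨q, hr.tail ⟨hss, h5, h6⟩, h4⟩

/-- The orbit of `x` under the first return map does not meet the singular points, except
possibly at the beginning. -/
def InfOrbit (t x : ℝ) : Prop := ∀ k : ℕ, ¬ Vert ((ret t)^[k + 1] x)

lemma infiniteHalfLeaf_iff (ht : 0 ≤ t) (ht4 : t ≤ 4) (hy : y ∈ Ico (0 : ℝ) 1) :
    InfiniteHalfLeaf t (E t x y) ↔ E t x y ∉ sing ∧ InfOrbit t x := by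
  constructor
  · rintro ⟨hp, h⟩
    refine ⟨hp, fun k => ?_⟩
    induction k using Nat.strong_induction_on with
    | _ k ih =>
      intro hv
      exact h _ ((endsAt_iff ht ht4 hy hp).2 ⟨k, ih, hv, rfl⟩)
  · rintro ⟨hp, h⟩
    refine ⟨hp, fun s hs => ?_⟩
    obtain ⟨k, -, h2, -⟩ := (endsAt_iff ht ht4 hy hp).1 hs
    exact h k h2

lemma InfOrbit.iterate (h : InfOrbit t x) (n : ℕ) : InfOrbit t ((ret t)^[n] x) := fun k => by
  rw [← Function.iterate_add_apply]
  have := h (k + n)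
  rwa [show k + n + 1 = k + 1 + n by ring] at this

/-- The union of the segments issued from the bottom points in `S`. -/
def susp (t : ℝ) (S : Set ℝ) : Set Surface := (fun z : ℝ × ℝ => E t z.1 z.2) '' (S ×ˢ Icc 0 1)

lemma mem_susp {S : Set ℝ} {p : Surface} :
    p ∈ susp t S ↔ ∃ a ∈ S, ∃ s ∈ Icc (0 : ℝ) 1, p = E t a s := by
  constructor
  · rintro ⟨⟨a, s⟩, ⟨h1, h2⟩, rfl⟩; exact ⟨a, h1, s, h2, rfl⟩
  · rintro ⟨a, h1, s, h2, rfl⟩; exact ⟨(a, s), ⟨h1, h2⟩, rfl⟩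

lemma E_mem_susp {S : Set ℝ} (hx : x ∈ S) (hy : y ∈ Icc (0 : ℝ) 1) : E t x y ∈ susp t S :=
  mem_susp.2 ⟨x, hx, y, hy, rfl⟩

lemma isClosed_susp {S : Set ℝ} (h : IsCompact S) : IsClosed (susp t S) :=
  ((h.prod isCompact_Icc).image (continuous_E t)).isClosed

lemma halfLeaf_eq (ht : 0 ≤ t) (ht4 : t ≤ 4) (hy : y ∈ Ico (0 : ℝ) 1) (hp : E t x y ∉ sing)
    (h : InfOrbit t x) {q : Surface} : q ∈ halfLeaf t (E t x y) ↔
      ∃ k : ℕ, ∃ s ∈ Ico (0 : ℝ) 1, (k = 0 → y ≤ s) ∧ q = E t ((ret t)^[k] x) s := by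
  change Reach t _ _ ↔ _
  rw [reach_iff ht ht4 hy hp]
  constructor
  · rintro ⟨k, s, h1, h2, -, h3⟩; exact ⟨k, s, h1, h2, h3⟩
  · rintro ⟨k, s, h1, h2, h3⟩; exact ⟨k, s, h1, h2, fun j _ => h j, h3⟩

/-- The `ω`-limit set of an infinite half-leaf whose crossings with the horizontal curve stay
in a compact interval. -/
lemma omega_eq_susp (ht : 0 ≤ t) (ht4 : t ≤ 4) (hy : y ∈ Ico (0 : ℝ) 1) (hp : E t x y ∉ sing)
    (h : InfOrbit t x) {a b : ℝ} {N₀ : ℕ} (hN : ∀ k ≥ N₀, (ret t)^[k] x ∈ Icc a b) :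
    omega t (E t x y) =
      susp t {c | MapClusterPt c Filter.atTop fun k : ℕ => (ret t)^[k] x} := by
  have hreg : ∀ k : ℕ, ∀ s ∈ Ico (0 : ℝ) 1, (k = 0 → y ≤ s) → E t ((ret t)^[k] x) s ∉ sing := by
    intro k s hs h0
    rcases hs.1.lt_or_eq with h1 | h1
    · exact E_not_mem_sing h1 hs.2
    · subst h1
      cases k with
      | zero => have : y = 0 := le_antisymm (h0 rfl) hy.1
                rwa [this] at hp
      | succ k => rw [E_zero_mem_sing]; exact h k
  apply Subset.antisymm
  · intro q hq
    have hq' : ∀ n : ℕ, q ∈ susp t (closure {c | ∃ k ≥ n + N₀ + 1, c = (ret t)^[k] x}) := by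
      intro n
      have hc : IsCompact (closure {c | ∃ k ≥ n + N₀ + 1, c = (ret t)^[k] x}) := by
        refine isCompact_Icc.of_isClosed_subset isClosed_closure
          (closure_minimal (t := Icc a b) ?_ isClosed_Icc)
        rintro _ ⟨k, hk, rfl⟩
        exact hN k (by omega)
      have h1 : E t ((ret t)^[n + N₀ + 1] x) 0 ∈ halfLeaf t (E t x y) :=
        (halfLeaf_eq ht ht4 hy hp h).2 ⟨_, 0, by norm_num, by simp, rfl⟩
      have h2 := mem_iInter₂.1 hq _ h1
      refine closure_minimal ?_ (isClosed_susp hc) h2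
      intro r hr
      obtain ⟨k, s, hs, -, rfl⟩ := (halfLeaf_eq ht ht4 (by norm_num)
        (hreg _ 0 (by norm_num) (by simp)) (h.iterate _)).1 hr
      rw [← Function.iterate_add_apply]
      exact E_mem_susp (subset_closure ⟨_, by omega, rfl⟩) ⟨hs.1, hs.2.le⟩
    -- For each `n` the point lies over a limit `u n` of late returns. Compactness yields a common
    -- base point, and replacing `u n` by a nearby actual return shows that it is a cluster point.
    choose u hu s hs hqs using fun n => mem_susp.1 (hq' n)
    have hk : ∀ n : ℕ, ∃ k ≥ n, |(ret t)^[k] x - u n| < 1 / ((n : ℝ) + 1) := by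
      intro n
      obtain ⟨_, ⟨k, hk, rfl⟩, hd⟩ := Metric.mem_closure_iff.1 (hu n) (1 / ((n : ℝ) + 1))
        (by positivity)
      exact ⟨k, by omega, by rwa [dist_comm, Real.dist_eq] at hd⟩
    choose κ hκ1 hκ2 using hk
    have hcu : ∀ n, (u n, s n) ∈ Icc a b ×ˢ Icc (0 : ℝ) 1 := fun n =>
      ⟨closure_minimal (by rintro _ ⟨k, hk, rfl⟩; exact hN k (by omega)) isClosed_Icc (hu n), hs n⟩
    obtain ⟨⟨c, r⟩, hcr, φ, hφ, hlim⟩ :=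
      (isCompact_Icc.prod isCompact_Icc).tendsto_subseq hcu
    refine mem_susp.2 ⟨c, ?_, r, hcr.2, ?_⟩
    · have hl1 : Filter.Tendsto (fun n => u (φ n)) Filter.atTop (nhds c) :=
        (continuous_fst.tendsto _).comp hlim
      have hl2 : Filter.Tendsto (fun n => (ret t)^[κ (φ n)] x) Filter.atTop (nhds c) := by
        have h0 : Filter.Tendsto (fun n => (ret t)^[κ (φ n)] x - u (φ n)) Filter.atTop
            (nhds 0) := by
          refine squeeze_zero_norm (fun n => (hκ2 (φ n)).le) ?_
          exact tendsto_one_div_add_atTop_nhds_zero_nat.comp hφ.tendsto_atTop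
        simpa using h0.add hl1
      have hl3 : Filter.Tendsto (fun n => κ (φ n)) Filter.atTop Filter.atTop :=
        Filter.tendsto_atTop_mono (fun n => hκ1 (φ n)) hφ.tendsto_atTop
      exact MapClusterPt.of_comp hl3 hl2.mapClusterPt
    · have hl := ((continuous_E t).tendsto (c, r)).comp hlim
      have he : ((fun z : ℝ × ℝ => E t z.1 z.2) ∘ (fun n => (u n, s n)) ∘ φ) = fun _ => q := by
        funext n; exact (hqs (φ n)).symm
      rw [he] at hl
      exact tendsto_nhds_unique tendsto_const_nhds hl
  · intro q hq
    obtain ⟨c, hc, r, hr, rfl⟩ := mem_susp.1 hq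
    rw [omega, mem_iInter₂]
    intro q hq
    obtain ⟨k, s, hs, h0, rfl⟩ := (halfLeaf_eq ht ht4 hy hp h).1 hq
    have hE : Continuous fun c : ℝ => E t c r :=
      (continuous_E t).comp (f := fun c : ℝ => (c, r)) (by fun_prop)
    have hc' : MapClusterPt (E t c r) Filter.atTop fun n : ℕ => E t ((ret t)^[n] x) r :=
      hc.continuousAt_comp hE.continuousAt
    rw [mem_closure_iff_nhds]
    intro U hU
    obtain ⟨n, hnU, hn⟩ :=
      ((hc'.frequently hU).and_eventually (Filter.eventually_ge_atTop (k + 1))).exists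
    refine ⟨_, hnU, ?_⟩
    rw [halfLeaf_eq ht ht4 hs (hreg k s hs h0) (h.iterate k)]
    rcases hr.2.lt_or_eq with h1 | h1
    · refine ⟨n - k, r, ⟨hr.1, h1⟩, by omega, ?_⟩
      rw [← Function.iterate_add_apply, Nat.sub_add_cancel (by omega)]
    -- The top of a cell is the bottom of the next one.
    · refine ⟨n + 1 - k, 0, by norm_num, by omega, ?_⟩
      rw [← Function.iterate_add_apply, Nat.sub_add_cancel (by omega), h1, E_top,
        Function.iterate_succ_apply']

end Disco

namespace Disco

variable {t x x' y y' : ℝ}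

/-! ### Closed leaves, saddle connections and suspended Cantor sets -/

lemma red_iterate_inj {k : ℕ} (h : red ((ret t)^[k] x) = red ((ret t)^[k] x')) :
    red x = red x' := by
  induction k with
  | zero => exact h
  | succ k ih =>
    rw [Function.iterate_succ_apply', Function.iterate_succ_apply'] at h
    exact ih (red_ret_inj h)

lemma onClosedLeaf_of_periodic (ht : 0 ≤ t) (ht4 : t ≤ 4) (hy : y ∈ Ico (0 : ℝ) 1)
    (hp : E t x y ∉ sing) (h : InfOrbit t x) {n : ℕ} (hn : n ≠ 0)
    (hper : red ((ret t)^[n] x) = red x) : OnClosedLeaf t (E t x y) := by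
  have hs : (y + 1) / 2 ∈ Ioo y 1 := ⟨by linarith [hy.2], by linarith [hy.2]⟩
  have hq : E t x ((y + 1) / 2) ∉ sing := E_not_mem_sing (by linarith [hy.1]) hs.2
  refine ⟨hp, E t x ((y + 1) / 2), fun h => ?_, reach_cell ht ht4 hy.1 hs.1.le hs.2.le hp hq, ?_⟩
  · exact hs.1.ne' (E_inj ⟨by linarith [hy.1], hs.2⟩ hy hq h).2
  · refine (halfLeaf_eq ht ht4 ⟨by linarith [hy.1], hs.2⟩ hq h).2 ⟨n, y, hy, fun h => absurd h hn, ?_⟩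
    exact E_congr hper.symm

lemma not_mem_sing_of_reach {p q : Surface} (h : Reach t q p) (hp : p ∉ sing) : q ∉ sing := by
  rcases Relation.ReflTransGen.cases_head h with h | ⟨b, h, -⟩
  · rwa [h]
  · exact h.1

lemma susp_leaf_of_periodic {x₀ : ℝ} (ht : 0 ≤ t) (ht4 : t ≤ 4) (h : InfOrbit t x₀) {n : ℕ}
    (hn : n ≠ 0) (hper : (ret t)^[n] x₀ = x₀) :
    susp t (range fun k : ℕ => (ret t)^[k] x₀) = leaf t (E t x₀ (1 / 2)) := by
  have hp : E t x₀ (1 / 2) ∉ sing := E_not_mem_sing (by norm_num) (by norm_num)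
  have hI : (1 / 2 : ℝ) ∈ Ico (0 : ℝ) 1 := by norm_num
  have hP : Function.IsPeriodicPt (ret t) n x₀ := hper
  apply Subset.antisymm
  · intro q hq
    obtain ⟨_, ⟨k, rfl⟩, s, hs, rfl⟩ := mem_susp.1 hq
    left
    refine (halfLeaf_eq ht ht4 hI hp h).2 ?_
    rcases hs.2.lt_or_eq with h1 | h1
    · refine ⟨k + n, s, ⟨hs.1, h1⟩, by omega, ?_⟩
      rw [Function.iterate_add_apply, hper]
    · refine ⟨k + 1, 0, by norm_num, by omega, ?_⟩
      rw [h1, E_top, Function.iterate_succ_apply']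
  · rintro q (hq | hq)
    · obtain ⟨k, s, hs, -, rfl⟩ := (halfLeaf_eq ht ht4 hI hp h).1 hq
      exact E_mem_susp ⟨k, rfl⟩ ⟨hs.1, hs.2.le⟩
    · have hq0 := not_mem_sing_of_reach hq hp
      obtain ⟨x, -, y, hy, rfl⟩ := exists_E t q
      obtain ⟨k, s, hs, -, -, h2⟩ := (reach_iff ht ht4 hy hq0).1 hq
      have h3 := (E_inj hI hs hp h2).1
      -- Going forward `n * k - k` steps on the periodic orbit amounts to going back `k` steps;
      -- injectivity of the return map modulo 6 then identifies `x`.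
      have h4 : (ret t)^[k] ((ret t)^[n * k - k] x₀) = x₀ := by
        rw [← Function.iterate_add_apply,
          show k + (n * k - k) = n * k by
            have : k ≤ n * k := Nat.le_mul_of_pos_left k (Nat.pos_of_ne_zero hn)
            omega]
        exact hP.mul_const k
      rw [← h4] at h3
      rw [← E_congr (red_iterate_inj h3)]
      exact E_mem_susp ⟨_, rfl⟩ ⟨hy.1, hy.2.le⟩

lemma finite_range_iterate {f : ℝ → ℝ} {x₀ : ℝ} {n : ℕ} (hn : n ≠ 0) (hper : f^[n] x₀ = x₀) :
    (range fun k : ℕ => f^[k] x₀).Finite := by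
  refine ((Finset.range n).finite_toSet.image fun k : ℕ => f^[k] x₀).subset ?_
  rintro _ ⟨k, rfl⟩
  have hP : Function.IsPeriodicPt f n x₀ := hper
  exact ⟨k % n, by simpa using Nat.mod_lt _ (Nat.pos_of_ne_zero hn), hP.iterate_mod_apply k⟩

/-- The points of the segment issued from a regular bottom point `o` are on other segments only
through the endpoints. -/
lemma exists_of_E_eq {o s s' : ℝ} (ho : ¬ Vert o) (hs : s ∈ Ico (0 : ℝ) 1) (hs' : s' ∈ Icc (0 : ℝ) 1)
    (h : E t o s = E t x s') : red x = red o ∨ (s' = 1 ∧ red (ret t x) = red o) := by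
  have hreg : E t o s ∉ sing := by
    rcases hs.1.lt_or_eq with h1 | h1
    · exact E_not_mem_sing h1 hs.2
    · rwa [← h1, E_zero_mem_sing]
  rcases hs'.2.lt_or_eq with h1 | h1
  · exact Or.inl (E_inj hs ⟨hs'.1, h1⟩ hreg h).1.symm
  · rw [h1, E_top] at h
    exact Or.inr ⟨h1, (E_inj hs (by norm_num) hreg h).1.symm⟩

lemma eq_of_red_eq_mem {o : ℝ} (ho : o ∈ Ioo (-1 : ℝ) 1) (hx : x ∈ Icc (-1 : ℝ) 5)
    (h : red x = red o) : x = o := by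
  obtain ⟨k, hk⟩ := red_eq_iff.1 h
  have h1 : (-1 : ℝ) < k := by linarith [ho.2, hx.1]
  have h2 : (k : ℝ) < 1 := by linarith [ho.1, hx.2]
  have h1' : (-1 : ℤ) < k := by exact_mod_cast h1
  have h2' : k < 1 := by exact_mod_cast h2
  have : k = 0 := by omega
  simpa [this] using hk

/-- Every crossing of the top sides lies over (1, 5), where the ratio is 1/2. There are finitely
many crossings and at least one, so the product is a positive power of 1/2. -/
lemma dilatation_lt_one {x₀ : ℝ} {n : ℕ} (hn : n ≠ 0) (hper : (ret t)^[n] x₀ = x₀)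
    (hO : ∀ k : ℕ, (ret t)^[k] x₀ + t ∈ Ioo (1 : ℝ) 5 ∧ ¬ Vert ((ret t)^[k] x₀)) :
    dilatation (susp t (range fun k : ℕ => (ret t)^[k] x₀)) < 1 := by
  set O := range fun k : ℕ => (ret t)^[k] x₀ with hOdef
  set Z := {z : Polygon | z.1.2 = 1 ∧ proj z ∈ susp t O} with hZ
  have key : ∀ z ∈ Z, z.1.1 ∈ Ioo (1 : ℝ) 5 ∧ z.1.1 - t ∈ O := by
    rintro z ⟨h1, h2⟩
    have e : proj z = E t (z.1.1 - t) 1 := by rw [← cyl_val, h1, E]; simp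
    rw [e] at h2
    obtain ⟨_, ⟨k, rfl⟩, s, hs, h3⟩ := mem_susp.1 h2
    simp only at h3
    have h4 : ∃ k : ℕ, ∃ s ∈ Ico (0 : ℝ) 1, E t ((ret t)^[k] x₀) s = E t (z.1.1 - t) 1 := by
      rcases hs.2.lt_or_eq with h5 | h5
      · exact ⟨k, s, ⟨hs.1, h5⟩, h3.symm⟩
      · refine ⟨k + 1, 0, by norm_num, ?_⟩
        rw [h3, h5, E_top, Function.iterate_succ_apply']
    obtain ⟨k, s, hs, h3⟩ := h4
    have h5 : ∃ j : ℕ, red (z.1.1 - t) = red ((ret t)^[j] x₀) := by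
      rcases exists_of_E_eq (hO k).2 hs (by norm_num) h3 with h5 | ⟨-, h5⟩
      · exact ⟨k, h5⟩
      -- The index `k + (n - 1)` is the predecessor of `k` along the periodic orbit.
      · refine ⟨k + (n - 1), red_ret_inj (t := t) ?_⟩
        rw [h5, ← Function.iterate_succ_apply' (ret t),
          show (k + (n - 1)).succ = k + n by omega, Function.iterate_add_apply, hper]
    obtain ⟨j, hj⟩ := h5
    have h6 := red_add_congr hj t
    rw [sub_add_cancel] at h6
    have h7 := (hO j).1
    have h8 : z.1.1 = (ret t)^[j] x₀ + t := by
      rcases eq_or_of_red_eq z.2.1 ⟨by linarith [h7.1], by linarith [h7.2]⟩ h6 with h | ⟨-, h⟩ | ⟨-, h⟩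
      · exact h
      · linarith [h7.2]
      · linarith [h7.1]
    exact ⟨h8 ▸ h7, ⟨j, by simp only; linarith⟩⟩
  have hfin : Z.Finite := by
    refine Set.Finite.of_injOn (f := fun z : Polygon => z.1.1 - t) (t := O)
      (fun z hz => (key z hz).2) ?_ (finite_range_iterate hn hper)
    intro z hz w hw h
    refine Subtype.ext (Prod.ext ?_ (hz.1.trans hw.1.symm))
    simpa using h
  have hne : Z.Nonempty := by
    have h7 := (hO 0).1
    refine ⟨⟨(x₀ + t, 1), ⟨by simpa using (show (0 : ℝ) ≤ x₀ + t by
      have := h7.1; simp at this; linarith), by have := h7.2; simp at this; simp only; linarith⟩,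
      by norm_num⟩, rfl, ?_⟩
    rw [← cyl_val]
    have : cyl (x₀ + t) 1 = E t x₀ 1 := by simp [E]
    rw [this]
    exact E_mem_susp ⟨0, rfl⟩ (by norm_num)
  have hd : dilatation (susp t O) = ∏ᶠ z ∈ Z, (1 / 2 : ℝ) := by
    refine finprod_mem_congr rfl fun z hz => ?_
    have h := (key z hz).1
    exact if_pos ⟨h.1.le, h.2.le⟩
  rw [hd, finprod_mem_eq_finite_toFinset_prod _ hfin, Finset.prod_const]
  refine pow_lt_one₀ (by norm_num) (by norm_num) ?_
  rw [Finset.card_ne_zero]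
  simpa using hne

/-- The neighbourhood is the complement of the suspension of the abscissas at distance at least `η`
from the periodic orbit; these form a compact set, so the suspension is closed. -/
lemma isAttractingClosedLeaf_susp {x₀ η : ℝ} (ht : 0 ≤ t) (ht4 : t ≤ 4) {n : ℕ} (hn : n ≠ 0)
    (hper : (ret t)^[n] x₀ = x₀)
    (hO : ∀ k : ℕ, (ret t)^[k] x₀ ∈ Ioo (-1 : ℝ) 1 ∧ (ret t)^[k] x₀ + t ∈ Ioo (1 : ℝ) 5 ∧
      ¬ Vert ((ret t)^[k] x₀)) (hη : 0 < η)
    (hU : ∀ x ∈ Ico (-1 : ℝ) 5, ∀ k : ℕ, |x - (ret t)^[k] x₀| < η → InfOrbit t x ∧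
      (∃ N, ∀ j ≥ N, (ret t)^[j] x ∈ Icc (-1 : ℝ) 1) ∧
      {c | MapClusterPt c Filter.atTop fun k : ℕ => (ret t)^[k] x} =
        range fun k : ℕ => (ret t)^[k] x₀) :
    IsAttractingClosedLeaf t (susp t (range fun k : ℕ => (ret t)^[k] x₀)) := by
  have hinf : InfOrbit t x₀ := fun k => (hO _).2.2
  have hP : Function.IsPeriodicPt (ret t) n x₀ := hper
  refine ⟨⟨E t x₀ (1 / 2), ?_, susp_leaf_of_periodic ht ht4 hinf hn hper⟩,
    dilatation_lt_one hn hper fun k => (hO k).2, ?_⟩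
  · exact onClosedLeaf_of_periodic ht ht4 (by norm_num) (E_not_mem_sing (by norm_num) (by norm_num))
      hinf hn (congrArg red hper)
  set N : Set ℝ := Icc (-1) 5 ∩ {x | ∀ k : ℕ, η ≤ |x - (ret t)^[k] x₀|} with hN
  have hNc : IsCompact N := by
    refine isCompact_Icc.inter_right ?_
    have : {x | ∀ k : ℕ, η ≤ |x - (ret t)^[k] x₀|} = ⋂ k : ℕ, {x | η ≤ |x - (ret t)^[k] x₀|} := by
      ext; simp
    rw [this]
    exact isClosed_iInter fun k => isClosed_le continuous_const (by fun_prop)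
  refine ⟨(susp t N)ᶜ, (isClosed_susp hNc).isOpen_compl, ?_, ?_⟩
  · intro q hq hqN
    obtain ⟨_, ⟨k, rfl⟩, s, hs, rfl⟩ := mem_susp.1 hq
    have h1 : ∃ k : ℕ, ∃ s ∈ Ico (0 : ℝ) 1, E t ((ret t)^[k] x₀) s ∈ susp t N := by
      rcases hs.2.lt_or_eq with h1 | h1
      · exact ⟨k, s, ⟨hs.1, h1⟩, hqN⟩
      · refine ⟨k + 1, 0, by norm_num, ?_⟩
        rwa [h1, E_top, ← Function.iterate_succ_apply' (ret t)] at hqN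
    obtain ⟨k, s, hs, hqN⟩ := h1
    obtain ⟨x, hx, s', hs', h2⟩ := mem_susp.1 hqN
    have h3 : ∃ j : ℕ, red x = red ((ret t)^[j] x₀) := by
      rcases exists_of_E_eq (hO k).2.2 hs hs' h2 with h3 | ⟨-, h3⟩
      · exact ⟨k, h3⟩
      · refine ⟨k + (n - 1), red_ret_inj (t := t) ?_⟩
        rw [h3, ← Function.iterate_succ_apply' (ret t),
          show (k + (n - 1)).succ = k + n by omega, Function.iterate_add_apply, hper]
    obtain ⟨j, hj⟩ := h3
    have h4 := eq_of_red_eq_mem (hO j).1 hx.1 hj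
    have h5 := hx.2 j
    rw [h4, sub_self, abs_zero] at h5
    linarith
  · intro p hpU hp
    obtain ⟨x, hx, y, hy, rfl⟩ := exists_E t p
    have h1 : x ∉ N := fun h => hpU (E_mem_susp h ⟨hy.1, hy.2.le⟩)
    have h2 : ∃ k : ℕ, |x - (ret t)^[k] x₀| < η := by
      by_contra h
      push Not at h
      exact h1 ⟨⟨hx.1, hx.2.le⟩, h⟩
    obtain ⟨k, hk⟩ := h2
    obtain ⟨h3, ⟨M, hM⟩, h4⟩ := hU x hx k hk
    exact ⟨(infiniteHalfLeaf_iff ht ht4 hy).2 ⟨hp, h3⟩, by rw [omega_eq_susp ht ht4 hy hp h3 hM, h4]⟩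

/-- The closing condition `he` compares points of the surface and not abscissas, since the
separatrix may come back to another preimage of the same singular point. -/
lemma isClosedSaddleConnection_susp {x₀ : ℝ} (ht : 0 ≤ t) (ht4 : t ≤ 4) {n : ℕ} (hn : n ≠ 0)
    (h0 : Vert x₀) (hv : ∀ k, k ≠ 0 → k < n → ¬ Vert ((ret t)^[k] x₀))
    (he : E t ((ret t)^[n] x₀) 0 = E t x₀ 0) :
    IsClosedSaddleConnection t (susp t {c | ∃ k < n, c = (ret t)^[k] x₀}) := by
  have hI : (1 / 2 : ℝ) ∈ Ico (0 : ℝ) 1 := by norm_num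
  have hp : E t x₀ (1 / 2) ∉ sing := E_not_mem_sing (by norm_num) (by norm_num)
  have hs : E t x₀ 0 ∈ sing := E_zero_mem_sing.2 h0
  have hvn : Vert ((ret t)^[n] x₀) := by rwa [← E_zero_mem_sing (t := t), he]
  refine ⟨E t x₀ (1 / 2), E t x₀ 0, ⟨hp, hs, ?_⟩, ?_, ?_⟩
  · have h6 := red_lt x₀
    have h6' := red_nonneg x₀
    -- A height small enough for the first piece of the separatrix, with t ≤ 4, not to reach the
    -- right side.
    have hε : 0 < (6 - red x₀) / 12 := by linarith
    refine ⟨E t x₀ ((6 - red x₀) / 12), step_mk (a := red x₀) ht le_rfl hε.le (by linarith) h6' ?_ ?_,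
      reach_cell ht ht4 hε.le (by linarith) (by norm_num) (E_not_mem_sing hε (by linarith)) hp⟩
    · have : t * ((6 - red x₀) / 12 - 0) ≤ 4 * ((6 - red x₀) / 12 - 0) := by gcongr
      linarith
    · rw [mul_zero, add_zero, red_red]
  · refine (endsAt_iff ht ht4 hI hp).2 ⟨n - 1, fun j hj => hv _ (by omega) (by omega), ?_⟩
    rw [Nat.sub_add_cancel (Nat.one_le_iff_ne_zero.2 hn)]
    exact ⟨hvn, he.symm⟩
  · apply Subset.antisymm
    · intro q hq
      obtain ⟨_, ⟨k, hk, rfl⟩, s, hs, rfl⟩ := mem_susp.1 hq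
      have main : ∀ k < n, ∀ s ∈ Ico (0 : ℝ) 1, E t ((ret t)^[k] x₀) s ∈
          insert (E t x₀ 0) (leaf t (E t x₀ (1 / 2))) := by
        intro k hk s hs
        cases k with
        | zero =>
          rcases hs.1.lt_or_eq with h1 | h1
          · have hr := E_not_mem_sing (t := t) (x := x₀) h1 hs.2
            rcases le_total s (1 / 2) with h2 | h2
            · exact Or.inr (Or.inr (reach_cell ht ht4 hs.1 h2 (by norm_num) hr hp))
            · exact Or.inr (Or.inl (reach_cell ht ht4 (by norm_num) h2 hs.2.le hp hr))
          · exact Or.inl (by rw [← h1]; rfl)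
        | succ k =>
          refine Or.inr (Or.inl ((reach_iff ht ht4 hI hp).2 ⟨k + 1, s, hs, by omega, ?_, rfl⟩))
          exact fun j hj => hv _ (by omega) (by omega)
      rcases hs.2.lt_or_eq with h1 | h1
      · exact main k hk s ⟨hs.1, h1⟩
      · rw [h1, E_top, ← Function.iterate_succ_apply' (ret t)]
        rcases (Nat.succ_le_of_lt hk).lt_or_eq with h2 | h2
        · exact main _ h2 0 (by norm_num)
        · rw [h2, he]; exact mem_insert _ _
    · rintro q (rfl | hq | hq)
      · exact E_mem_susp ⟨0, Nat.pos_of_ne_zero hn, rfl⟩ (by norm_num)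
      · obtain ⟨k, s, hs, -, h2, rfl⟩ := (reach_iff ht ht4 hI hp).1 hq
        refine E_mem_susp ⟨k, ?_, rfl⟩ ⟨hs.1, hs.2.le⟩
        by_contra h
        have := h2 (n - 1) (by omega)
        rw [Nat.sub_add_cancel (Nat.one_le_iff_ne_zero.2 hn)] at this
        exact this hvn
      · have hq0 := not_mem_sing_of_reach hq hp
        obtain ⟨x, -, y, hy, rfl⟩ := exists_E t q
        obtain ⟨k, s, hs, -, h2, h3⟩ := (reach_iff ht ht4 hy hq0).1 hq
        have h4 := (E_inj hI hs hp h3).1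
        cases k with
        | zero =>
          rw [show E t x y = E t x₀ y from E_congr h4.symm]
          exact E_mem_susp ⟨0, Nat.pos_of_ne_zero hn, rfl⟩ ⟨hy.1, hy.2.le⟩
        | succ k => exact absurd ((vert_congr h4).1 h0) (h2 k (by omega))

/-! ### Suspended Cantor sets and half-leaves in the turned set -/

lemma IsCantorSet.image {X Y : Type*} [TopologicalSpace X] [TopologicalSpace Y] [T2Space Y]
    {S : Set X} {f : X → Y} (hS : IsCantorSet S) (hf : Continuous f) (hi : InjOn f S) :
    IsCantorSet (f '' S) where
  nonempty := hS.nonempty.image f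
  isCompact := hS.isCompact.image hf
  perfect := by
    refine ⟨(hS.isCompact.image hf).isClosed, ?_⟩
    rw [preperfect_iff_nhds]
    rintro _ ⟨x, hx, rfl⟩ U hU
    obtain ⟨y, ⟨hyU, hyS⟩, hne⟩ := preperfect_iff_nhds.1 hS.perfect.acc x hx _
      (hf.continuousAt.preimage_mem_nhds hU)
    exact ⟨f y, ⟨hyU, mem_image_of_mem f hyS⟩, fun h => hne (hi hyS hx h)⟩
  totallyDisconnected := by
    have := isCompact_iff_compactSpace.1 hS.isCompact
    have he : Topology.IsClosedEmbedding (S.domRestrict f) :=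
      (hf.comp continuous_subtype_val).isClosedEmbedding (injOn_iff_injective.1 hi)
    have h1 : IsTotallyDisconnected (univ : Set S) := by
      have : TotallyDisconnectedSpace S :=
        totallyDisconnectedSpace_subtype_iff.2 hS.totallyDisconnected
      exact isTotallyDisconnected_of_totallyDisconnectedSpace _
    have h2 := he.isEmbedding.isTotallyDisconnected_image.2 h1
    rwa [image_univ, range_domRestrict] at h2

/-- A slice at height strictly between 0 and 1 is an injective image of `S`, because `S` has
diameter less than 6. The abscissas of the slice lie in countably many translates of `S`. -/
lemma isTransverselyNullCantor_susp {S : Set ℝ} (hS : IsCantorSet S) (hS1 : S ⊆ Icc (-1) 1)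
    (h0 : volume S = 0) : IsTransverselyNullCantor (susp t S) := by
  have hS5 : ∀ a ∈ S, ∀ b ∈ S, red a = red b → a = b := by
    intro a ha b hb h
    obtain ⟨k, hk⟩ := red_eq_iff.1 h
    have ha := hS1 ha
    have hb := hS1 hb
    have h1 : (-1 : ℝ) < k := by linarith [ha.1, hb.2]
    have h2 : (k : ℝ) < 1 := by linarith [ha.2, hb.1]
    have h1' : (-1 : ℤ) < k := by exact_mod_cast h1
    have h2' : k < 1 := by exact_mod_cast h2
    have : k = 0 := by omega
    simpa [this] using hk
  have key : ∀ c ∈ Ioo (0 : ℝ) 1, ∀ u s, s ∈ Icc (0 : ℝ) 1 → ∀ a, cyl u c = E t a s →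
      s = c ∧ red u = red (a + t * c) := by
    intro c hc u s hs a h
    have hn := congrArg nfS h
    rw [nfS_cyl hc.1 hc.2] at hn
    rcases hs.1.lt_or_eq with h1 | h1
    · rcases hs.2.lt_or_eq with h2 | h2
      · rw [E, nfS_cyl h1 h2] at hn
        obtain ⟨e1, e2⟩ := Prod.mk.inj hn
        exact ⟨e2.symm, by rw [e1, e2]⟩
      · rw [h2, E, nfS_cyl_one] at hn
        exact absurd (Prod.mk.inj hn).2 hc.1.ne'
    · rw [← h1, E_zero, nfS_cyl_zero] at hn
      exact absurd (Prod.mk.inj hn).2 hc.1.ne'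
  refine ⟨isClosed_susp hS.isCompact, fun c hc => ⟨?_, ?_⟩⟩
  · have e : susp t S ∩ horizontal c = (fun a => E t a c) '' S := by
      apply Subset.antisymm
      · rintro q ⟨h1, z, hz, rfl⟩
        obtain ⟨a, ha, s, hs, h2⟩ := mem_susp.1 h1
        have h3 := h2
        rw [← cyl_val, hz] at h3
        rw [h2, (key c hc _ s hs a h3).1]
        exact mem_image_of_mem _ ha
      · rintro _ ⟨a, ha, rfl⟩
        refine ⟨E_mem_susp ha ⟨hc.1.le, hc.2.le⟩, ?_⟩
        simp only
        rw [E, ← cyl_red, cyl_eq_proj ⟨red_nonneg _, (red_lt _).le⟩ ⟨hc.1.le, hc.2.le⟩]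
        exact ⟨_, rfl, rfl⟩
    rw [e]
    refine hS.image ((continuous_E t).comp (f := fun a : ℝ => (a, c)) (by fun_prop)) ?_
    intro a ha b hb h
    exact hS5 a ha b hb (E_inj ⟨hc.1.le, hc.2⟩ ⟨hc.1.le, hc.2⟩ (E_not_mem_sing hc.1 hc.2) h).1
  · refine measure_mono_null (t := ⋃ k : ℤ, (fun x => x + (-(t * c) - 6 * k)) ⁻¹' S) ?_ ?_
    · rintro x ⟨z, hz, h1⟩
      obtain ⟨a, ha, s, hs, h2⟩ := mem_susp.1 h1
      rw [← cyl_val, hz] at h2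
      obtain ⟨k, hk⟩ := red_eq_iff.1 (key c hc _ s hs a h2).2
      simp only [mem_iUnion, mem_preimage]
      refine ⟨k, ?_⟩
      have hk' : x = a + t * c + 6 * k := hk
      rw [hk']
      convert ha using 1; ring
    · rw [measure_iUnion_null_iff]
      intro k
      rw [measure_preimage_add_right, h0]

lemma halfLeaf_subset_halfTurn {S : Set ℝ} (ht : 0 ≤ t) (ht4 : t ≤ 4) (hy : y ∈ Ico (0 : ℝ) 1)
    (hp : E t x y ∉ sing) (h : InfOrbit t x)
    (hS : ∀ k : ℕ, ∃ a ∈ S, red a = red (-(ret t)^[k] x - t)) :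
    halfLeaf t (E t x y) ⊆ halfTurn '' susp t S := by
  intro q hq
  obtain ⟨k, s, hs, -, rfl⟩ := (halfLeaf_eq ht ht4 hy hp h).1 hq
  obtain ⟨a, ha, hr⟩ := hS k
  have hs' : 1 - s ∈ Icc (0 : ℝ) 1 := ⟨by linarith [hs.2], by linarith [hs.1]⟩
  refine ⟨E t a (1 - s), E_mem_susp ha hs', ?_⟩
  rw [E_congr hr, halfTurn_E hs']
  congr 1 <;> ring

end Disco

namespace Disco

/-! ### The contracted rotation and its expanding left inverse -/

/-- The lift of the contracted rotation `v ↦ v / 2 + δ` modulo `1`. -/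
noncomputable def F (δ v : ℝ) : ℝ := v / 2 + ⌊v⌋ / 2 + δ

/-- The continuous monotone left inverse of `F`. -/
noncomputable def G (δ u : ℝ) : ℝ := (u - δ) + |u - δ - round (u - δ)|

variable {δ u v w y y' : ℝ}

/-- The slot [δ + k, δ + k + 1/2] is the closure of the image of [k, k + 1) under `F`. Slots
alternate with gaps, the jumps of `F` at the integers. -/
lemma G_of_slot (k : ℤ) (h1 : δ + k ≤ u) (h2 : u ≤ δ + k + 1 / 2) : G δ u = 2 * (u - δ) - k := by
  have hf : ⌊u - δ⌋ = k := Int.floor_eq_iff.2 ⟨by linarith, by linarith⟩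
  have h3 : Int.fract (u - δ) = u - δ - k := by rw [Int.fract, hf]
  rw [G, abs_sub_round_eq_min, h3, min_eq_left (by linarith)]; ring

lemma G_of_gap (k : ℤ) (h1 : δ + k + 1 / 2 ≤ u) (h2 : u ≤ δ + k + 1) : G δ u = k + 1 := by
  rcases h2.lt_or_eq with h2 | h2
  · have hf : ⌊u - δ⌋ = k := Int.floor_eq_iff.2 ⟨by linarith, by linarith⟩
    have h3 : Int.fract (u - δ) = u - δ - k := by rw [Int.fract, hf]
    rw [G, abs_sub_round_eq_min, h3, min_eq_right (by linarith)]; ring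
  · rw [G_of_slot (k + 1) (by push_cast; linarith) (by push_cast; linarith)]
    push_cast; linarith

lemma F_of_mem (k : ℤ) (h1 : (k : ℝ) ≤ v) (h2 : v < k + 1) : F δ v = δ + k + (v - k) / 2 := by
  rw [F, Int.floor_eq_iff.2 ⟨h1, h2⟩]; ring

/-- For u ≤ u' the interval from u to u' either lies in one slot, where `G` doubles its length, or
overlaps a gap. Applied with u = u' it locates a single point. -/
lemma slot_or_gap (δ u u' : ℝ) :
    (∃ k : ℤ, δ + k ≤ u ∧ u' ≤ δ + k + 1 / 2) ∨
      ∃ k : ℤ, δ + k ≤ u ∧ u < δ + k + 1 ∧ δ + k + 1 / 2 < u' := by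
  have h1 := Int.floor_le (u - δ)
  have h2 := Int.lt_floor_add_one (u - δ)
  by_cases h3 : u' ≤ δ + ⌊u - δ⌋ + 1 / 2
  · exact Or.inl ⟨⌊u - δ⌋, by linarith, h3⟩
  · exact Or.inr ⟨⌊u - δ⌋, by linarith, by linarith, not_le.1 h3⟩

lemma continuous_G (δ : ℝ) : Continuous (G δ) := by
  have h : Continuous fun s : ℝ => |s - round s| := by
    have : (fun s : ℝ => |s - round s|) = fun s : ℝ => ‖(s : UnitAddCircle)‖ := by
      funext s; rw [UnitAddCircle.norm_eq]
    rw [this]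
    exact continuous_norm.comp (AddCircle.continuous_mk' 1)
  exact (continuous_id.sub continuous_const).add (h.comp (continuous_id.sub continuous_const))

/-- The distance to the nearest integer is the norm on the circle, hence 1-Lipschitz, so adding it
to the identity keeps monotonicity. -/
lemma monotone_G (δ : ℝ) : Monotone (G δ) := by
  intro u v h
  have h1 : ‖((u - δ : ℝ) : UnitAddCircle)‖ - ‖((v - δ : ℝ) : UnitAddCircle)‖ ≤ v - u := by
    refine (norm_sub_norm_le _ _).trans ?_
    rw [← AddCircle.coe_sub, UnitAddCircle.norm_eq]
    have := round_le (u - δ - (v - δ)) 0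
    simp only [Int.cast_zero, sub_zero] at this
    refine this.trans ?_
    rw [abs_sub_comm, abs_of_nonneg] <;> linarith
  rw [UnitAddCircle.norm_eq, UnitAddCircle.norm_eq] at h1
  unfold G; linarith

lemma G_add_int (δ u : ℝ) (k : ℤ) : G δ (u + k) = G δ u + k := by
  unfold G
  rw [show u + k - δ = u - δ + k by ring, round_add_intCast]
  push_cast
  rw [show u - δ + k - (round (u - δ) + k : ℝ) = u - δ - round (u - δ) by ring]; ring

lemma F_add_int (δ v : ℝ) (k : ℤ) : F δ (v + k) = F δ v + k := by
  unfold F; rw [Int.floor_add_intCast]; push_cast; ring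

lemma G_F (δ v : ℝ) : G δ (F δ v) = v := by
  have h1 := Int.floor_le v
  have h2 := Int.lt_floor_add_one v
  rw [F_of_mem ⌊v⌋ h1 h2, G_of_slot ⌊v⌋ (by linarith) (by linarith)]; ring

lemma F_G (k : ℤ) (h1 : δ + k ≤ u) (h2 : u < δ + k + 1 / 2) : F δ (G δ u) = u := by
  rw [G_of_slot k h1 h2.le, F_of_mem k (by linarith) (by linarith)]; ring

/-- Inequalities about the discontinuous iterates of `F` become inequalities about the continuous
iterates of `G`; all the visiting arguments rest on this. -/
lemma gc_G_F (δ : ℝ) : GaloisConnection (G δ) (F δ) := by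
  intro u v
  constructor
  · intro h
    by_contra hlt
    push Not at hlt
    have h1 := Int.floor_le v
    have h2 := Int.lt_floor_add_one v
    have hF := F_of_mem (δ := δ) ⌊v⌋ h1 h2
    -- Truncating `u` to the slot containing `F δ v` puts it where `G` is known to be affine.
    set b := min u (δ + ⌊v⌋ + 1 / 2)
    have hb : F δ v < b := lt_min hlt (by rw [hF]; linarith)
    have hG : G δ b = 2 * (b - δ) - ⌊v⌋ :=
      G_of_slot _ (by rw [hF] at hb; linarith) (min_le_right _ _)
    have := (monotone_G δ (min_le_left u (δ + ⌊v⌋ + 1 / 2))).trans h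
    change G δ b ≤ v at this
    rw [hG] at this
    rw [hF] at hb
    linarith
  · intro h
    have := monotone_G δ h
    rwa [G_F] at this

lemma gc_iterate (δ : ℝ) (k : ℕ) : GaloisConnection (G δ)^[k] (F δ)^[k] := by
  induction k with
  | zero => exact GaloisConnection.id
  | succ k ih =>
    rw [Function.iterate_succ', Function.iterate_succ]
    exact ih.compose (gc_G_F δ)

lemma G_F_iterate (δ v : ℝ) (k : ℕ) : (G δ)^[k] ((F δ)^[k] v) = v :=
  (Function.LeftInverse.iterate (G_F δ) k) v

lemma G_iterate_F_iterate (δ v : ℝ) {j k : ℕ} (h : j ≤ k) :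
    (G δ)^[j] ((F δ)^[k] v) = (F δ)^[k - j] v := by
  conv_lhs => rw [← Nat.add_sub_cancel' h, Function.iterate_add_apply]
  exact G_F_iterate _ _ _

lemma monotone_G_iterate (δ : ℝ) (k : ℕ) : Monotone (G δ)^[k] := (monotone_G δ).iterate k

lemma continuous_G_iterate (δ : ℝ) (k : ℕ) : Continuous (G δ)^[k] := (continuous_G δ).iterate k

lemma F_lt_of_lt_G {k : ℕ} (h : v < (G δ)^[k] u) : (F δ)^[k] v < u :=
  not_le.1 fun hle => not_le.2 h ((gc_iterate δ k _ _).2 hle)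

lemma lt_F_of_G_lt {k : ℕ} (h : (G δ)^[k] u < v) : u < (F δ)^[k] v := by
  refine lt_of_le_of_ne ((gc_iterate δ k).le_iff_le.1 h.le) fun h' => ?_
  rw [h', G_F_iterate] at h
  exact lt_irrefl _ h

lemma G_iterate_add_int (δ u : ℝ) (k : ℕ) (i : ℤ) : (G δ)^[k] (u + i) = (G δ)^[k] u + i := by
  induction k with
  | zero => rfl
  | succ k ih => rw [Function.iterate_succ_apply', ih, G_add_int, Function.iterate_succ_apply']

lemma F_iterate_add_int (δ u : ℝ) (k : ℕ) (i : ℤ) : (F δ)^[k] (u + i) = (F δ)^[k] u + i := by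
  induction k with
  | zero => rfl
  | succ k ih => rw [Function.iterate_succ_apply', ih, F_add_int, Function.iterate_succ_apply']

lemma G_iterate_sub_int (δ u : ℝ) (k : ℕ) (i : ℤ) : (G δ)^[k] (u - i) = (G δ)^[k] u - i := by
  have := G_iterate_add_int δ u k (-i)
  push_cast at this
  simpa [sub_eq_add_neg] using this

lemma F_iterate_sub_int (δ u : ℝ) (k : ℕ) (i : ℤ) : (F δ)^[k] (u - i) = (F δ)^[k] u - i := by
  have := F_iterate_add_int δ u k (-i)
  push_cast at this
  simpa [sub_eq_add_neg] using this

lemma G_iterate_int (δ : ℝ) (k : ℕ) (i : ℤ) : (G δ)^[k] (i : ℝ) = (G δ)^[k] 0 + i := by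
  simpa using G_iterate_add_int δ 0 k i

lemma F_iterate_int (δ : ℝ) (k : ℕ) (i : ℤ) : (F δ)^[k] (i : ℝ) = (F δ)^[k] 0 + i := by
  simpa using F_iterate_add_int δ 0 k i

lemma closedGap_of_G_eq_int {i : ℤ} (h : G δ u = i) : δ + i - 1 / 2 ≤ u ∧ u ≤ δ + i := by
  rcases slot_or_gap δ u u with ⟨k, h1, h2⟩ | ⟨k, h0, h1, h2⟩
  · rw [G_of_slot k h1 h2] at h
    have h3 : (k : ℝ) ≤ i := by linarith
    have h4 : (i : ℝ) ≤ k + 1 := by linarith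
    have h3' : k ≤ i := by exact_mod_cast h3
    have h4' : i ≤ k + 1 := by exact_mod_cast h4
    have : i = k ∨ i = k + 1 := by omega
    rcases this with rfl | rfl
    · constructor <;> linarith
    · push_cast at h ⊢; constructor <;> linarith
  · rw [G_of_gap k h2.le h1.le] at h
    constructor <;> linarith

lemma G_eq_int {i : ℤ} (h1 : δ + i - 1 / 2 ≤ u) (h2 : u ≤ δ + i) : G δ u = i := by
  rw [G_of_gap (i - 1) (by push_cast; linarith) (by push_cast; linarith)]; push_cast; ring

/-- A point whose image under `G` is no integer lies in the interior of a slot. -/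
lemma exists_slot (h : ∀ i : ℤ, G δ u ≠ i) : ∃ k : ℤ, δ + k < u ∧ u < δ + k + 1 / 2 := by
  rcases slot_or_gap δ u u with ⟨k, h1, h2⟩ | ⟨k, h0, h1, h2⟩
  · refine ⟨k, lt_of_le_of_ne h1 fun h' => h k ?_, lt_of_le_of_ne h2 fun h' => h (k + 1) ?_⟩
    · exact G_eq_int (by linarith) h'.symm.le
    · exact G_eq_int (by push_cast; linarith) (by push_cast; linarith)
  · exact absurd (G_of_gap k h2.le h1.le) (by simpa using h (k + 1))

/-- The open gaps in the image of `F`. -/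
def Gap (δ u : ℝ) : Prop := ∃ k : ℤ, δ + k + 1 / 2 < u ∧ u < δ + k + 1

lemma not_gap_F (δ v : ℝ) : ¬ Gap δ (F δ v) := by
  rintro ⟨k, h1, h2⟩
  have h3 := Int.floor_le v
  have h4 := Int.lt_floor_add_one v
  rw [F_of_mem ⌊v⌋ h3 h4] at h1 h2
  have h5 : (k : ℝ) < ⌊v⌋ := by
    have : (k : ℝ) < ⌊v⌋ + 1 := by linarith
    have h6 : k < ⌊v⌋ + 1 := by exact_mod_cast this
    have h7 : k ≠ ⌊v⌋ := by rintro rfl; linarith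
    have h8 : k < ⌊v⌋ := by omega
    exact_mod_cast h8
  have h9 : (k : ℝ) + 1 ≤ ⌊v⌋ := by
    have : k < ⌊v⌋ := by exact_mod_cast h5
    have : k + 1 ≤ ⌊v⌋ := by omega
    exact_mod_cast this
  linarith

lemma isOpen_gap (δ : ℝ) : IsOpen {u | Gap δ u} := by
  have : {u | Gap δ u} = ⋃ k : ℤ, Ioo (δ + k + 1 / 2) (δ + k + 1) := by
    ext u; simp [Gap]
  rw [this]; exact isOpen_iUnion fun k => isOpen_Ioo

/-- The `F`-orbit of `y` contains no integer. -/
def Inf (δ y : ℝ) : Prop := ∀ (k : ℕ) (i : ℤ), (F δ)^[k] y ≠ i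

lemma Inf.iterate (h : Inf δ y) (n : ℕ) : Inf δ ((F δ)^[n] y) := fun k i => by
  rw [← Function.iterate_add_apply]; exact h _ i

lemma Inf.sub_int (h : Inf δ y) (m : ℤ) : Inf δ (y - m) := fun k i hk => by
  rw [F_iterate_sub_int] at hk
  exact h k (i + m) (by push_cast; linarith)

/-! #### The symmetry -/

/-- Reflection of the circle replaces δ by 1/2 - δ. For `F` this holds only off the integers, where
`F` is right-continuous; it exchanges the two sides of the discontinuity. -/
lemma G_neg (δ u : ℝ) : G (1 / 2 - δ) (-u) = -G δ u := by
  rcases slot_or_gap δ u u with ⟨k, h1, h2⟩ | ⟨k, h0, h1, h2⟩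
  · rw [G_of_slot k h1 h2, G_of_slot (-k - 1) (by push_cast; linarith) (by push_cast; linarith)]
    push_cast; ring
  · rw [G_of_gap k h2.le h1.le, G_of_gap (-k - 2) (by push_cast; linarith) (by push_cast; linarith)]
    push_cast; ring

lemma G_iterate_neg (δ u : ℝ) (k : ℕ) : (G (1 / 2 - δ))^[k] (-u) = -(G δ)^[k] u := by
  induction k with
  | zero => rfl
  | succ k ih => rw [Function.iterate_succ_apply', ih, G_neg, Function.iterate_succ_apply']

lemma F_neg (h : ∀ i : ℤ, y ≠ i) : F (1 / 2 - δ) (-y) = -F δ y := by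
  have h1 := lt_of_le_of_ne (Int.floor_le y) (h _).symm
  have h2 := Int.lt_floor_add_one y
  rw [F_of_mem ⌊y⌋ h1.le h2,
    F_of_mem (-⌊y⌋ - 1) (by push_cast; linarith) (by push_cast; linarith)]
  push_cast; ring

lemma F_iterate_neg (h : Inf δ y) (k : ℕ) : (F (1 / 2 - δ))^[k] (-y) = -(F δ)^[k] y := by
  induction k with
  | zero => rfl
  | succ k ih =>
    rw [Function.iterate_succ_apply', ih, F_neg (h k), Function.iterate_succ_apply']

lemma Inf.neg (h : Inf δ y) : Inf (1 / 2 - δ) (-y) := fun k i hk => by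
  rw [F_iterate_neg h] at hk
  exact h k (-i) (by push_cast; linarith)

/-! #### Irrational case -/

/-- The orbit of `0` under `G` does not come back to the integers. -/
def Irr (δ : ℝ) : Prop := ∀ n : ℕ, n ≠ 0 → ∀ i : ℤ, (G δ)^[n] 0 ≠ i

lemma Irr.symm (h : Irr δ) : Irr (1 / 2 - δ) := fun n hn i hi => by
  have := G_iterate_neg δ 0 n
  rw [neg_zero, hi] at this
  exact h n hn (-i) (by push_cast; linarith)

/-- The `G`-orbit of 0 stays in the interior of the slots, where `F` inverts `G`. -/
lemma Irr.F_G_iterate (h : Irr δ) (a c : ℕ) : (F δ)^[a] ((G δ)^[a + c] 0) = (G δ)^[c] 0 := by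
  induction a with
  | zero => simp
  | succ a ih =>
    rw [Function.iterate_succ_apply, show a + 1 + c = (a + c) + 1 by ring,
      Function.iterate_succ_apply' (G δ)]
    obtain ⟨k, h1, h2⟩ := exists_slot (δ := δ) (u := (G δ)^[a + c] 0) fun i => by
      rw [← Function.iterate_succ_apply' (G δ)]; exact h _ (by omega) i
    rw [F_G k h1.le h2, ih]

lemma Irr.G_ne (h : Irr δ) {a b : ℕ} (hab : a < b) (i : ℤ) :
    (G δ)^[b] 0 ≠ (G δ)^[a] 0 + i := fun he => by
  have h1 := h.F_G_iterate a (b - a)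
  rw [Nat.add_sub_cancel' hab.le, he, F_iterate_add_int] at h1
  have h2 := h.F_G_iterate a 0
  rw [add_zero] at h2
  rw [h2] at h1
  exact h (b - a) (by omega) i (by simpa using h1.symm)

/-- If a periodic orbit met an integer, the orbit of 0 would be periodic modulo the integers. Hence
periodic orbits stay in open slots and are expanding. -/
lemma Irr.G_ne_int_of_periodic (h : Irr δ) {s : ℝ} {r : ℕ} (hr : r ≠ 0) {i : ℤ}
    (hs : (G δ)^[r] s - i = s) {j : ℕ} (hj : j ≠ 0) (m : ℤ) : (G δ)^[j] s ≠ m := fun hm => by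
  have hper : ∀ k : ℕ, (G δ)^[r * k] s = s + (k * i : ℤ) := by
    intro k
    induction k with
    | zero => simp
    | succ k ih =>
      rw [Nat.mul_succ, add_comm, Function.iterate_add_apply, ih, G_iterate_add_int]
      push_cast; linarith
  have h1 : (G δ)^[j] ((G δ)^[r * j] s) = m + (j * i : ℤ) := by
    rw [hper, G_iterate_add_int, hm]
  have h2 : (G δ)^[j] ((G δ)^[r * j] s) = (G δ)^[r * j] 0 + m := by
    rw [← Function.iterate_add_apply, add_comm, Function.iterate_add_apply, hm, G_iterate_int]
  exact h (r * j) (Nat.mul_ne_zero hr hj) (j * i) (by linarith)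

lemma Irr.expanding (h : Irr δ) {s : ℝ} {r : ℕ} (hr : r ≠ 0) {i : ℤ}
    (hs : (G δ)^[r] s - i = s) (n : ℕ) :
    ∀ᶠ u in nhds s, (G δ)^[n] u - (G δ)^[n] s = 2 ^ n * (u - s) := by
  induction n with
  | zero => simp
  | succ n ih =>
    obtain ⟨k, h1, h2⟩ := exists_slot (δ := δ) (u := (G δ)^[n] s) fun m => by
      rw [← Function.iterate_succ_apply' (G δ)]
      exact h.G_ne_int_of_periodic hr hs (by omega) m
    have h3 := (continuous_G_iterate δ n).continuousAt.preimage_mem_nhds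
      (isOpen_Ioo.mem_nhds (⟨h1, h2⟩ : (G δ)^[n] s ∈ Ioo (δ + k) (δ + k + 1 / 2)))
    filter_upwards [ih, h3] with u hu hu'
    rw [Function.iterate_succ_apply', Function.iterate_succ_apply', G_of_slot k h1.le h2.le,
      G_of_slot k hu'.1.le hu'.2.le, pow_succ]
    linarith

lemma iterate_sub_eq (δ u : ℝ) (r k : ℕ) (i : ℤ) :
    (fun u => (G δ)^[r] u - i)^[k] u = (G δ)^[r * k] u - (k * i : ℤ) := by
  induction k with
  | zero => simp
  | succ k ih =>
    rw [Function.iterate_succ_apply', ih, Nat.mul_succ, add_comm, Function.iterate_add_apply,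
      G_iterate_sub_int]
    push_cast; ring

/-- Put φ = G^r - i. The orbit of 0 under φ decreases to -∞, so a translate of `y` falls between two
consecutive points φ^(k+1)(0) and φ^k(0). The iterate F^(rk) takes it between φ(0) and 0, up to an
integer. -/
lemma Irr.visit (h : Irr δ) {r : ℕ} (hr : r ≠ 0) {i : ℤ} (hi : (G δ)^[r] 0 < i) (hy : Inf δ y) :
    ∃ (k : ℕ) (m : ℤ), (F δ)^[k] y - m ∈ Ioo ((G δ)^[r] 0 - i) 0 := by
  set φ : ℝ → ℝ := fun u => (G δ)^[r] u - i with hφ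
  have hmono : Monotone φ := fun a b hab => sub_le_sub_right (monotone_G_iterate δ r hab) _
  have hanti : Antitone fun k : ℕ => φ^[k] 0 :=
    hmono.antitone_iterate_of_map_le (by simp only [hφ]; linarith)
  have hcont : Continuous φ := (continuous_G_iterate δ r).sub continuous_const
  -- A bounded orbit would converge to a fixed point, near which φ expands by 2^r. It would then be
  -- stationary, and 0 would return to its own orbit modulo the integers.
  have hunb : ¬ BddBelow (range fun k : ℕ => φ^[k] 0) := by
    intro hb
    have hlim := tendsto_atTop_ciInf hanti hb
    set s := ⨅ k : ℕ, φ^[k] 0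
    have hfix : φ s = s := isFixedPt_of_tendsto_iterate hlim hcont.continuousAt
    obtain ⟨k, hk⟩ := (hlim.eventually (h.expanding hr hfix r)).exists
    have h1 : s ≤ φ^[k] 0 := ciInf_le hb k
    have h2 : φ^[k + 1] 0 ≤ φ^[k] 0 := hanti (Nat.le_succ k)
    have h3 : φ^[k + 1] 0 - s = 2 ^ r * (φ^[k] 0 - s) := by
      rw [← hk, Function.iterate_succ_apply']
      nth_rw 1 [← hfix]
      simp only [hφ]; ring
    have h4 : (2 : ℝ) ≤ 2 ^ r := by
      calc (2 : ℝ) = 2 ^ 1 := by norm_num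
        _ ≤ 2 ^ r := pow_le_pow_right₀ (by norm_num) (Nat.one_le_iff_ne_zero.2 hr)
    have h5 : φ^[k] 0 = s := by nlinarith
    have h6 : φ^[k + 1] 0 = φ^[k] 0 := by
      rw [Function.iterate_succ_apply', h5, hfix]
    rw [iterate_sub_eq, iterate_sub_eq] at h6
    refine h.G_ne (a := r * k) (b := r * (k + 1))
      (Nat.mul_lt_mul_of_pos_left (Nat.lt_succ_self k) (Nat.pos_of_ne_zero hr)) i ?_
    push_cast at h6; linarith
  obtain ⟨m, hm⟩ := exists_int_gt y
  set y₁ := y - m with hy₁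
  have hex : ∃ k : ℕ, φ^[k] 0 < y₁ := by
    by_contra hne
    push Not at hne
    exact hunb ⟨y₁, by rintro _ ⟨k, rfl⟩; exact hne k⟩
  classical
  have hk0 : Nat.find hex ≠ 0 := fun h0 => by
    have := Nat.find_spec hex
    rw [h0] at this
    simp only [Function.iterate_zero, id] at this
    linarith
  obtain ⟨k, hk⟩ := Nat.exists_eq_succ_of_ne_zero hk0
  have h1 : φ^[k + 1] 0 < y₁ := by have := Nat.find_spec hex; rwa [hk] at this
  have h2 : y₁ ≤ φ^[k] 0 := not_lt.1 (Nat.find_min hex (by omega))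
  have hF : (F δ)^[r * k] (φ^[k] 0) = -(k * i : ℤ) := by
    rw [iterate_sub_eq, F_iterate_sub_int]
    have := h.F_G_iterate (r * k) 0
    rw [add_zero] at this
    rw [this]; simp
  -- Equality would send the orbit of `y` to an integer, as F^(rk) brings φ^k(0) back to one.
  have h3 : y₁ < φ^[k] 0 := by
    refine lt_of_le_of_ne h2 fun he => ?_
    rw [← he] at hF
    exact (hy.sub_int m) _ (-(k * i)) (by rw [hF]; push_cast; ring)
  refine ⟨r * k, m - k * i, ?_⟩
  rw [Function.iterate_succ_apply, iterate_sub_eq] at h1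
  rw [iterate_sub_eq] at h3
  have h4 := lt_F_of_G_lt (δ := δ) (k := r * k) (v := y₁ + (k * i : ℤ)) (u := φ 0) (by linarith)
  have h5 := F_lt_of_lt_G (δ := δ) (k := r * k) (v := y₁ + (k * i : ℤ)) (u := 0) (by linarith)
  rw [F_iterate_add_int, F_iterate_sub_int] at h4 h5
  push_cast at h4 h5 ⊢
  constructor
  · simp only [hφ] at h4; linarith
  · linarith

/-- The images of [0, ε] under `G` double in length until one overlaps a gap. One step later the
image contains a left neighbourhood of an integer starting at a point of the orbit of 0. `Irr.visit`
applies to this interval, and iterating `F` pulls the visit back to (0, ε). -/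
lemma Irr.visit_right (h : Irr δ) (hy : Inf δ y) {ε : ℝ} (hε : 0 < ε) :
    ∃ (k : ℕ) (m : ℤ), (F δ)^[k] y - m ∈ Ioo 0 ε := by
  have hM : ∃ M : ℕ, ∃ k : ℤ, (G δ)^[M] 0 < δ + k + 1 ∧ δ + k + 1 / 2 < (G δ)^[M] ε := by
    by_contra hne
    have hslot : ∀ M : ℕ, ∃ k : ℤ, δ + k ≤ (G δ)^[M] 0 ∧ (G δ)^[M] ε ≤ δ + k + 1 / 2 := by
      intro M
      rcases slot_or_gap δ ((G δ)^[M] 0) ((G δ)^[M] ε) with h1 | ⟨k, -, h1, h2⟩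
      · exact h1
      · exact absurd ⟨M, k, h1, h2⟩ hne
    have hlen : ∀ M : ℕ, (G δ)^[M] ε - (G δ)^[M] 0 = 2 ^ M * ε := by
      intro M
      induction M with
      | zero => simp
      | succ M ih =>
        obtain ⟨k, h1, h2⟩ := hslot M
        have h3 := monotone_G_iterate δ M hε.le
        rw [Function.iterate_succ_apply', Function.iterate_succ_apply',
          G_of_slot k h1 (h3.trans h2), G_of_slot k (h1.trans h3) h2, pow_succ]
        linarith
    obtain ⟨M, hM⟩ := pow_unbounded_of_one_lt (1 / ε) (one_lt_two (α := ℝ))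
    obtain ⟨k, h1, h2⟩ := hslot M
    have h3 := hlen M
    rw [div_lt_iff₀ hε] at hM
    linarith
  obtain ⟨M, k, h1, h2⟩ := hM
  have h3 : (G δ)^[M + 1] 0 < (k + 1 : ℤ) := by
    refine lt_of_le_of_ne ?_ (h _ (by omega) _)
    rw [Function.iterate_succ_apply']
    have h4 := monotone_G δ h1.le
    rw [G_of_gap k (by linarith) le_rfl] at h4
    push_cast; exact h4

  have h4 : ((k + 1 : ℤ) : ℝ) ≤ (G δ)^[M + 1] ε := by
    rw [Function.iterate_succ_apply']
    have h4 := monotone_G δ h2.le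
    rw [G_of_gap k le_rfl (by linarith)] at h4
    push_cast; exact h4
  obtain ⟨j, m, h5, h6⟩ := h.visit (by omega : M + 1 ≠ 0) h3 hy
  have h7 := lt_F_of_G_lt (δ := δ) (k := M + 1) (u := 0) (v := (F δ)^[j] y - (m - (k + 1) : ℤ))
    (by push_cast at h5 ⊢; linarith)
  have h8 := F_lt_of_lt_G (δ := δ) (k := M + 1) (u := ε) (v := (F δ)^[j] y - (m - (k + 1) : ℤ))
    (by push_cast at h4 ⊢; linarith)
  rw [F_iterate_sub_int, ← Function.iterate_add_apply] at h7 h8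
  exact ⟨M + 1 + j, _, h7, h8⟩

lemma Irr.visit_left (h : Irr δ) (hy : Inf δ y) {ε : ℝ} (hε : 0 < ε) :
    ∃ (k : ℕ) (m : ℤ), (F δ)^[k] y - m ∈ Ioo (-ε) 0 := by
  obtain ⟨k, m, h1, h2⟩ := h.symm.visit_right hy.neg hε
  rw [F_iterate_neg hy] at h1 h2
  exact ⟨k, -m, by push_cast; linarith, by push_cast; linarith⟩

/-- The points whose orbit under `G` avoids the open gaps. -/
def core (δ : ℝ) : Set ℝ := {v | ∀ n : ℕ, ¬ Gap δ ((G δ)^[n] v)}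

lemma isClosed_core (δ : ℝ) : IsClosed (core δ) := by
  have : core δ = ⋂ n : ℕ, (G δ)^[n] ⁻¹' {u | Gap δ u}ᶜ := by ext v; simp [core]
  rw [this]
  exact isClosed_iInter fun n =>
    (isOpen_gap δ).isClosed_compl.preimage (continuous_G_iterate δ n)

/-- An interval around a core point doubles under `G` until it overlaps a gap. As the core point is
outside the open gap, the interval contains an edge of it. The edges are the one-sided limits of `F`
at integers, so visits close to 0 on the correct side are mapped into the interval. -/
lemma Irr.visit_core (h : Irr δ) (hy : Inf δ y) (n : ℕ) : ∀ {u a u' : ℝ}, a ∈ core δ → u < a →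
    a < u' → 1 / 2 < 2 ^ n * (u' - u) → ∃ (k : ℕ) (m : ℤ), (F δ)^[k] y - m ∈ Ioo u u' := by
  have gap : ∀ {u a u' : ℝ} (k : ℤ), a ∈ core δ → u < a → a < u' → u < δ + k + 1 →
      δ + k + 1 / 2 < u' → ∃ (k : ℕ) (m : ℤ), (F δ)^[k] y - m ∈ Ioo u u' := by
    intro u a u' k ha h1 h2 h3 h4
    have h5 : a ≤ δ + k + 1 / 2 ∨ δ + k + 1 ≤ a := by
      by_contra hne
      push Not at hne
      exact ha 0 ⟨k, hne.1, hne.2⟩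
    rcases h5 with h5 | h5
    -- The left edge of the gap is the limit of `F` from the left at k + 1.
    · obtain ⟨j, m, h6, h7⟩ := h.visit_left hy (ε := min 1 (δ + k + 1 / 2 - u))
        (lt_min one_pos (by linarith))
      have h8 := min_le_left 1 (δ + k + 1 / 2 - u)
      have h9 := min_le_right 1 (δ + k + 1 / 2 - u)
      have hF : F δ ((F δ)^[j] y - (m - (k + 1) : ℤ)) = δ + k + (((F δ)^[j] y - m + 1)) / 2 := by
        rw [F_of_mem k (by push_cast; linarith) (by push_cast; linarith)]; push_cast; ring
      have e := F_iterate_sub_int δ ((F δ)^[j] y) 1 (m - (k + 1))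
      simp only [Function.iterate_one] at e
      rw [e, ← Function.iterate_succ_apply' (F δ)] at hF
      refine ⟨j + 1, m - (k + 1), ?_⟩
      rw [hF]
      constructor <;> linarith
    · obtain ⟨j, m, h6, h7⟩ := h.visit_right hy (ε := min 1 (u' - (δ + k + 1)))
        (lt_min one_pos (by linarith))
      have h8 := min_le_left 1 (u' - (δ + k + 1))
      have h9 := min_le_right 1 (u' - (δ + k + 1))
      have hF : F δ ((F δ)^[j] y - (m - (k + 1) : ℤ)) = δ + k + 1 + (((F δ)^[j] y - m)) / 2 := by
        rw [F_of_mem (k + 1) (by push_cast; linarith) (by push_cast; linarith)]; push_cast; ring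
      have e := F_iterate_sub_int δ ((F δ)^[j] y) 1 (m - (k + 1))
      simp only [Function.iterate_one] at e
      rw [e, ← Function.iterate_succ_apply' (F δ)] at hF
      refine ⟨j + 1, m - (k + 1), ?_⟩
      rw [hF]
      constructor <;> linarith
  induction n with
  | zero =>
    intro u a u' ha h1 h2 hl
    rcases slot_or_gap δ u u' with ⟨k, h3, h4⟩ | ⟨k, -, h3, h4⟩
    · norm_num at hl; linarith
    · exact gap k ha h1 h2 h3 h4
  | succ n ih =>
    intro u a u' ha h1 h2 hl
    rcases slot_or_gap δ u u' with ⟨k, h3, h4⟩ | ⟨k, -, h3, h4⟩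
    · have e1 := G_of_slot (δ := δ) k h3 (by linarith : u ≤ _)
      have e2 := G_of_slot (δ := δ) k (by linarith) h4
      have e3 := G_of_slot (δ := δ) k (by linarith : _ ≤ a) (by linarith)
      have ha' : G δ a ∈ core δ := fun j => by
        have := ha (j + 1)
        rwa [Function.iterate_succ_apply] at this
      obtain ⟨j, m, h5, h6⟩ := ih (u := G δ u) (u' := G δ u') ha' (by linarith) (by linarith) (by
        rw [pow_succ] at hl
        rw [e1, e2]; linarith)
      have h7 := lt_F_of_G_lt (δ := δ) (k := 1) (u := u) (v := (F δ)^[j] y - m) h5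
      have h8 := F_lt_of_lt_G (δ := δ) (k := 1) (u := u') (v := (F δ)^[j] y - m) h6
      rw [F_iterate_sub_int, ← Function.iterate_add_apply] at h7 h8
      exact ⟨1 + j, m, h7, h8⟩
    · exact gap k ha h1 h2 h3 h4

end Disco

namespace Disco

variable {δ u v w y y' : ℝ}

/-! ### Limit sets of the contracted rotation -/

/-- The limit set of the orbit of `y` under the contracted rotation, in `[0, 1]`. -/
def cl (δ y : ℝ) : Set ℝ :=
  {c | MapClusterPt c Filter.atTop fun k : ℕ => Int.fract ((F δ)^[k] y)}

lemma mapClusterPt_iff_abs {a : ℕ → ℝ} {c : ℝ} : MapClusterPt c Filter.atTop a ↔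
    ∀ ε > 0, ∀ N, ∃ k ≥ N, |a k - c| < ε := by
  rw [mapClusterPt_iff_frequently]
  constructor
  · intro h ε hε N
    have := h _ (Metric.ball_mem_nhds c hε)
    obtain ⟨k, hk, hk'⟩ := Filter.frequently_atTop.1 this N
    exact ⟨k, hk, by rwa [Metric.mem_ball, Real.dist_eq] at hk'⟩
  · intro h s hs
    obtain ⟨ε, hε, hs⟩ := Metric.mem_nhds_iff.1 hs
    refine Filter.frequently_atTop.2 fun N => ?_
    obtain ⟨k, hk, hk'⟩ := h ε hε N
    exact ⟨k, hk, hs (by rwa [Metric.mem_ball, Real.dist_eq])⟩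

lemma mapClusterPt_tail {a : ℕ → ℝ} {c : ℝ} (n : ℕ) :
    MapClusterPt c Filter.atTop (fun k => a (k + n)) ↔ MapClusterPt c Filter.atTop a := by
  rw [mapClusterPt_iff_abs, mapClusterPt_iff_abs]
  constructor
  · intro h ε hε N
    obtain ⟨k, hk, h'⟩ := h ε hε N
    exact ⟨k + n, by omega, h'⟩
  · intro h ε hε N
    obtain ⟨k, hk, h'⟩ := h ε hε (N + n)
    exact ⟨k - n, by omega, by simpa only [Nat.sub_add_cancel (by omega : n ≤ k)] using h'⟩

lemma mapClusterPt_congr_of_tendsto {a b : ℕ → ℝ} {c : ℝ}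
    (h : Filter.Tendsto (fun k => a k - b k) Filter.atTop (nhds 0))
    (ha : MapClusterPt c Filter.atTop a) : MapClusterPt c Filter.atTop b := by
  rw [mapClusterPt_iff_abs] at ha ⊢
  intro ε hε N
  obtain ⟨M, hM⟩ := Metric.tendsto_atTop.1 h (ε / 2) (by linarith)
  obtain ⟨k, hk, h1⟩ := ha (ε / 2) (by linarith) (max N M)
  refine ⟨k, (le_max_left _ _).trans hk, ?_⟩
  have h2 := hM k ((le_max_right _ _).trans hk)
  rw [Real.dist_eq, sub_zero] at h2
  rw [abs_lt] at h1 h2 ⊢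
  constructor <;> linarith [h1.1, h1.2, h2.1, h2.2]

lemma cl_iterate (δ y : ℝ) (n : ℕ) : cl δ ((F δ)^[n] y) = cl δ y := by
  ext c
  refine Iff.trans ?_ (mapClusterPt_tail n)
  simp only [cl, ← Function.iterate_add_apply]
  rfl

lemma cl_sub_int (δ y : ℝ) (m : ℤ) : cl δ (y - m) = cl δ y := by
  simp only [cl, F_iterate_sub_int, Int.fract_sub_intCast]

lemma cl_subset_Icc : cl δ y ⊆ Icc 0 1 := by
  intro c hc
  refine isClosed_Icc.closure_subset (mem_closure_iff_nhds.2 fun U hU => ?_)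
  obtain ⟨k, hk⟩ := (hc.frequently hU).exists
  exact ⟨_, hk, Int.fract_nonneg _, (Int.fract_lt_one _).le⟩

/-- A property of orbits that holds for all infinite orbits holds for the tails. -/
lemma exists_fract_mem {a b : ℝ} (ha : 0 ≤ a) (hb : b ≤ 1)
    (h : ∀ y, Inf δ y → ∃ (k : ℕ) (m : ℤ), (F δ)^[k] y - m ∈ Ioo a b) (hy : Inf δ y) (N : ℕ) :
    ∃ k ≥ N, Int.fract ((F δ)^[k] y) ∈ Ioo a b := by
  obtain ⟨k, m, hk⟩ := h _ (hy.iterate N)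
  rw [← Function.iterate_add_apply] at hk
  refine ⟨k + N, by omega, ?_⟩
  have : Int.fract ((F δ)^[k + N] y) = (F δ)^[k + N] y - m :=
    Int.fract_eq_iff.2 ⟨by linarith [hk.1], by linarith [hk.2], m, by ring⟩
  rwa [this]

lemma not_gap_add_int (h : ¬ Gap δ u) (m : ℤ) : ¬ Gap δ (u + m) := by
  rintro ⟨k, h1, h2⟩
  exact h ⟨k - m, by push_cast; linarith, by push_cast; linarith⟩

/-- After more than n steps the point has a G^n-image in the image of `F`, off the open gaps, and
this passes to limits. Conversely core points are visited; the ends 0 and 1 need one-sided visits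
because the fractional part jumps there. -/
lemma Irr.cl_eq (h : Irr δ) (hy : Inf δ y) : cl δ y = core δ ∩ Icc 0 1 := by
  apply Subset.antisymm
  · intro c hc
    refine ⟨fun n hg => ?_, cl_subset_Icc hc⟩
    have hU := (continuous_G_iterate δ n).continuousAt.preimage_mem_nhds
      ((isOpen_gap δ).mem_nhds hg)
    obtain ⟨k, hk, hn⟩ :=
      ((hc.frequently hU).and_eventually (Filter.eventually_ge_atTop (n + 1))).exists
    change Gap δ ((G δ)^[n] (_ - _)) at hk
    rw [G_iterate_sub_int, G_iterate_F_iterate _ _ (by omega),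
      show k - n = (k - n - 1) + 1 by omega, Function.iterate_succ_apply'] at hk
    have := not_gap_add_int (not_gap_F δ ((F δ)^[k - n - 1] y)) (-⌊(F δ)^[k] y⌋)
    push_cast at this
    exact this hk
  · rintro c ⟨hc, h0, h1⟩
    refine mapClusterPt_iff_abs.2 fun ε hε N => ?_
    rcases h0.lt_or_eq with h0 | rfl
    · rcases h1.lt_or_eq with h1 | rfl
      · set η := min ε (min c (1 - c))
        have hη : 0 < η := lt_min hε (lt_min h0 (by linarith))
        have e1 : η ≤ ε := min_le_left _ _
        have e2 : η ≤ c := (min_le_right _ _).trans (min_le_left _ _)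
        have e3 : η ≤ 1 - c := (min_le_right _ _).trans (min_le_right _ _)
        obtain ⟨n, hn⟩ := pow_unbounded_of_one_lt (1 / (4 * η)) (one_lt_two (α := ℝ))
        rw [div_lt_iff₀ (by linarith)] at hn
        obtain ⟨k, hk, hk1, hk2⟩ := exists_fract_mem (δ := δ) (a := c - η) (b := c + η) (by linarith)
          (by linarith) (fun y hy => h.visit_core hy n hc (by linarith) (by linarith)
            (by linarith)) hy N
        exact ⟨k, hk, abs_lt.2 ⟨by linarith, by linarith⟩⟩
      · have hη : 0 < min ε 1 := lt_min hε one_pos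
        obtain ⟨k, hk, hk1, hk2⟩ := exists_fract_mem (δ := δ) (a := 1 - min ε 1) (b := 1)
          (by linarith [min_le_right ε 1]) le_rfl (fun y hy => by
            obtain ⟨k, m, h1, h2⟩ := h.visit_left hy hη
            exact ⟨k, m - 1, by push_cast; linarith, by push_cast; linarith⟩) hy N
        exact ⟨k, hk, abs_lt.2 ⟨by linarith [min_le_left ε 1], by linarith⟩⟩
    · have hη : 0 < min ε 1 := lt_min hε one_pos
      obtain ⟨k, hk, hk1, hk2⟩ := exists_fract_mem (δ := δ) (a := 0) (b := min ε 1) le_rfl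
        (min_le_right ε 1) (fun y hy => h.visit_right hy hη) hy N
      exact ⟨k, hk, abs_lt.2 ⟨by linarith, by linarith [min_le_left ε 1]⟩⟩

/-- A backward orbit that avoids the integers. -/
def Back (δ : ℝ) (v : ℕ → ℝ) : Prop :=
  (∀ k, ∀ i : ℤ, v k ≠ i) ∧ ∀ k, ∃ m : ℤ, v k + m = F δ (v (k + 1))

/-- `G` runs along the backward orbit up to integers, and `F` retraces it. -/
lemma Back.G_iterate {v : ℕ → ℝ} (h : Back δ v) (k : ℕ) :
    ∃ m : ℤ, (G δ)^[k] (v 0) = v k + m ∧ (F δ)^[k] ((G δ)^[k] (v 0)) = v 0 := by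
  induction k with
  | zero => exact ⟨0, by simp⟩
  | succ k ih =>
    obtain ⟨m, h1, h2⟩ := ih
    obtain ⟨l, hl⟩ := h.2 k
    have h3 : G δ (v k) = v (k + 1) - l := by
      have := congrArg (G δ) hl
      rw [G_F, G_add_int] at this
      linarith
    have h4 : F δ (v (k + 1) - l) = v k := by
      have := F_iterate_sub_int δ (v (k + 1)) 1 l
      simp only [Function.iterate_one] at this
      rw [this, ← hl]; ring
    refine ⟨m - l, ?_, ?_⟩
    · rw [Function.iterate_succ_apply', h1, G_add_int, h3]; push_cast; ring
    · rw [Function.iterate_succ_apply' (G δ), Function.iterate_succ_apply (F δ), h1, G_add_int, h3,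
        F_add_int, h4, ← h1, h2]

lemma Back.mem_core {v : ℕ → ℝ} (h : Back δ v) : v 0 ∈ core δ := fun n => by
  obtain ⟨m, h1, -⟩ := h.G_iterate n
  obtain ⟨l, hl⟩ := h.2 n
  rw [h1, show v n + (m : ℝ) = F δ (v (n + 1)) + (m - l : ℤ) by rw [← hl]; push_cast; ring]
  exact not_gap_add_int (not_gap_F _ _) _

lemma Irr.inf_zero (h : Irr δ) {k : ℕ} (hk : k ≠ 0) (i : ℤ) : (F δ)^[k] 0 ≠ i := fun hi => by
  have := G_F_iterate δ 0 k
  rw [hi, G_iterate_int] at this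
  exact h k hk (-i) (by push_cast; linarith)

lemma Irr.inf_F_zero (h : Irr δ) : Inf δ (F δ 0) := fun k i => by
  rw [← Function.iterate_succ_apply]; exact h.inf_zero (by omega) i

lemma isTotallyDisconnected_of_volume_eq_zero {C : Set ℝ} (h : volume C = 0) :
    IsTotallyDisconnected C := by
  intro s hs hpre x hx y hy
  by_contra hne
  have key : ∀ a ∈ s, ∀ b ∈ s, ¬ a < b := by
    intro a ha b hb hlt
    have h2 : volume (Icc a b) = 0 := measure_mono_null ((hpre.Icc_subset ha hb).trans hs) h
    rw [Real.volume_Icc, ENNReal.ofReal_eq_zero] at h2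
    linarith
  exact (lt_or_gt_of_ne hne).elim (key x hx y hy) (key y hy x hx)

/-- Perfectness comes from the orbit of F(0): its points are distinct modulo 1, lie in the core, and
accumulate at every point of it by `Irr.cl_eq`. -/
lemma Irr.isCantorSet (h : Irr δ) (h0 : volume (core δ) = 0) :
    IsCantorSet (core δ ∩ Icc 0 1) where
  nonempty := by
    rw [← h.cl_eq h.inf_F_zero]
    obtain ⟨c, -, hc⟩ := (isCompact_Icc (a := (0 : ℝ)) (b := 1)).exists_mapClusterPt
      (f := Filter.atTop) (u := fun k : ℕ => Int.fract ((F δ)^[k] (F δ 0)))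
      (by
        rw [Filter.le_principal_iff]
        exact Filter.mem_map.2 (Filter.univ_mem' fun k =>
          ⟨Int.fract_nonneg _, (Int.fract_lt_one _).le⟩))
    exact ⟨c, hc⟩
  isCompact := isCompact_Icc.inter_left (isClosed_core δ)
  perfect := by
    refine ⟨(isClosed_core δ).inter isClosed_Icc, preperfect_iff_nhds.2 fun c hc U hU => ?_⟩
    set a : ℕ → ℝ := fun k => Int.fract ((F δ)^[k] (F δ 0))
    have hcl : c ∈ cl δ (F δ 0) := by rwa [h.cl_eq h.inf_F_zero]
    have hinj : ∀ k l : ℕ, k < l → a k ≠ a l := by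
      intro k l hkl he
      obtain ⟨m, hm⟩ := Int.fract_eq_fract.1 he
      have h1 := congrArg ((G δ)^[k]) (show (F δ)^[l] (F δ 0) = (F δ)^[k] (F δ 0) + (-m : ℤ) by
        push_cast; linarith)
      rw [G_iterate_F_iterate _ _ hkl.le, G_iterate_add_int, G_F_iterate,
        ← Function.iterate_succ_apply] at h1
      have h2 := congrArg (G δ) h1
      rw [Function.iterate_succ_apply', G_F, G_add_int, G_F] at h2
      exact h.inf_zero (by omega : l - k ≠ 0) (-m) (by rw [h2]; simp)
    have hmem : ∀ k, a k ∈ core δ ∩ Icc 0 1 := by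
      intro k
      refine ⟨fun n hn => ?_, Int.fract_nonneg _, (Int.fract_lt_one _).le⟩
      simp only [a] at hn
      rw [← Function.iterate_succ_apply, Int.fract, G_iterate_sub_int] at hn
      -- While `n ≤ k` the point is still a value of `F`. Afterwards it runs along the `G`-orbit of
      -- 0, whose points are values of `F` as well.
      have key : ¬ Gap δ ((G δ)^[n] ((F δ)^[k + 1] 0)) := by
        rcases lt_or_ge n (k + 1) with hk | hk
        · rw [G_iterate_F_iterate _ _ hk.le, show k + 1 - n = (k - n) + 1 by omega,
            Function.iterate_succ_apply']
          exact not_gap_F _ _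
        · rw [show n = (n - (k + 1)) + (k + 1) by omega, Function.iterate_add_apply, G_F_iterate]
          obtain ⟨l, h1, h2⟩ := exists_slot (δ := δ) (u := (G δ)^[n - (k + 1)] 0) fun i => by
            rw [← Function.iterate_succ_apply' (G δ)]; exact h _ (by omega) i
          have := h.F_G_iterate 1 (n - (k + 1))
          rw [← this]
          exact not_gap_F _ _
      have := not_gap_add_int key (-⌊(F δ)^[k + 1] 0⌋)
      push_cast at this
      exact this hn
    obtain ⟨k, -, hk⟩ := Filter.frequently_atTop.1 (hcl.frequently hU) 0
    obtain ⟨l, hl', hl⟩ := Filter.frequently_atTop.1 (hcl.frequently hU) (k + 1)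
    by_cases hkc : a k = c
    · exact ⟨a l, ⟨hl, hmem l⟩, fun h' => hinj k l (by omega) (hkc.trans h'.symm)⟩
    · exact ⟨a k, ⟨hk, hmem k⟩, hkc⟩
  totallyDisconnected :=
    isTotallyDisconnected_of_volume_eq_zero (measure_mono_null inter_subset_left h0)

/-! #### Rational case -/

/-- The orbit of `0` under `G` comes back to the integers, for the first time after `n` steps. -/
structure Rat (δ : ℝ) (n : ℕ) (p : ℤ) : Prop where
  ne_zero : n ≠ 0
  eq : (G δ)^[n] 0 = p
  ne : ∀ j, j ≠ 0 → j < n → ∀ i : ℤ, (G δ)^[j] 0 ≠ i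

lemma irr_or_rat (δ : ℝ) : Irr δ ∨ ∃ n p, Rat δ n p := by
  classical
  by_cases h : ∃ n : ℕ, n ≠ 0 ∧ ∃ i : ℤ, (G δ)^[n] 0 = i
  · obtain ⟨h1, p, h2⟩ := Nat.find_spec h
    refine Or.inr ⟨Nat.find h, p, h1, h2, fun j hj hlt i hi => Nat.find_min h hlt ⟨hj, i, hi⟩⟩
  · push Not at h
    exact Or.inl h

lemma Rat.symm {n : ℕ} {p : ℤ} (h : Rat δ n p) : Rat (1 / 2 - δ) n (-p) := by
  have e : ∀ k, (G (1 / 2 - δ))^[k] 0 = -(G δ)^[k] 0 := fun k => by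
    simpa using G_iterate_neg δ 0 k
  refine ⟨h.ne_zero, by rw [e, h.eq]; push_cast; rfl, fun j hj hlt i hi => ?_⟩
  rw [e] at hi
  exact h.ne j hj hlt (-i) (by push_cast; linarith)

/-- The translates by the integers of the points of the orbit of `0` under `G`. -/
def P (δ : ℝ) : Set ℝ := {v | ∃ (j : ℕ) (i : ℤ), v = (G δ)^[j] 0 + i}

lemma P_add_int (h : v ∈ P δ) (i : ℤ) : v + i ∈ P δ := by
  obtain ⟨j, l, rfl⟩ := h
  exact ⟨j, l + i, by push_cast; ring⟩

lemma G_iterate_mem_P (h : v ∈ P δ) (k : ℕ) : (G δ)^[k] v ∈ P δ := by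
  obtain ⟨j, l, rfl⟩ := h
  exact ⟨k + j, l, by rw [G_iterate_add_int, Function.iterate_add_apply]⟩

lemma int_mem_P (δ : ℝ) (i : ℤ) : (i : ℝ) ∈ P δ := ⟨0, i, by simp⟩

lemma inf_of_not_mem_P (h : y ∉ P δ) : Inf δ y := fun k i hi => h ⟨k, i, by
  rw [← G_iterate_int, ← hi, G_F_iterate]⟩

section Rat

variable {n : ℕ} {p : ℤ}

lemma Rat.exists_lt (h : Rat δ n p) (hv : v ∈ P δ) :
    ∃ j < n, ∃ i : ℤ, v = (G δ)^[j] 0 + i := by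
  obtain ⟨j, i, rfl⟩ := hv
  induction j using Nat.strong_induction_on generalizing i with
  | _ j ih =>
    by_cases hj : j < n
    · exact ⟨j, hj, i, rfl⟩
    · obtain ⟨j', h1, i', h2⟩ := ih (j - n) (by have := h.ne_zero; omega) (i + p)
      refine ⟨j', h1, i', ?_⟩
      rw [← h2, show j = (j - n) + n by omega, Function.iterate_add_apply, h.eq, G_iterate_int,
        Nat.add_sub_cancel]
      push_cast; ring

lemma Rat.F_G_iterate (h : Rat δ n p) (a c : ℕ) (hac : a + c < n) :
    (F δ)^[a] ((G δ)^[a + c] 0) = (G δ)^[c] 0 := by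
  induction a with
  | zero => simp
  | succ a ih =>
    rw [Function.iterate_succ_apply, show a + 1 + c = (a + c) + 1 by ring,
      Function.iterate_succ_apply' (G δ)]
    obtain ⟨k, h1, h2⟩ := exists_slot (δ := δ) (u := (G δ)^[a + c] 0) fun i => by
      rw [← Function.iterate_succ_apply' (G δ)]; exact h.ne _ (by omega) (by omega) i
    rw [F_G k h1.le h2, ih (by omega)]

/-- With `inf_of_not_mem_P`, the infinite orbits are exactly those starting off `P`. -/
lemma Rat.not_mem_P (h : Rat δ n p) (hy : Inf δ y) : y ∉ P δ := fun hP => by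
  obtain ⟨j, hj, i, rfl⟩ := h.exists_lt hP
  refine hy j i ?_
  have := h.F_G_iterate j 0 (by omega)
  rw [add_zero] at this
  rw [F_iterate_add_int, this]; simp

lemma Rat.G_n (h : Rat δ n p) (hv : v ∈ P δ) : (G δ)^[n] v = v + p := by
  obtain ⟨j, i, rfl⟩ := hv
  rw [G_iterate_add_int, ← Function.iterate_add_apply, add_comm n j, Function.iterate_add_apply,
    h.eq, G_iterate_int]
  ring

lemma Rat.G_n_mul (h : Rat δ n p) (hv : v ∈ P δ) (k : ℕ) : (G δ)^[n * k] v = v + (k * p : ℤ) := by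
  induction k with
  | zero => simp
  | succ k ih =>
    rw [Nat.mul_succ, add_comm, Function.iterate_add_apply, ih, G_iterate_add_int, h.G_n hv]
    push_cast; ring

lemma Rat.G_inj (h : Rat δ n p) (hv : v ∈ P δ) (hw : w ∈ P δ) {j : ℕ}
    (he : (G δ)^[j] v = (G δ)^[j] w) : v = w := by
  have h1 := h.G_n_mul hv j
  have h2 := h.G_n_mul hw j
  have hj : j ≤ n * j := Nat.le_mul_of_pos_left j (Nat.pos_of_ne_zero h.ne_zero)
  rw [← Nat.sub_add_cancel hj, Function.iterate_add_apply] at h1 h2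
  rw [he, h2] at h1
  linarith

lemma Rat.finite (h : Rat δ n p) (a b : ℝ) : (P δ ∩ Icc a b).Finite := by
  have hsub : P δ ∩ Icc a b ⊆ ⋃ j ∈ Finset.range n, (fun i : ℤ => (G δ)^[j] 0 + i) ''
      (Icc ⌊a - (G δ)^[j] 0⌋ ⌈b - (G δ)^[j] 0⌉) := by
    rintro v ⟨hv, h1, h2⟩
    obtain ⟨j, hj, i, rfl⟩ := h.exists_lt hv
    refine mem_biUnion (by simpa using hj) ⟨i, ⟨?_, ?_⟩, rfl⟩
    · have : ⌊a - (G δ)^[j] 0⌋ ≤ ⌊(i : ℝ)⌋ := Int.floor_le_floor (by linarith)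
      simpa using this
    · have : ⌈(i : ℝ)⌉ ≤ ⌈b - (G δ)^[j] 0⌉ := Int.ceil_le_ceil (by linarith)
      simpa using this
  exact (Set.Finite.biUnion (Finset.finite_toSet _) fun j _ => (finite_Icc _ _).image _).subset hsub

/-- The arc to the right of `0` is visited by all infinite orbits. -/
lemma Rat.exists_arc (h : Rat δ n p) : ∃ β, 0 < β ∧ β ≤ 1 ∧ β ∈ P δ ∧
    (∀ v ∈ P δ, 0 < v → β ≤ v) ∧
    ∀ y, Inf δ y → ∃ (k : ℕ) (m : ℤ), (F δ)^[k] y - m ∈ Ioo 0 β := by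
  have hfin : (P δ ∩ Ioc 0 1).Finite := (h.finite 0 1).subset
    (inter_subset_inter_right _ Ioc_subset_Icc_self)
  have h1 : (1 : ℝ) ∈ P δ ∩ Ioc 0 1 := ⟨by simpa using int_mem_P δ 1, by norm_num⟩
  obtain ⟨β, hβ, hmin⟩ := exists_min_image _ id hfin ⟨1, h1⟩
  simp only [id] at hmin
  have hmin' : ∀ v ∈ P δ, 0 < v → β ≤ v := by
    intro v hv hv0
    rcases le_or_gt v 1 with h2 | h2
    · exact hmin v ⟨hv, hv0, h2⟩
    · exact hβ.2.2.trans h2.le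
  refine ⟨β, hβ.2.1, hβ.2.2, hβ.1, hmin', fun y hy => ?_⟩
  have hfy := h.finite (y - 1) y
  have hne : (P δ ∩ Icc (y - 1) y).Nonempty :=
    ⟨⌊y⌋, int_mem_P δ _, by linarith [Int.lt_floor_add_one y], Int.floor_le y⟩
  -- The point `α` of `P` just to the left of `y` is an image under G^j of an integer `i`; F^j then
  -- takes `y` just to the right of `i`.
  obtain ⟨α, ⟨hα, hα1, hα2⟩, hmax⟩ := exists_max_image _ id hfy hne
  simp only [id] at hmax
  have hαy : α < y := lt_of_le_of_ne hα2 fun he => h.not_mem_P hy (he ▸ hα)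
  obtain ⟨j, hj, i, hi⟩ := h.exists_lt hα
  rw [← G_iterate_int] at hi
  refine ⟨j, i, ?_, ?_⟩
  · have := lt_F_of_G_lt (δ := δ) (k := j) (u := i) (v := y) (by rw [← hi]; exact hαy)
    linarith
  -- Otherwise G^j(β + i) is a point of `P` between `α` and `y`, hence equal to `α`, against the
  -- injectivity of G^j on `P`.
  · by_contra hge
    push Not at hge
    have h2 : (G δ)^[j] (β + i) ≤ y := (gc_iterate δ j _ _).2 (by linarith)
    have hβi := P_add_int hβ.1 i
    have h3 : α ≤ (G δ)^[j] (β + i) := by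
      rw [hi]; exact monotone_G_iterate δ j (by linarith [hβ.2.1])
    have h4 := hmax _ ⟨G_iterate_mem_P hβi j, by linarith, h2⟩
    have h5 := h.G_inj hβi (int_mem_P δ i) (h4.antisymm (hi ▸ h3) |>.trans hi)
    linarith [hβ.2.1]

/-- An integer separating the k-th iterates would be pulled back by G^k to a point of `P` between
`y` and `y'`. Without separation `F` halves the distance. -/
lemma floor_F_iterate (hyy : y ≤ y') (hP : ∀ v ∈ P δ, y < v → y' < v) (k : ℕ) :
    ⌊(F δ)^[k] y⌋ = ⌊(F δ)^[k] y'⌋ ∧ (F δ)^[k] y' - (F δ)^[k] y = (y' - y) / 2 ^ k := by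
  have hF : ∀ k : ℕ, (F δ)^[k] y' - (F δ)^[k] y = (y' - y) / 2 ^ k →
      ⌊(F δ)^[k] y⌋ = ⌊(F δ)^[k] y'⌋ := by
    intro k hk
    have hle : (F δ)^[k] y ≤ (F δ)^[k] y' := by
      have : 0 ≤ (y' - y) / 2 ^ k := by have := sub_nonneg.2 hyy; positivity
      linarith
    refine le_antisymm (Int.floor_le_floor hle) ?_
    by_contra hlt
    push Not at hlt
    have h1 : (F δ)^[k] y < ⌊(F δ)^[k] y'⌋ := Int.floor_lt.1 hlt
    have h2 : y < (G δ)^[k] ⌊(F δ)^[k] y'⌋ := not_le.1 fun h => not_le.2 h1 ((gc_iterate δ k _ _).1 h)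
    have h3 : (G δ)^[k] ⌊(F δ)^[k] y'⌋ ≤ y' := (gc_iterate δ k _ _).2 (Int.floor_le _)
    exact absurd (hP _ (G_iterate_mem_P (int_mem_P δ _) k) h2) (not_lt.2 h3)
  have main : ∀ k : ℕ, (F δ)^[k] y' - (F δ)^[k] y = (y' - y) / 2 ^ k := by
    intro k
    induction k with
    | zero => simp
    | succ k ih =>
      have h1 := hF k ih
      rw [Function.iterate_succ_apply', Function.iterate_succ_apply', F, F, h1, pow_succ]
      have : (y' - y) / (2 ^ k * 2) = (y' - y) / 2 ^ k / 2 := by rw [div_div]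
      rw [this, ← ih]; ring
  exact ⟨hF k (main k), main k⟩

lemma fract_F_iterate (hyy : y ≤ y') (hP : ∀ v ∈ P δ, y < v → y' < v) (k : ℕ) :
    Int.fract ((F δ)^[k] y') - Int.fract ((F δ)^[k] y) = (y' - y) / 2 ^ k := by
  obtain ⟨h1, h2⟩ := floor_F_iterate hyy hP k
  rw [Int.fract, Int.fract, h1, ← h2]; ring

lemma tendsto_div_two_pow (a : ℝ) :
    Filter.Tendsto (fun k : ℕ => a / 2 ^ k) Filter.atTop (nhds 0) := by
  have := (tendsto_pow_atTop_nhds_zero_of_lt_one (r := (1 / 2 : ℝ)) (by norm_num)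
    (by norm_num)).const_mul a
  simp only [mul_zero] at this
  refine this.congr fun k => ?_
  rw [div_pow, one_pow]; ring

lemma cl_eq_of_arc (hyy : y ≤ y') (hP : ∀ v ∈ P δ, y < v → y' < v) : cl δ y = cl δ y' := by
  have h1 : Filter.Tendsto (fun k : ℕ => Int.fract ((F δ)^[k] y') - Int.fract ((F δ)^[k] y))
      Filter.atTop (nhds 0) := by
    simp only [fract_F_iterate hyy hP]; exact tendsto_div_two_pow _
  apply Subset.antisymm
  · intro c hc
    refine mapClusterPt_congr_of_tendsto ?_ hc
    simpa using h1.neg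
  · intro c hc
    exact mapClusterPt_congr_of_tendsto h1 hc

lemma Rat.cl_eq (h : Rat δ n p) (hy : Inf δ y) : cl δ y = cl δ 0 := by
  obtain ⟨β, h0, h1, hβ, hmin, hv⟩ := h.exists_arc
  obtain ⟨k, m, hk⟩ := hv y hy
  rw [← cl_iterate δ y k, ← cl_sub_int δ _ m]
  exact (cl_eq_of_arc hk.1.le fun v hv hv0 => hk.2.trans_le (hmin v hv hv0)).symm

lemma cl_of_periodic (hn : n ≠ 0) {q : ℤ} (hs : (F δ)^[n] y = y + q) :
    cl δ y = range fun k : ℕ => Int.fract ((F δ)^[k] y) := by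
  have hper : ∀ k : ℕ, Int.fract ((F δ)^[k + n] y) = Int.fract ((F δ)^[k] y) := fun k => by
    rw [Function.iterate_add_apply, hs, F_iterate_add_int, Int.fract_add_intCast]
  have hper' : ∀ j k : ℕ, Int.fract ((F δ)^[k + n * j] y) = Int.fract ((F δ)^[k] y) := by
    intro j k
    induction j with
    | zero => simp
    | succ j ih => rw [Nat.mul_succ, ← add_assoc, hper, ih]
  have hfin : (range fun k : ℕ => Int.fract ((F δ)^[k] y)).Finite := by
    refine ((Finset.range n).finite_toSet.image fun k : ℕ => Int.fract ((F δ)^[k] y)).subset ?_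
    rintro _ ⟨k, rfl⟩
    refine ⟨k % n, by simpa using Nat.mod_lt _ (Nat.pos_of_ne_zero hn), ?_⟩
    have := hper' (k / n) (k % n)
    rw [Nat.mod_add_div] at this
    exact this.symm
  apply Subset.antisymm
  · intro c hc
    refine hfin.isClosed.closure_subset (mem_closure_iff_nhds.2 fun U hU => ?_)
    obtain ⟨k, hk⟩ := (hc.frequently hU).exists
    exact ⟨_, hk, k, rfl⟩
  · rintro _ ⟨k, rfl⟩
    refine mapClusterPt_iff_abs.2 fun ε hε N => ⟨k + n * N, ?_, ?_⟩
    · have : N ≤ n * N := Nat.le_mul_of_pos_left N (Nat.pos_of_ne_zero hn)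
      omega
    · rw [hper' N k, sub_self, abs_zero]; exact hε

/-- The first `n` steps of a point of `P` pass through an open gap, on which `G` is constant, so G^n
is locally constant there. -/
lemma Rat.eventually_G_n (h : Rat δ n p) (hg : Gap δ ((G δ)^[n - 1] 0)) (hv : v ∈ P δ) :
    ∀ᶠ u in nhds v, (G δ)^[n] u = v + p := by
  obtain ⟨l, hl, i, rfl⟩ := h.exists_lt hv
  obtain ⟨k, hk1, hk2⟩ := hg
  have h1 : (G δ)^[n - 1 - l] ((G δ)^[l] 0 + i) ∈ Ioo (δ + (k + i : ℤ) + 1 / 2) (δ + (k + i : ℤ) + 1) := by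
    rw [G_iterate_add_int, ← Function.iterate_add_apply,
      show n - 1 - l + l = n - 1 by omega]
    push_cast
    constructor <;> linarith
  have h2 := (continuous_G_iterate δ (n - 1 - l)).continuousAt.preimage_mem_nhds
    (isOpen_Ioo.mem_nhds h1)
  have key : ∀ u, (G δ)^[n - 1 - l] u ∈ Ioo (δ + (k + i : ℤ) + 1 / 2) (δ + (k + i : ℤ) + 1) →
      (G δ)^[n] u = (G δ)^[l] ((k + i : ℤ) + 1) := by
    intro u hu
    rw [show n = l + (1 + (n - 1 - l)) by omega, Function.iterate_add_apply,
      Function.iterate_add_apply _ 1, Function.iterate_one]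
    congr 1
    exact G_of_gap _ hu.1.le hu.2.le
  filter_upwards [h2] with u hu
  rw [key u hu, ← key _ h1, h.G_n ⟨l, i, rfl⟩]

/-- In the interior of a gap there is an attracting periodic orbit. -/
lemma Rat.exists_periodic (h : Rat δ n p) (hg : Gap δ ((G δ)^[n - 1] 0)) :
    ∃ s, Inf δ s ∧ (F δ)^[n] s = s + (-p : ℤ) := by
  obtain ⟨β, h0, h1, hβ, hmin, hv⟩ := h.exists_arc
  have harc : ∀ y, 0 ≤ y → y < β → (F δ)^[n] y = (F δ)^[n] 0 + y / 2 ^ n := by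
    intro y hy0 hyβ
    have := (floor_F_iterate (δ := δ) hy0
      (fun v hv hv0 => hyβ.trans_le (hmin v hv hv0)) n).2
    rw [sub_zero] at this; linarith
  have hpow : (1 : ℝ) < 2 ^ n := one_lt_pow₀ (by norm_num) h.ne_zero
  -- Local constancy of G^n to the right of -p and to the left of β - p gives strict inequalities:
  -- F^n + p maps [0, β) inside, away from both ends.
  have e1 : -(p : ℝ) < (F δ)^[n] 0 := by
    have hz : ((-p : ℤ) : ℝ) ∈ P δ := int_mem_P δ _
    obtain ⟨u, hu, hu'⟩ := ((h.eventually_G_n hg hz).filter_mono nhdsWithin_le_nhds |>.and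
      (self_mem_nhdsWithin : Ioi ((-p : ℤ) : ℝ) ∈ nhdsWithin _ _)).exists
    have h2 : u ≤ (F δ)^[n] 0 := (gc_iterate δ n _ _).1 (by rw [hu]; push_cast; linarith)
    push_cast at hu'; linarith
  have e2 : (F δ)^[n] 0 + β / 2 ^ n < β - p := by
    have hz : β + ((-p : ℤ) : ℝ) ∈ P δ := P_add_int hβ _
    obtain ⟨u, hu, hu'⟩ := ((h.eventually_G_n hg hz).filter_mono nhdsWithin_le_nhds |>.and
      (self_mem_nhdsWithin : Iio (β + ((-p : ℤ) : ℝ)) ∈ nhdsWithin _ _)).exists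
    push_cast at hu hu'
    have h2 : ∀ y, 0 ≤ y → y < β → (F δ)^[n] 0 + y / 2 ^ n < u := by
      intro y hy0 hyβ
      rw [← harc y hy0 hyβ]
      exact F_lt_of_lt_G (by rw [hu]; linarith)
    have h3 : (F δ)^[n] 0 + β / 2 ^ n ≤ u := by
      by_contra hlt
      push Not at hlt
      set y := max 0 (β - (F δ)^[n] 0 - β / 2 ^ n + u) with hy
      have hyβ : y < β := max_lt h0 (by linarith)
      have h4 := h2 y (le_max_left _ _) hyβ
      have h5 : β - y ≤ (F δ)^[n] 0 + β / 2 ^ n - u := by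
        have := le_max_right 0 (β - (F δ)^[n] 0 - β / 2 ^ n + u)
        linarith
      have h6 : (β - y) / 2 ^ n < β - y := div_lt_self (by linarith) hpow
      rw [sub_div] at h6
      linarith
    linarith
  -- The fixed point of the affine contraction F^n + p of slope 1/2^n on the arc.
  set s := ((F δ)^[n] 0 + p) / (1 - 1 / 2 ^ n) with hs
  have hpos : (0 : ℝ) < 1 - 1 / 2 ^ n := by
    have : (1 : ℝ) / 2 ^ n < 1 := by rw [div_lt_one (by positivity)]; exact hpow
    linarith
  have hs0 : 0 < s := div_pos (by linarith) hpos
  have hsβ : s < β := by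
    rw [hs, div_lt_iff₀ hpos]
    have : β * (1 - 1 / 2 ^ n) = β - β / 2 ^ n := by ring
    linarith
  have hsP : s ∉ P δ := fun hP => absurd (hmin s hP hs0) (not_le.2 hsβ)
  refine ⟨s, inf_of_not_mem_P hsP, ?_⟩
  rw [harc s hs0.le hsβ]
  have : s * (1 - 1 / 2 ^ n) = (F δ)^[n] 0 + p := by
    rw [hs, div_mul_cancel₀ _ hpos.ne']
  push_cast
  have e3 : s * (1 - 1 / 2 ^ n) = s - s / 2 ^ n := by ring
  linarith

/-- The start of a backward orbit is recurrent. G^(nk) translates `P` by kp, so v' = G^(nk)(v 0) -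
kp lies in the same arc as `v 0`. F^(nk) contracts this arc by 2^(nk) and sends v' to `v 0` modulo
1, so `v 0` is within 2^(-nk) of its own iterate. -/
lemma Rat.back_mem (h : Rat δ n p) {v : ℕ → ℝ} (hv : Back δ v) :
    Inf δ (v 0) ∧ Int.fract (v 0) ∈ cl δ (v 0) := by
  -- A backward orbit meeting `P` would continue under `G` to an integer, which `Back` excludes.
  have hP : ∀ k, v k ∉ P δ := by
    intro k hk
    have hk' : (G δ)^[k] (v 0) ∈ P δ := by
      obtain ⟨m, h1, -⟩ := hv.G_iterate k
      rw [h1]; exact P_add_int hk m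
    obtain ⟨j, hj, i, hi⟩ := h.exists_lt hk'
    obtain ⟨m, h1, -⟩ := hv.G_iterate (n - j + k)
    rw [Function.iterate_add_apply, hi, G_iterate_add_int, ← Function.iterate_add_apply,
      Nat.sub_add_cancel hj.le, h.eq] at h1
    exact hv.1 (n - j + k) (p + i - m) (by push_cast; linarith)
  refine ⟨inf_of_not_mem_P (hP 0), mapClusterPt_iff_abs.2 fun ε hε N => ?_⟩
  have key : ∀ k : ℕ, |Int.fract ((F δ)^[n * k] (v 0)) - Int.fract (v 0)| =
      |(G δ)^[n * k] (v 0) - (k * p : ℤ) - v 0| / 2 ^ (n * k) := by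
    intro k
    obtain ⟨m, h1, h2⟩ := hv.G_iterate (n * k)
    set v' := (G δ)^[n * k] (v 0) - (k * p : ℤ) with hv'
    have hv'P : v' ∉ P δ := fun hc => by
      have := P_add_int hc (k * p - m)
      rw [hv', h1] at this
      push_cast at this
      exact hP (n * k) (by convert this using 1; ring)
    have h3 : Int.fract ((F δ)^[n * k] v') = Int.fract (v 0) := by
      rw [hv', F_iterate_sub_int, h2, Int.fract_sub_intCast]
    rcases le_total (v 0) v' with hle | hle
    · have h4 := fract_F_iterate (δ := δ) hle (fun w hw hlt => by
        by_contra hge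
        push Not at hge
        have h5 := monotone_G_iterate δ (n * k) hlt.le
        rw [h.G_n_mul hw] at h5
        have : w = v' := le_antisymm hge (by rw [hv']; linarith)
        exact hv'P (this ▸ hw)) (n * k)
      rw [h3] at h4
      rw [abs_sub_comm, h4, abs_div, abs_of_pos (show (0 : ℝ) < 2 ^ (n * k) by positivity)]
    · have h4 := fract_F_iterate (δ := δ) hle (fun w hw hlt => by
        by_contra hge
        push Not at hge
        have h5 := monotone_G_iterate δ (n * k) hge
        rw [h.G_n_mul hw] at h5
        have : w ≤ v' := by rw [hv']; linarith
        linarith) (n * k)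
      rw [h3] at h4
      rw [h4, abs_div, abs_of_pos (show (0 : ℝ) < 2 ^ (n * k) by positivity), abs_sub_comm]
  have hbound : ∀ k : ℕ, |(G δ)^[n * k] (v 0) - (k * p : ℤ) - v 0| ≤ 1 := by
    intro k
    have h1 := monotone_G_iterate δ (n * k) (Int.floor_le (v 0))
    have h2 := monotone_G_iterate δ (n * k) (Int.lt_floor_add_one (v 0)).le
    have e1 := h.G_n_mul (int_mem_P δ ⌊v 0⌋) k
    have e2 := h.G_n_mul (int_mem_P δ (⌊v 0⌋ + 1)) k
    push_cast at e2
    rw [e1] at h1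
    rw [e2] at h2
    have h3 := Int.floor_le (v 0)
    have h4 := Int.lt_floor_add_one (v 0)
    push_cast at h1 h2 ⊢
    rw [abs_le]; constructor <;> linarith
  obtain ⟨K, hK⟩ := exists_pow_lt_of_lt_one hε (by norm_num : (1 / 2 : ℝ) < 1)
  have hle : max N K ≤ n * max N K := Nat.le_mul_of_pos_left _ (Nat.pos_of_ne_zero h.ne_zero)
  refine ⟨n * max N K, (le_max_left _ _).trans hle, ?_⟩
  rw [key]
  calc _ ≤ 1 / 2 ^ (n * max N K) := by gcongr; exact hbound _
    _ = (1 / 2 : ℝ) ^ (n * max N K) := by rw [div_pow, one_pow]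
    _ ≤ (1 / 2 : ℝ) ^ K := pow_le_pow_of_le_one (by norm_num) (by norm_num)
      ((le_max_right _ _).trans hle)
    _ < ε := hK

end Rat

end Disco

namespace Disco

/-! ### The parameter set -/

/-- The displacement of `θ` under the `n`-th iterate of the doubling map. -/
def disp (n : ℕ) (θ : ℝ) : ℝ := (2 ^ n - 1) * θ

/-- The parameters for which the orbit of `0` falls into an open gap. -/
def gapParam : Set ℝ := {θ | ∃ n, 1 / 2 < Int.fract (disp n θ)}

variable {θ : ℝ}

lemma disp_add (k j : ℕ) (θ : ℝ) : disp (k + j) θ = disp j θ + 2 ^ j * disp k θ := by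
  unfold disp; rw [pow_add]; ring

lemma disp_zero (θ : ℝ) : disp 0 θ = 0 := by simp [disp]

lemma half_lt_fract_iff {x : ℝ} : 1 / 2 < Int.fract x ↔ ∃ m : ℤ, (m : ℝ) + 1 / 2 < x ∧ x < m + 1 := by
  constructor
  · intro h
    have := Int.lt_floor_add_one x
    rw [Int.fract] at h
    exact ⟨⌊x⌋, by linarith, this⟩
  · rintro ⟨m, h1, h2⟩
    have : ⌊x⌋ = m := Int.floor_eq_iff.2 ⟨by linarith, h2⟩
    rw [Int.fract, this]; linarith

lemma fract_le_half_of {x : ℝ} (m : ℤ) (h1 : (m : ℝ) ≤ x) (h2 : x ≤ m + 1 / 2) :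
    Int.fract x ≤ 1 / 2 := by
  have : ⌊x⌋ = m := Int.floor_eq_iff.2 ⟨h1, by linarith⟩
  rw [Int.fract, this]; linarith

lemma isOpen_gapParam : IsOpen gapParam := by
  have : gapParam = ⋃ (n : ℕ) (m : ℤ), disp n ⁻¹' Ioo (m + 1 / 2) (m + 1) := by
    ext θ
    simp only [gapParam, half_lt_fract_iff, mem_iUnion, mem_preimage, mem_Ioo]
    rfl
  rw [this]
  refine isOpen_iUnion fun n => isOpen_iUnion fun m => isOpen_Ioo.preimage ?_
  exact continuous_const.mul continuous_id

/-- After a return to `θ` or `θ + 1 / 2` the displacements repeat. -/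
lemma fract_disp_add {n : ℕ} (h : Int.fract (disp n θ) = 0 ∨ Int.fract (disp n θ) = 1 / 2) {j : ℕ}
    (hj : j ≠ 0) : Int.fract (disp (n + j) θ) = Int.fract (disp j θ) := by
  rw [disp_add]
  obtain ⟨i, hi⟩ : ∃ i : ℤ, 2 ^ j * disp n θ = i := by
    obtain ⟨j, rfl⟩ := Nat.exists_eq_succ_of_ne_zero hj
    have := Int.floor_add_fract (disp n θ)
    rcases h with h | h
    · exact ⟨2 ^ (j + 1) * ⌊disp n θ⌋, by
        push_cast; rw [Nat.succ_eq_add_one]; congr 1; linarith⟩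
    · refine ⟨2 ^ (j + 1) * ⌊disp n θ⌋ + 2 ^ j, ?_⟩
      push_cast
      have e : disp n θ = ⌊disp n θ⌋ + 1 / 2 := by linarith
      rw [Nat.succ_eq_add_one, pow_succ]
      linear_combination 2 ^ j * 2 * e
  rw [hi, Int.fract_add_intCast]

lemma not_mem_gapParam {n : ℕ} (hn : n ≠ 0)
    (h : Int.fract (disp n θ) = 0 ∨ Int.fract (disp n θ) = 1 / 2)
    (hlt : ∀ k < n, Int.fract (disp k θ) ≤ 1 / 2) : θ ∉ gapParam := by
  rintro ⟨k, hk⟩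
  induction k using Nat.strong_induction_on with
  | _ k ih =>
    rcases lt_trichotomy k n with h1 | rfl | h1
    · exact absurd (hlt k h1) (not_le.2 hk)
    · rcases h with h | h <;> rw [h] at hk <;> norm_num at hk
    · rw [show k = n + (k - n) by omega, fract_disp_add h (by omega)] at hk
      exact ih (k - n) (by omega) hk

lemma disp_mono (n : ℕ) : Monotone (disp n) := fun a b h => by
  have : (1 : ℝ) ≤ 2 ^ n := one_le_pow₀ (by norm_num)
  exact mul_le_mul_of_nonneg_left h (by linarith)

lemma two_pow_sub_one_pos {n : ℕ} (hn : n ≠ 0) : (0 : ℝ) < 2 ^ n - 1 := by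
  have : (1 : ℝ) < 2 ^ n := one_lt_pow₀ (by norm_num) hn
  linarith

lemma disp_div {n : ℕ} (hn : n ≠ 0) (c : ℝ) : disp n (c / (2 ^ n - 1)) = c := by
  have := two_pow_sub_one_pos hn
  unfold disp; field_simp

/-- The components of `gapParam`. -/
lemma exists_component (h : θ ∈ gapParam) : ∃ (n : ℕ) (a b : ℝ), n ≠ 0 ∧ a < θ ∧ θ < b ∧
    a ∉ gapParam ∧ b ∉ gapParam ∧ Ioo a b ⊆ gapParam ∧
    Int.fract (disp n a) = 1 / 2 ∧ Int.fract (disp n b) = 0 := by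
  classical
  set n := Nat.find h with hn
  have h1 := Nat.find_spec h
  rw [← hn] at h1
  have hmin : ∀ k < n, Int.fract (disp k θ) ≤ 1 / 2 := fun k hk => not_lt.1 (Nat.find_min h hk)
  have hn0 : n ≠ 0 := fun h0 => by rw [h0, disp_zero] at h1; norm_num at h1
  obtain ⟨m, hm1, hm2⟩ := half_lt_fract_iff.1 h1
  -- The interval on which the n-th displacement, the first to exceed one half at `θ`, lies in the
  -- same open half-unit. It remains to see that its ends are not in `gapParam`.
  set a := ((m : ℝ) + 1 / 2) / (2 ^ n - 1) with ha
  set b := ((m : ℝ) + 1) / (2 ^ n - 1) with hb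
  have hpos := two_pow_sub_one_pos hn0
  have hna : disp n a = m + 1 / 2 := disp_div hn0 _
  have hnb : disp n b = m + 1 := disp_div hn0 _
  have haθ : a < θ := by
    by_contra hle
    have := disp_mono n (not_lt.1 hle); linarith
  have hθb : θ < b := by
    by_contra hle
    have := disp_mono n (not_lt.1 hle); linarith
  have hIoo : ∀ x ∈ Ioo a b, (m : ℝ) + 1 / 2 < disp n x ∧ disp n x < m + 1 := by
    intro x hx
    unfold disp at *
    constructor
    · rw [← hna]; exact mul_lt_mul_of_pos_left hx.1 hpos
    · rw [← hnb]; exact mul_lt_mul_of_pos_left hx.2 hpos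
  have hfl : ∀ k < n, (⌊disp k θ⌋ : ℝ) ≤ disp k θ ∧ disp k θ ≤ ⌊disp k θ⌋ + 1 / 2 := by
    intro k hk
    have := hmin k hk
    rw [Int.fract] at this
    exact ⟨Int.floor_le _, by linarith⟩
  -- If an earlier displacement had fractional part 0 or 1/2, the n-th would repeat the one at time
  -- n - k, whose fractional part is at most 1/2.
  have key : ∀ x ∈ Ioo a b, ∀ k < n, k ≠ 0 →
      (∀ j < n, (⌊disp j θ⌋ : ℝ) ≤ disp j x ∧ disp j x ≤ ⌊disp j θ⌋ + 1 / 2) →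
      Int.fract (disp k x) = 0 ∨ Int.fract (disp k x) = 1 / 2 → False := by
    intro x hx k hk hk0 hj hf
    have h2 := fract_disp_add hf (j := n - k) (by omega)
    rw [Nat.add_sub_cancel' hk.le] at h2
    have h3 := half_lt_fract_iff.2 ⟨m, hIoo x hx⟩
    obtain ⟨h4, h5⟩ := hj (n - k) (by omega)
    have := fract_le_half_of _ h4 h5
    linarith
  -- Otherwise take the first parameter to the right of `θ` at which an earlier displacement reaches
  -- the upper end of its half-unit; this contradicts `key`. The left end is treated symmetrically.
  have hR : ∀ k < n, disp k b ≤ ⌊disp k θ⌋ + 1 / 2 := by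
    by_contra hne
    push Not at hne
    set K := (Finset.range n).filter fun k => (⌊disp k θ⌋ : ℝ) + 1 / 2 < disp k b with hK
    have hKne : K.Nonempty := by
      obtain ⟨k, hk, hk'⟩ := hne
      exact ⟨k, by simp only [hK, Finset.mem_filter, Finset.mem_range]; exact ⟨hk, hk'⟩⟩
    obtain ⟨k, hk, hkm⟩ := Finset.exists_min_image K
      (fun k => ((⌊disp k θ⌋ : ℝ) + 1 / 2) / (2 ^ k - 1)) hKne
    have hKmem : ∀ {j}, j ∈ K ↔ j < n ∧ (⌊disp j θ⌋ : ℝ) + 1 / 2 < disp j b := by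
      intro j; simp only [hK, Finset.mem_filter, Finset.mem_range]
    have hK0 : ∀ {j}, j ∈ K → j ≠ 0 := by
      rintro j hj rfl
      have := (hKmem.1 hj).2
      simp only [disp_zero, Int.floor_zero] at this
      norm_num at this
    obtain ⟨hkn, hkb⟩ := hKmem.1 hk
    set x := ((⌊disp k θ⌋ : ℝ) + 1 / 2) / (2 ^ k - 1) with hx
    have hkx : disp k x = ⌊disp k θ⌋ + 1 / 2 := disp_div (hK0 hk) _
    have hxb : x < b := by
      by_contra hle
      have := disp_mono k (not_lt.1 hle); linarith
    have hθx : θ ≤ x := by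
      rw [hx, le_div_iff₀ (two_pow_sub_one_pos (hK0 hk))]
      have := (hfl k hkn).2
      unfold disp at *; linarith
    refine key x ⟨by linarith, hxb⟩ k hkn (hK0 hk) (fun j hj => ?_) (Or.inr ?_)
    · refine ⟨(hfl j hj).1.trans (disp_mono j hθx), ?_⟩
      by_cases hjK : j ∈ K
      · have := disp_mono j (hkm j hjK)
        rwa [disp_div (hK0 hjK)] at this
      · have : disp j b ≤ ⌊disp j θ⌋ + 1 / 2 := by
          by_contra hlt; exact hjK (hKmem.2 ⟨hj, not_le.1 hlt⟩)
        exact (disp_mono j hxb.le).trans this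
    · rw [hkx, Int.fract_intCast_add]; norm_num
  have hL : ∀ k < n, (⌊disp k θ⌋ : ℝ) ≤ disp k a := by
    by_contra hne
    push Not at hne
    set K := (Finset.range n).filter fun k => disp k a < (⌊disp k θ⌋ : ℝ) with hK
    have hKne : K.Nonempty := by
      obtain ⟨k, hk, hk'⟩ := hne
      exact ⟨k, by simp only [hK, Finset.mem_filter, Finset.mem_range]; exact ⟨hk, hk'⟩⟩
    obtain ⟨k, hk, hkm⟩ := Finset.exists_max_image K
      (fun k => (⌊disp k θ⌋ : ℝ) / (2 ^ k - 1)) hKne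
    have hKmem : ∀ {j}, j ∈ K ↔ j < n ∧ disp j a < (⌊disp j θ⌋ : ℝ) := by
      intro j; simp only [hK, Finset.mem_filter, Finset.mem_range]
    have hK0 : ∀ {j}, j ∈ K → j ≠ 0 := by
      rintro j hj rfl
      have := (hKmem.1 hj).2
      simp only [disp_zero, Int.floor_zero] at this
      norm_num at this
    obtain ⟨hkn, hka⟩ := hKmem.1 hk
    set x := (⌊disp k θ⌋ : ℝ) / (2 ^ k - 1) with hx
    have hkx : disp k x = ⌊disp k θ⌋ := disp_div (hK0 hk) _
    have hax : a < x := by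
      by_contra hle
      have := disp_mono k (not_lt.1 hle); linarith
    have hxθ : x ≤ θ := by
      rw [hx, div_le_iff₀ (two_pow_sub_one_pos (hK0 hk))]
      have := (hfl k hkn).1
      unfold disp at *; linarith
    refine key x ⟨hax, by linarith⟩ k hkn (hK0 hk) (fun j hj => ?_) (Or.inl ?_)
    · refine ⟨?_, (disp_mono j hxθ).trans (hfl j hj).2⟩
      by_cases hjK : j ∈ K
      · have := disp_mono j (hkm j hjK)
        rwa [disp_div (hK0 hjK)] at this
      · have : (⌊disp j θ⌋ : ℝ) ≤ disp j a := by
          by_contra hlt; exact hjK (hKmem.2 ⟨hj, not_le.1 hlt⟩)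
        exact this.trans (disp_mono j hax.le)
    · rw [hkx, Int.fract_intCast]
  have ea : Int.fract (disp n a) = 1 / 2 := by rw [hna, Int.fract_intCast_add]; norm_num
  have eb : Int.fract (disp n b) = 0 := by
    rw [hnb]; exact_mod_cast Int.fract_intCast (R := ℝ) (m + 1)
  refine ⟨n, a, b, hn0, haθ, hθb, not_mem_gapParam hn0 (Or.inr ea) ?_,
    not_mem_gapParam hn0 (Or.inl eb) ?_, fun x hx => ⟨n, half_lt_fract_iff.2 ⟨m, hIoo x hx⟩⟩, ea, eb⟩
  · exact fun k hk => fract_le_half_of _ (hL k hk) ((disp_mono k haθ.le).trans (hfl k hk).2)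
  · exact fun k hk => fract_le_half_of _ ((hfl k hk).1.trans (disp_mono k hθb.le)) (hR k hk)

lemma fract_of_right_gap (h : θ ∉ gapParam) {ε : ℝ} (hε : 0 < ε) (hs : Ioo θ (θ + ε) ⊆ gapParam) :
    ∃ n, n ≠ 0 ∧ Int.fract (disp n θ) = 1 / 2 := by
  obtain ⟨n, a, b, hn, h1, h2, h3, h4, h5, h6, h7⟩ :=
    exists_component (hs (⟨by linarith, by linarith⟩ : θ + ε / 2 ∈ Ioo θ (θ + ε)))
  have e1 : a ≤ θ := by
    by_contra hlt; exact h3 (hs ⟨not_le.1 hlt, by linarith⟩)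
  have e2 : θ ≤ a := by
    by_contra hlt; exact h (h5 ⟨not_le.1 hlt, by linarith⟩)
  exact ⟨n, hn, by rw [le_antisymm e2 e1, h6]⟩

lemma fract_of_left_gap (h : θ ∉ gapParam) {ε : ℝ} (hε : 0 < ε) (hs : Ioo (θ - ε) θ ⊆ gapParam) :
    ∃ n, n ≠ 0 ∧ Int.fract (disp n θ) = 0 := by
  obtain ⟨n, a, b, hn, h1, h2, h3, h4, h5, h6, h7⟩ :=
    exists_component (hs (⟨by linarith, by linarith⟩ : θ - ε / 2 ∈ Ioo (θ - ε) θ))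
  have e1 : θ ≤ b := by
    by_contra hlt; exact h4 (hs ⟨by linarith, not_le.1 hlt⟩)
  have e2 : b ≤ θ := by
    by_contra hlt; exact h (h5 ⟨by linarith, not_le.1 hlt⟩)
  exact ⟨n, hn, by rw [le_antisymm e1 e2, h7]⟩

lemma left_gap_of_fract {n : ℕ} (hn : n ≠ 0) (h : Int.fract (disp n θ) = 0) :
    ∃ ε > 0, Ioo (θ - ε) θ ⊆ gapParam := by
  have hpos := two_pow_sub_one_pos hn
  refine ⟨1 / 2 / (2 ^ n - 1), by positivity, fun x hx => ⟨n, half_lt_fract_iff.2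
    ⟨⌊disp n θ⌋ - 1, ?_, ?_⟩⟩⟩
  all_goals
    have e : disp n θ = ⌊disp n θ⌋ := by
      have := Int.floor_add_fract (disp n θ); rw [h] at this; linarith
    push_cast
    rw [← e]
    unfold disp
  · have := mul_lt_mul_of_pos_left hx.1 hpos
    rw [mul_sub, mul_div_cancel₀ _ hpos.ne'] at this
    linarith
  · have := mul_lt_mul_of_pos_left hx.2 hpos
    linarith

lemma right_gap_of_fract {n : ℕ} (hn : n ≠ 0) (h : Int.fract (disp n θ) = 1 / 2) :
    ∃ ε > 0, Ioo θ (θ + ε) ⊆ gapParam := by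
  have hpos := two_pow_sub_one_pos hn
  refine ⟨1 / 2 / (2 ^ n - 1), by positivity, fun x hx => ⟨n, half_lt_fract_iff.2
    ⟨⌊disp n θ⌋, ?_, ?_⟩⟩⟩
  all_goals
    have e : (⌊disp n θ⌋ : ℝ) = disp n θ - 1 / 2 := by
      have := Int.floor_add_fract (disp n θ); rw [h] at this; linarith
    rw [e]
    unfold disp
  · have := mul_lt_mul_of_pos_left hx.1 hpos
    linarith
  · have := mul_lt_mul_of_pos_left hx.2 hpos
    rw [mul_add, mul_div_cancel₀ _ hpos.ne'] at this
    linarith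

/-- Each kind of return persists at all positive multiples of its time, so the two would clash at
time nm. -/
lemma not_left_and_right {n m : ℕ} (hn : n ≠ 0) (hm : m ≠ 0) (h : Int.fract (disp n θ) = 1 / 2)
    (h' : Int.fract (disp m θ) = 0) : False := by
  have h1 : ∀ k : ℕ, Int.fract (disp (n * (k + 1)) θ) = 1 / 2 := by
    intro k
    induction k with
    | zero => simpa using h
    | succ k ih =>
      rw [Nat.mul_succ, add_comm, fract_disp_add (Or.inr h) (by positivity), ih]
  have h2 : ∀ k : ℕ, Int.fract (disp (m * (k + 1)) θ) = 0 := by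
    intro k
    induction k with
    | zero => simpa using h'
    | succ k ih =>
      rw [Nat.mul_succ, add_comm, fract_disp_add (Or.inl h') (by positivity), ih]
  have e1 := h1 (m - 1)
  have e2 := h2 (n - 1)
  rw [Nat.sub_add_cancel (Nat.one_le_iff_ne_zero.2 ‹_›)] at e1 e2
  rw [mul_comm, e2] at e1
  norm_num at e1

/-- An isolated parameter would be the common end of two components, which is excluded. At 0 all
displacements vanish, and at 1/2 the first one is 1/2, so there too a component on the inner side is
impossible. -/
lemma not_isolated (h : θ ∉ gapParam) (hθ : θ ∈ Icc (0 : ℝ) (1 / 2)) {ε : ℝ} (hε : 0 < ε) :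
    ∃ x ∈ Icc (0 : ℝ) (1 / 2), x ∉ gapParam ∧ x ≠ θ ∧ |x - θ| < ε := by
  by_contra hne
  push Not at hne
  have hx : ∀ x, 0 ≤ x → x ≤ 1 / 2 → x ≠ θ → |x - θ| < ε → x ∈ gapParam := by
    intro x h0 h1 h2 h3
    by_contra h4
    exact absurd h3 (not_lt.2 (hne x ⟨h0, h1⟩ h4 h2))
  have hright : θ < 1 / 2 → ∃ n, n ≠ 0 ∧ Int.fract (disp n θ) = 1 / 2 := by
    intro hlt
    refine fract_of_right_gap h (lt_min hε (sub_pos.2 hlt)) fun x ⟨h1, h2⟩ => ?_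
    have e1 := min_le_left ε (1 / 2 - θ)
    have e2 := min_le_right ε (1 / 2 - θ)
    exact hx x (by linarith [hθ.1]) (by linarith) h1.ne' (by rw [abs_lt]; constructor <;> linarith)
  have hleft : 0 < θ → ∃ n, n ≠ 0 ∧ Int.fract (disp n θ) = 0 := by
    intro hlt
    refine fract_of_left_gap h (lt_min hε hlt) fun x ⟨h1, h2⟩ => ?_
    have e1 := min_le_left ε θ
    have e2 := min_le_right ε θ
    exact hx x (by linarith) (by linarith [hθ.2]) h2.ne (by rw [abs_lt]; constructor <;> linarith)
  rcases hθ.1.lt_or_eq with h0 | h0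
  · obtain ⟨m, hm, hm'⟩ := hleft h0
    rcases hθ.2.lt_or_eq with h1 | h1
    · obtain ⟨n, hn, hn'⟩ := hright h1
      exact not_left_and_right hn hm hn' hm'
    · refine not_left_and_right (n := 1) one_ne_zero hm ?_ hm'
      rw [h1]; norm_num [disp, Int.fract_eq_self]
  · obtain ⟨n, hn, hn'⟩ := hright (by rw [← h0]; norm_num)
    rw [← h0] at hn'
    simp [disp] at hn'

/-! #### Orbits of the doubling map -/

/-- Almost all orbits of the doubling map visit a given arc. -/
lemma volume_avoid {a b : ℝ} (hab : a < b) :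
    volume {x : ℝ | ∀ (n : ℕ) (k : ℤ), 2 ^ n * x - k ∉ Ioo a b} = 0 := by
  set J : Set UnitAddCircle := (fun x : ℝ => (x : UnitAddCircle)) '' Ioo a b with hJ
  have hJo : IsOpen J := QuotientAddGroup.isOpenMap_coe _ isOpen_Ioo
  set S : Set UnitAddCircle := {x | ∀ n : ℕ, 2 ^ n • x ∉ J} with hS
  have hSc : IsClosed S := by
    have : S = ⋂ n : ℕ, (fun x : UnitAddCircle => 2 ^ n • x) ⁻¹' Jᶜ := by ext; simp [hS]
    rw [this]
    exact isClosed_iInter fun n => hJo.isClosed_compl.preimage (continuous_const_smul _)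
  have herg : Ergodic (fun y : UnitAddCircle => 2 • y) volume :=
    AddCircle.ergodic_nsmul one_lt_two
  have hsub : S ⊆ (fun y : UnitAddCircle => 2 • y) ⁻¹' S := by
    intro x hx n
    have := hx (n + 1)
    rwa [pow_succ, mul_smul] at this
  -- A closed set contained in its preimage is null or of full measure by ergodicity; it misses the
  -- non-empty open arc `J`.
  have h0 : volume S = 0 := by
    rcases herg.ae_empty_or_univ_of_ae_le_preimage hSc.measurableSet.nullMeasurableSet
      hsub.eventuallyLE with h | h
    · rw [measure_congr h, measure_empty]
    · exfalso
      have h1 : volume Sᶜ = 0 := by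
        rw [measure_congr h.compl, compl_univ, measure_empty]
      have h2 : J ⊆ Sᶜ := fun x hx hxS => by
        have := hxS 0
        rw [pow_zero, one_smul] at this
        exact this hx
      have h3 := (hJo.measure_pos volume ((nonempty_Ioo.2 hab).image _)).ne'
      exact h3 (measure_mono_null h2 h1)
  have hsub2 : {x : ℝ | ∀ (n : ℕ) (k : ℤ), 2 ^ n * x - k ∉ Ioo a b} ⊆
      ⋃ i : ℤ, ((fun x : ℝ => (x : UnitAddCircle)) ⁻¹' S) ∩ Ioc (i : ℝ) (i + 1) := by
    intro x hx
    refine mem_iUnion.2 ⟨⌈x⌉ - 1, fun n => ?_, ?_, ?_⟩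
    · rintro ⟨y, hy, he⟩
      have he' : ((y : ℝ) : UnitAddCircle) = ((2 ^ n * x : ℝ) : UnitAddCircle) := by
        have he : ((y : ℝ) : UnitAddCircle) = 2 ^ n • (x : UnitAddCircle) := he
        rw [he]
        have := AddCircle.coe_nsmul (p := (1 : ℝ)) (n := 2 ^ n) (x := x)
        rw [nsmul_eq_mul] at this
        push_cast at this
        exact this.symm
      rw [eq_comm, ← sub_eq_zero, ← AddCircle.coe_sub, AddCircle.coe_eq_zero_iff] at he'
      obtain ⟨k, hk⟩ := he'
      rw [zsmul_one] at hk
      exact hx n k (by rwa [hk, sub_sub_cancel])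
    · push_cast; linarith [Int.ceil_lt_add_one x]
    · push_cast; linarith [Int.le_ceil x]
  refine measure_mono_null hsub2 (measure_iUnion_null fun i => ?_)
  have hmp := UnitAddCircle.measurePreserving_mk (i : ℝ)
  have := hmp.measure_preimage hSc.measurableSet.nullMeasurableSet
  rw [h0, Measure.restrict_apply (hSc.measurableSet.preimage hmp.measurable)] at this
  exact this

/-- As disp n θ = 2^n θ - θ, the doubling orbit of θ has to hit the moving arc (θ + 1/2, θ + 1).
Locating θ in an interval of length 1/8 leaves a fixed arc inside it. -/
lemma volume_compl_gapParam : volume gapParamᶜ = 0 := by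
  have hsub : gapParamᶜ ⊆ ⋃ i : ℤ, {x : ℝ | ∀ (n : ℕ) (k : ℤ), 2 ^ n * x - k ∉
      Ioo (((i : ℝ) + 1) / 8 + 1 / 2) ((i : ℝ) / 8 + 1)} := by
    intro θ hθ
    refine mem_iUnion.2 ⟨⌊8 * θ⌋, fun n k hk => hθ ⟨n, half_lt_fract_iff.2 ⟨k, ?_, ?_⟩⟩⟩
    all_goals
      have h1 := Int.floor_le (8 * θ)
      have h2 := Int.lt_floor_add_one (8 * θ)
      obtain ⟨h3, h4⟩ := hk
      unfold disp; linarith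
  refine measure_mono_null hsub (measure_iUnion_null fun i => volume_avoid (by linarith))

/-- Off the gaps `G` is the doubling map recentred at 2δ, modulo integers, so core points have
doubling orbits avoiding an arc. -/
lemma volume_core (δ : ℝ) : volume (core δ) = 0 := by
  have hsub : core δ ⊆ (fun v => v + (-(2 * δ))) ⁻¹' {x : ℝ | ∀ (n : ℕ) (k : ℤ), 2 ^ n * x - k ∉
      Ioo (1 / 2 - δ) (1 - δ)} := by
    intro v hv n k hk
    have key : ∀ n : ℕ, ∃ m : ℤ, (G δ)^[n] v = 2 ^ n * (v - 2 * δ) + 2 * δ + m := by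
      intro n
      induction n with
      | zero => exact ⟨0, by simp⟩
      | succ n ih =>
        obtain ⟨m, hm⟩ := ih
        rcases slot_or_gap δ ((G δ)^[n] v) ((G δ)^[n] v) with ⟨l, h1, h2⟩ | ⟨l, -, h1, h2⟩
        · refine ⟨2 * m - l, ?_⟩
          rw [Function.iterate_succ_apply', G_of_slot l h1 h2, hm, pow_succ]
          push_cast; ring
        · exact absurd ⟨l, h2, h1⟩ (hv n)
    obtain ⟨m, hm⟩ := key n
    refine hv n ⟨k + m, ?_, ?_⟩
    all_goals
      rw [hm]
      obtain ⟨h1, h2⟩ := hk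
      push_cast
      simp only [← sub_eq_add_neg] at h1 h2
      linarith
  refine measure_mono_null hsub ?_
  rw [measure_preimage_add_right]
  exact volume_avoid (by linarith)

/-! #### The three cases -/

/-- The shift from J to J + 1 comes from the start: 0 = (1 - θ) + disp 1 θ - 1. -/
lemma G_iterate_zero_eq (θ : ℝ) (J : ℕ) (h : ∀ j < J, ¬ Gap (1 - θ) ((G (1 - θ))^[j] 0)) :
    ∃ m : ℤ, (G (1 - θ))^[J] 0 = (1 - θ) + disp (J + 1) θ + m := by
  induction J with
  | zero => exact ⟨-1, by simp [disp]; ring⟩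
  | succ J ih =>
    obtain ⟨m, hm⟩ := ih fun j hj => h j (by omega)
    rcases slot_or_gap (1 - θ) ((G (1 - θ))^[J] 0) ((G (1 - θ))^[J] 0) with
      ⟨l, h1, h2⟩ | ⟨l, -, h1, h2⟩
    · refine ⟨2 * m - l - 1, ?_⟩
      rw [Function.iterate_succ_apply', G_of_slot l h1 h2, hm, disp, disp, pow_succ _ (J + 1)]
      push_cast; ring
    · exact absurd ⟨l, h2, h1⟩ (h J (by omega))

lemma not_gap_of_ne {δ u : ℝ} (h : ∀ i : ℤ, G δ u ≠ i) : ¬ Gap δ u := by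
  rintro ⟨k, h1, h2⟩
  exact h (k + 1) (by rw [G_of_gap k h1.le h2.le]; push_cast; rfl)

/-- The point just before the return lies in a closed gap. Its interior, right edge and left edge
are the hyperbolic case and the two kinds of saddle connection. -/
lemma Rat.disp_eq {n : ℕ} {p : ℤ} (h : Rat (1 - θ) n p) :
    ∃ m : ℤ, (G (1 - θ))^[n - 1] 0 = (1 - θ) + disp n θ + m ∧
      (p : ℝ) - 1 / 2 ≤ disp n θ + m ∧ disp n θ + m ≤ p := by
  obtain ⟨m, hm⟩ := G_iterate_zero_eq θ (n - 1) fun j hj => not_gap_of_ne fun i => by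
    rw [← Function.iterate_succ_apply' (G _)]; exact h.ne _ (by omega) (by omega) i
  have hn := Nat.sub_add_cancel (Nat.one_le_iff_ne_zero.2 h.ne_zero)
  rw [hn] at hm
  have h1 := h.eq
  rw [← hn, Function.iterate_succ_apply'] at h1
  obtain ⟨h2, h3⟩ := closedGap_of_G_eq_int h1
  rw [hm] at h2 h3
  exact ⟨m, hm, by linarith, by linarith⟩

lemma Rat.fract_lt {n : ℕ} {p : ℤ} (h : Rat (1 - θ) n p) {k : ℕ} (hk : k < n) :
    Int.fract (disp k θ) ≤ 1 / 2 := by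
  rcases Nat.eq_zero_or_pos k with rfl | hk0
  · rw [disp_zero]; norm_num
  obtain ⟨m, hm⟩ := G_iterate_zero_eq θ (k - 1) fun j hj => not_gap_of_ne fun i => by
    rw [← Function.iterate_succ_apply' (G _)]; exact h.ne _ (by omega) (by omega) i
  obtain ⟨l, h1, h2⟩ := exists_slot (δ := 1 - θ) (u := (G (1 - θ))^[k - 1] 0) fun i => by
    rw [← Function.iterate_succ_apply' (G _)]; exact h.ne _ (by omega) (by omega) i
  rw [hm, Nat.sub_add_cancel hk0] at h1 h2
  exact fract_le_half_of (l - m) (by push_cast; linarith) (by push_cast; linarith)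

lemma Irr.fract_lt (h : Irr (1 - θ)) {k : ℕ} (hk : k ≠ 0) :
    0 < Int.fract (disp k θ) ∧ Int.fract (disp k θ) < 1 / 2 := by
  have hG : ∀ j, ∀ i : ℤ, G (1 - θ) ((G (1 - θ))^[j] 0) ≠ i := fun j i => by
    rw [← Function.iterate_succ_apply' (G _)]; exact h _ (by omega) i
  obtain ⟨m, hm⟩ := G_iterate_zero_eq θ (k - 1) fun j hj => not_gap_of_ne (hG j)
  obtain ⟨l, h1, h2⟩ := exists_slot (hG (k - 1))
  rw [hm, Nat.sub_add_cancel (Nat.one_le_iff_ne_zero.2 hk)] at h1 h2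
  have : ⌊disp k θ⌋ = l - m :=
    Int.floor_eq_iff.2 ⟨by push_cast; linarith, by push_cast; linarith⟩
  rw [Int.fract, this]; push_cast
  constructor <;> linarith

lemma rat_of_mem_gapParam (h : θ ∈ gapParam) :
    ∃ n p, Rat (1 - θ) n p ∧ Gap (1 - θ) ((G (1 - θ))^[n - 1] 0) := by
  rcases irr_or_rat (1 - θ) with hI | ⟨n, p, hR⟩
  · obtain ⟨k, hk⟩ := h
    have hk0 : k ≠ 0 := by rintro rfl; rw [disp_zero] at hk; norm_num at hk
    exact absurd (hI.fract_lt hk0).2 (not_lt.2 hk.le)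
  · refine ⟨n, p, hR, ?_⟩
    obtain ⟨m, h1, h2, h3⟩ := hR.disp_eq
    rcases h2.lt_or_eq with h2 | h2
    · rcases h3.lt_or_eq with h3 | h3
      · exact ⟨p - 1, by rw [h1]; push_cast; linarith, by rw [h1]; push_cast; linarith⟩
      · refine absurd h (not_mem_gapParam hR.ne_zero (Or.inl ?_) fun k hk => hR.fract_lt hk)
        rw [show disp n θ = (p - m : ℤ) by push_cast; linarith, Int.fract_intCast]
    · refine absurd h (not_mem_gapParam hR.ne_zero (Or.inr ?_) fun k hk => hR.fract_lt hk)
      rw [show disp n θ = (p - m - 1 : ℤ) + 1 / 2 by push_cast; linarith, Int.fract_intCast_add]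
      norm_num

/-- The right edge δ + p of the gap is F(p), so following `F` back along the orbit of 0 gives F^n(p)
= 0. The left edge is reduced to this by reflection. -/
lemma Rat.saddle_right {δ : ℝ} {n : ℕ} {p : ℤ} (h : Rat δ n p) (he : (G δ)^[n - 1] 0 = δ + p) :
    (F δ)^[n] 0 = -p := by
  have h1 := h.F_G_iterate (n - 1) 0 (by have := h.ne_zero; omega)
  rw [add_zero, he] at h1
  have h2 : δ + (p : ℝ) = F δ (p : ℝ) := by
    rw [F_of_mem p le_rfl (by linarith)]; ring
  rw [h2, ← Function.iterate_succ_apply (F δ),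
    Nat.succ_eq_add_one, Nat.sub_add_cancel (Nat.one_le_iff_ne_zero.2 h.ne_zero),
    F_iterate_int] at h1
  simp only [Function.iterate_zero, id] at h1
  linarith

lemma saddle_of_not_mem_gapParam (h : θ ∉ gapParam) (hI : ¬ Irr (1 - θ)) :
    ∃ n p, Rat (1 - θ) n p ∧ ((Int.fract (disp n θ) = 0 ∧ (F (1 - θ))^[n] 0 = -p) ∨
      (Int.fract (disp n θ) = 1 / 2 ∧ (F (1 / 2 - (1 - θ)))^[n] 0 = p)) := by
  rcases irr_or_rat (1 - θ) with hI' | ⟨n, p, hR⟩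
  · exact absurd hI' hI
  · refine ⟨n, p, hR, ?_⟩
    obtain ⟨m, h1, h2, h3⟩ := hR.disp_eq
    rcases h2.lt_or_eq with h2 | h2
    · rcases h3.lt_or_eq with h3 | h3
      · exact absurd ⟨n, half_lt_fract_iff.2 ⟨p - m - 1, by push_cast; linarith,
          by push_cast; linarith⟩⟩ h
      · refine Or.inl ⟨?_, hR.saddle_right (by linarith)⟩
        rw [show disp n θ = (p - m : ℤ) by push_cast; linarith, Int.fract_intCast]
    · refine Or.inr ⟨?_, ?_⟩
      · rw [show disp n θ = (p - m - 1 : ℤ) + 1 / 2 by push_cast; linarith, Int.fract_intCast_add]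
        norm_num
      · have e := G_iterate_neg (1 - θ) 0 (n - 1)
        rw [neg_zero] at e
        rw [hR.symm.saddle_right (by rw [e, h1]; push_cast; linarith)]
        push_cast; ring

end Disco

namespace Disco

variable {t x y v δ : ℝ} {n : ℕ} {p : ℤ}

/-! ### The directions `2 ≤ t ≤ 4` -/

lemma ret_eq_glueMap (k : ℤ) {z : ℝ} (h : x + t = z + 6 * k) (h0 : 0 ≤ z) (h6 : z < 6) :
    ret t x = glueMap z := by
  rw [ret, red_eq_of_add k h h0 h6]

lemma ret_of_lt_one (h0 : 0 ≤ x + t) (h1 : x + t < 1) : ret t x = 2 * (x + t) + 1 := by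
  rw [ret_eq_glueMap (z := x + t) 0 (by simp) h0 (by linarith), glueMap, if_pos h1]

lemma ret_of_lt_three (h1 : 1 ≤ x + t) (h3 : x + t < 3) : ret t x = (x + t - 1) / 2 := by
  rw [ret_eq_glueMap (z := x + t) 0 (by simp) (by linarith) (by linarith), glueMap,
    if_neg (by linarith), if_pos h3]

lemma ret_of_lt_five (h3 : 3 ≤ x + t) (h5 : x + t < 5) : ret t x = (x + t - 3) / 2 - 1 := by
  rw [ret_eq_glueMap (z := x + t) 0 (by simp) (by linarith) (by linarith), glueMap,
    if_neg (by linarith), if_neg (by linarith), if_pos h5]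

lemma ret_of_lt_six (h5 : 5 ≤ x + t) (h6 : x + t < 6) : ret t x = 2 * (x + t) - 7 := by
  rw [ret_eq_glueMap (z := x + t) 0 (by simp) (by linarith) (by linarith), glueMap,
    if_neg (by linarith), if_neg (by linarith), if_neg (by linarith)]

lemma ret_of_lt_seven (h6 : 6 ≤ x + t) (h7 : x + t < 7) : ret t x = 2 * (x + t) - 11 := by
  rw [ret_eq_glueMap (z := x + t - 6) 1 (by push_cast; ring) (by linarith) (by linarith), glueMap,
    if_pos (by linarith)]; ring

lemma ret_of_lt_nine (h7 : 7 ≤ x + t) (h9 : x + t < 9) : ret t x = (x + t - 7) / 2 := by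
  rw [ret_eq_glueMap (z := x + t - 6) 1 (by push_cast; ring) (by linarith) (by linarith), glueMap,
    if_neg (by linarith), if_pos (by linarith)]; ring

lemma F_eq_fract (δ v : ℝ) : F δ v = ⌊v⌋ + (Int.fract v / 2 + δ) := by
  rw [F, Int.fract]; ring

lemma fract_F (δ v : ℝ) : Int.fract (F δ v) = Int.fract (Int.fract v / 2 + δ) := by
  rw [F_eq_fract, Int.fract_intCast_add]

lemma fract_eq_sub {u : ℝ} (k : ℤ) (h0 : (k : ℝ) ≤ u) (h1 : u < k + 1) : Int.fract u = u - k := by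
  rw [Int.fract, Int.floor_eq_iff.2 ⟨h0, h1⟩]

/-- For x in [-1, 1) the top point x + t is in [1, 5), where both branches have ratio 1/2. They meet
at x + t = 3, which is a/2 + t/4 = 1 in the coordinate x = 2a - 1. -/
lemma ret_fract (h2 : 2 ≤ t) (h4 : t ≤ 4) (v : ℝ) :
    ret t (2 * Int.fract v - 1) = 2 * Int.fract (F (t / 4) v) - 1 := by
  have h0 := Int.fract_nonneg v
  have h1 := Int.fract_lt_one v
  rw [fract_F]
  generalize Int.fract v = a at *
  rcases lt_or_ge (2 * a - 1 + t) 3 with h | h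
  · rw [ret_of_lt_three (by linarith) h,
      fract_eq_sub 0 (by push_cast; linarith) (by push_cast; linarith)]
    push_cast; ring
  · rw [ret_of_lt_five h (by linarith),
      fract_eq_sub 1 (by push_cast; linarith) (by push_cast; linarith)]
    push_cast; ring

lemma ret_iterate_fract (h2 : 2 ≤ t) (h4 : t ≤ 4) (v : ℝ) (k : ℕ) :
    (ret t)^[k] (2 * Int.fract v - 1) = 2 * Int.fract ((F (t / 4))^[k] v) - 1 := by
  induction k with
  | zero => rfl
  | succ k ih => rw [Function.iterate_succ_apply', ih, ret_fract h2 h4, ← Function.iterate_succ_apply' (F _)]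

lemma vert_fract {w : ℝ} : Vert (2 * Int.fract w - 1) ↔ Int.fract w = 0 ∨ Int.fract w = 1 / 2 := by
  have h0 := Int.fract_nonneg w
  have h1 := Int.fract_lt_one w
  generalize Int.fract w = a at *
  unfold Vert
  rcases lt_or_ge a (1 / 2) with h | h
  · rw [red_eq_of_add (y := 2 * a + 5) (-1) (by push_cast; ring) (by linarith) (by linarith)]
    constructor
    · rintro (h' | h' | h' | h') <;> left <;> linarith
    · rintro (h' | h') <;> right <;> right <;> right <;> linarith
  · rw [red_of_mem (by linarith) (by linarith)]
    constructor
    · rintro (h' | h' | h' | h') <;> right <;> linarith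
    · rintro (h' | h') <;> left <;> linarith

lemma fract_eq_zero {u : ℝ} (h : Int.fract u = 0) : ∃ i : ℤ, u = i :=
  ⟨⌊u⌋, by have := Int.floor_add_fract u; rw [h] at this; linarith⟩

/-- The vertices in [-1, 1) are -1 and 0. The second one is attained by the return map only for t =
2, from -1. -/
lemma fract_F_ne_half (h2 : 2 ≤ t) (h4 : t ≤ 4) (h : Int.fract v ≠ 0 ∨ 2 < t) :
    Int.fract (F (t / 4) v) ≠ 1 / 2 := by
  have h0 := Int.fract_nonneg v
  have h1 := Int.fract_lt_one v
  rw [fract_F]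
  generalize Int.fract v = a at *
  rcases lt_or_ge (a / 2 + t / 4) 1 with h5 | h5
  · rw [fract_eq_sub 0 (by push_cast; linarith) (by push_cast; linarith)]
    push_cast
    intro h6
    rcases h with h | h
    · exact h (by linarith)
    · linarith
  · rw [fract_eq_sub 1 (by push_cast; linarith) (by push_cast; linarith)]
    push_cast
    intro h6
    linarith

lemma Inf.fract_ne (h : Inf δ v) (k : ℕ) : Int.fract ((F δ)^[k] v) ≠ 0 := fun h0 => by
  obtain ⟨i, hi⟩ := fract_eq_zero h0
  exact h k i hi

lemma Inf.infOrbit (h2 : 2 ≤ t) (h4 : t ≤ 4) (h : Inf (t / 4) v) :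
    InfOrbit t (2 * Int.fract v - 1) := fun k => by
  rw [ret_iterate_fract h2 h4, vert_fract, not_or]
  refine ⟨h.fract_ne _, ?_⟩
  rw [Function.iterate_succ_apply']
  exact fract_F_ne_half h2 h4 (Or.inl (h.fract_ne k))

lemma InfOrbit.inf_F (h2 : 2 ≤ t) (h4 : t ≤ 4) (h : InfOrbit t (2 * Int.fract v - 1)) :
    Inf (t / 4) (F (t / 4) v) := fun k i hi => by
  refine h k ?_
  rw [ret_iterate_fract h2 h4, vert_fract, Function.iterate_succ_apply, hi]
  exact Or.inl (Int.fract_intCast i)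

lemma mapClusterPt_affine {a : ℕ → ℝ} {c : ℝ} :
    MapClusterPt c Filter.atTop (fun k => 2 * a k - 1) ↔ MapClusterPt ((c + 1) / 2) Filter.atTop a := by
  rw [mapClusterPt_iff_abs, mapClusterPt_iff_abs]
  constructor
  · intro h ε hε N
    obtain ⟨k, hk, h'⟩ := h ε hε N
    refine ⟨k, hk, ?_⟩
    rw [abs_lt] at h' ⊢; constructor <;> linarith [h'.1, h'.2]
  · intro h ε hε N
    obtain ⟨k, hk, h'⟩ := h (ε / 2) (by linarith) N
    refine ⟨k, hk, ?_⟩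
    rw [abs_lt] at h' ⊢; constructor <;> linarith [h'.1, h'.2]

lemma mapClusterPt_ret (h2 : 2 ≤ t) (h4 : t ≤ 4) (v : ℝ) :
    {c | MapClusterPt c Filter.atTop fun k : ℕ => (ret t)^[k] (2 * Int.fract v - 1)} =
      (fun c => 2 * c - 1) '' cl (t / 4) v := by
  ext c
  simp only [ret_iterate_fract h2 h4, mem_ofPred_eq, mapClusterPt_affine, mem_image]
  constructor
  · intro h; exact ⟨(c + 1) / 2, h, by ring⟩
  · rintro ⟨a, ha, rfl⟩
    rw [show (2 * a - 1 + 1) / 2 = a by ring]; exact ha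

lemma eq_fract_of_mem (hx : x ∈ Ico (-1 : ℝ) 1) : x = 2 * Int.fract ((x + 1) / 2) - 1 := by
  rw [fract_eq_sub 0 (by push_cast; linarith [hx.1]) (by push_cast; linarith [hx.2])]
  push_cast; ring

lemma fract_mem_Icc (u : ℝ) : 2 * Int.fract u - 1 ∈ Icc (-1 : ℝ) 1 :=
  ⟨by linarith [Int.fract_nonneg u], by linarith [Int.fract_lt_one u]⟩

lemma omega_of_trapped (h2 : 2 ≤ t) (h4 : t ≤ 4) (hy : y ∈ Ico (0 : ℝ) 1) (hp : E t x y ∉ sing)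
    (h : InfOrbit t x) {N : ℕ} (hN : (ret t)^[N] x ∈ Ico (-1 : ℝ) 1) :
    ∃ v, Inf (t / 4) v ∧ omega t (E t x y) = susp t ((fun c => 2 * c - 1) '' cl (t / 4) v) := by
  obtain ⟨v, hv⟩ : ∃ v, (ret t)^[N] x = 2 * Int.fract v - 1 := ⟨_, eq_fract_of_mem hN⟩
  have hi := h.iterate N
  rw [hv] at hi
  -- One more step is needed, as `InfOrbit` allows the starting point itself to be a vertex.
  refine ⟨F (t / 4) v, hi.inf_F h2 h4, ?_⟩
  have hk : ∀ k, (ret t)^[k + N] x = (ret t)^[k] (2 * Int.fract v - 1) := fun k => by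
    rw [Function.iterate_add_apply, hv]
  rw [omega_eq_susp (a := -1) (b := 1) (N₀ := N) (by linarith) h4 hy hp h fun k hkN => ?_]
  · congr 1
    have := cl_iterate (t / 4) v 1
    rw [Function.iterate_one] at this
    rw [this, ← mapClusterPt_ret h2 h4]
    ext c
    rw [mem_ofPred_eq, ← mapClusterPt_tail N]
    simp only [hk, mem_ofPred_eq]
  · rw [← Nat.sub_add_cancel hkN, hk, ret_iterate_fract h2 h4]
    exact fract_mem_Icc _

/-- Unless x + t is in (5, 7), the next return is in [-1, 1) or is a vertex. On (5, 7) the return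
map doubles, and v = (7 - x - t)/2 turns it into an inverse of `F` modulo 1. -/
lemma exists_back (h2 : 2 ≤ t) (h4 : t ≤ 4) (hx : x ∈ Ico (-1 : ℝ) 5) (h : InfOrbit t x)
    (hN : ∀ N, (ret t)^[N] x ∉ Ico (-1 : ℝ) 1) :
    ∃ v : ℕ → ℝ, Back (t / 4) v ∧ ∀ k, v k ∈ Ioo (0 : ℝ) 1 ∧ (ret t)^[k] x = 7 - 2 * v k - t := by
  have hmem : ∀ k, (ret t)^[k] x ∈ Ico (-1 : ℝ) 5 := fun k => by
    cases k with
    | zero => exact hx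
    | succ k => rw [Function.iterate_succ_apply']; exact ret_mem
  have key : ∀ k, 5 < (ret t)^[k] x + t ∧ (ret t)^[k] x + t < 7 := by
    intro k
    have h1 : 1 ≤ (ret t)^[k] x := by
      by_contra hlt; exact hN k ⟨(hmem k).1, not_le.1 hlt⟩
    have h5 := (hmem k).2
    have hs := hN (k + 1)
    have hv := h k
    rw [Function.iterate_succ_apply'] at hs hv
    rw [vert_ret] at hv
    constructor
    · by_contra hlt
      rcases (not_lt.1 hlt).lt_or_eq with h6 | h6
      · rw [ret_of_lt_five (by linarith) h6] at hs
        exact hs ⟨by linarith, by linarith⟩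
      · rw [h6] at hv
        exact hv (Or.inr (Or.inr (Or.inr (red_of_mem (by norm_num) (by norm_num)))))
    · by_contra hlt
      rw [ret_of_lt_nine (not_lt.1 hlt) (by linarith)] at hs
      exact hs ⟨by linarith, by linarith⟩
  have hv : ∀ k, (7 - ((ret t)^[k] x + t)) / 2 ∈ Ioo (0 : ℝ) 1 := fun k =>
    ⟨by linarith [(key k).2], by linarith [(key k).1]⟩
  refine ⟨fun k => (7 - ((ret t)^[k] x + t)) / 2, ⟨fun k i hi => ?_, fun k => ?_⟩,
    fun k => ⟨hv k, by ring⟩⟩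
  · have := hv k
    simp only at hi
    rw [hi] at this
    have h1 : (0 : ℤ) < i := by exact_mod_cast this.1
    have h3 : i < (1 : ℤ) := by exact_mod_cast this.2
    omega
  · simp only
    rw [F_of_mem 0 (by push_cast; exact (hv (k + 1)).1.le) (by push_cast; linarith [(hv (k + 1)).2]),
      Function.iterate_succ_apply']
    rcases lt_or_ge ((ret t)^[k] x + t) 6 with h6 | h6
    · exact ⟨0, by rw [ret_of_lt_six (key k).1.le h6]; push_cast; ring⟩
    · exact ⟨1, by rw [ret_of_lt_seven h6 (key k).2]; push_cast; ring⟩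

lemma Back.shift {v : ℕ → ℝ} (h : Back δ v) (k : ℕ) : Back δ fun j => v (j + k) :=
  ⟨fun j => h.1 _, fun j => by
    obtain ⟨m, hm⟩ := h.2 (j + k)
    exact ⟨m, hm.trans (by simp only [show j + 1 + k = j + k + 1 by omega])⟩⟩

lemma concentratesOn_susp (h2 : 2 ≤ t) (h4 : t ≤ 4) {Λ : Set ℝ}
    (h1 : ∀ v, Inf (t / 4) v → cl (t / 4) v = Λ)
    (hb : ∀ v, Back (t / 4) v → v 0 ∈ Ioo (0 : ℝ) 1 → v 0 ∈ Λ) :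
    ConcentratesOn t (susp t ((fun c => 2 * c - 1) '' Λ)) := by
  intro q hq
  obtain ⟨x, hx, y, hy, rfl⟩ := exists_E t q
  obtain ⟨hp, h⟩ := (infiniteHalfLeaf_iff (by linarith) h4 hy).1 hq
  by_cases hN : ∃ N, (ret t)^[N] x ∈ Ico (-1 : ℝ) 1
  · left
    obtain ⟨N, hN⟩ := hN
    obtain ⟨v, hv, e⟩ := omega_of_trapped h2 h4 hy hp h hN
    rw [e, h1 v hv]
  · right
    push Not at hN
    obtain ⟨v, hv, hv'⟩ := exists_back h2 h4 hx h hN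
    refine halfLeaf_subset_halfTurn (by linarith) h4 hy hp h fun k => ⟨2 * v k - 1, ⟨v k, ?_, rfl⟩, ?_⟩
    · have := hb _ (hv.shift k)
      simp only [zero_add] at this
      exact this (hv' k).1
    · rw [(hv' k).2]
      exact red_eq_iff.2 ⟨1, by push_cast; ring⟩

open scoped Pointwise in
lemma Irr.exists_cantor (h2 : 2 ≤ t) (h4 : t ≤ 4) (h : Irr (t / 4)) :
    ∃ A, IsTransverselyNullCantor A ∧ ConcentratesOn t A := by
  refine ⟨_, ?_, concentratesOn_susp h2 h4 (fun v hv => h.cl_eq hv) fun v hv hm =>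
    ⟨hv.mem_core, hm.1.le, hm.2.le⟩⟩
  have h0 := volume_core (t / 4)
  refine isTransverselyNullCantor_susp ((h.isCantorSet h0).image (by fun_prop) fun a _ b _ hab => ?_)
    ?_ ?_
  · linarith [show (2 * a - 1 : ℝ) = 2 * b - 1 from hab]
  · rintro _ ⟨a, ⟨-, ha⟩, rfl⟩
    exact ⟨by simp only; linarith [ha.1], by simp only; linarith [ha.2]⟩
  · have hsub : (fun c : ℝ => 2 * c - 1) '' (core (t / 4) ∩ Icc 0 1) ⊆
        (fun c : ℝ => c + -1) '' ((fun c : ℝ => (2 : ℝ) • c) '' core (t / 4)) := by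
      rintro _ ⟨a, ⟨ha, -⟩, rfl⟩
      exact ⟨_, ⟨a, ha, rfl⟩, by simp only [smul_eq_mul]; ring⟩
    refine measure_mono_null hsub ?_
    rw [image_add_right, measure_preimage_add_right]
    change volume ((2 : ℝ) • core (t / 4)) = 0
    rw [Measure.addHaar_smul, h0, mul_zero]

lemma Rat.concentratesOn (h2 : 2 ≤ t) (h4 : t ≤ 4) (h : Rat (t / 4) n p) {Λ : Set ℝ}
    (h1 : ∀ v, Inf (t / 4) v → cl (t / 4) v = Λ) :
    ConcentratesOn t (susp t ((fun c => 2 * c - 1) '' Λ)) := by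
  refine concentratesOn_susp h2 h4 h1 fun v hv hm => ?_
  obtain ⟨e1, e2⟩ := h.back_mem hv
  rwa [h1 _ e1, fract_eq_sub 0 (by push_cast; exact hm.1.le) (by push_cast; linarith [hm.2]),
    Int.cast_zero, sub_zero] at e2

lemma Rat.exists_attracting (h2 : 2 ≤ t) (h4 : t ≤ 4) (h : Rat (t / 4) n p)
    (hg : Gap (t / 4) ((G (t / 4))^[n - 1] 0)) :
    ∃ L, IsAttractingClosedLeaf t L ∧ ConcentratesOn t L ∧
      ∀ q, InfiniteHalfLeaf t q → ¬ OnClosedLeaf t q → omega t q = L := by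
  obtain ⟨s, hs, hsn⟩ := h.exists_periodic hg
  have hn := h.ne_zero
  set x₀ := 2 * Int.fract s - 1 with hx₀
  have hit : ∀ k, (ret t)^[k] x₀ = 2 * Int.fract ((F (t / 4))^[k] s) - 1 := ret_iterate_fract h2 h4 s
  have hper : (ret t)^[n] x₀ = x₀ := by rw [hit, hsn, Int.fract_add_intCast]
  have hcl : ∀ v, Inf (t / 4) v → cl (t / 4) v = range fun k : ℕ => Int.fract ((F (t / 4))^[k] s) :=
    fun v hv => by rw [h.cl_eq hv, ← h.cl_eq hs, cl_of_periodic hn hsn]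
  have hL : ((fun c : ℝ => 2 * c - 1) '' range fun k : ℕ => Int.fract ((F (t / 4))^[k] s)) =
      range fun k : ℕ => (ret t)^[k] x₀ := by
    rw [← range_comp]; congr 1; ext k; exact (hit k).symm
  have hfin : (range fun k : ℕ => (ret t)^[k] x₀).Finite := finite_range_iterate hn hper
  have hpos : ∀ k, Int.fract ((F (t / 4))^[k] s) ∈ Ioo (0 : ℝ) 1 := fun k =>
    ⟨(Int.fract_nonneg _).lt_of_ne (hs.fract_ne k).symm, Int.fract_lt_one _⟩
  have hinf := hs.infOrbit h2 h4
  have hconc := h.concentratesOn h2 h4 hcl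
  rw [hL] at hconc
  -- Removing the finitely many points of `P` from the neighbourhood ensures that all nearby orbits
  -- are infinite.
  have hQ : IsClosed ((fun c : ℝ => 2 * c - 1) '' (P (t / 4) ∩ Icc 0 1)) :=
    ((h.finite 0 1).image _).isClosed
  obtain ⟨η, hη, hU⟩ := hfin.isCompact.exists_thickening_subset_open
    ((isOpen_Ioo (a := (-1 : ℝ)) (b := 1)).sdiff hQ) (by
      rintro _ ⟨k, rfl⟩
      simp only
      rw [hit k]
      refine ⟨⟨by linarith [(hpos k).1], by linarith [(hpos k).2]⟩, ?_⟩
      rintro ⟨c, ⟨hc, -⟩, hce⟩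
      refine h.not_mem_P ((hs.iterate k).sub_int ⌊(F (t / 4))^[k] s⌋) ?_
      have : (F (t / 4))^[k] s - ⌊(F (t / 4))^[k] s⌋ = c := by
        change Int.fract _ = c
        simp only at hce; linarith
      rwa [this])
  refine ⟨susp t (range fun k : ℕ => (ret t)^[k] x₀),
    isAttractingClosedLeaf_susp (by linarith) h4 hn hper (fun k => ⟨?_, ?_, ?_⟩) hη ?_, hconc, ?_⟩
  · rw [hit k]; exact ⟨by linarith [(hpos k).1], by linarith [(hpos k).2]⟩
  · rw [hit k]; exact ⟨by linarith [(hpos k).1], by linarith [(hpos k).2]⟩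
  -- By periodicity each point of the orbit is a later iterate, so it is covered by `InfOrbit`,
  -- which says nothing about the start.
  · have := hinf (k + n - 1)
    rwa [Nat.sub_add_cancel (by omega), Function.iterate_add_apply, hper] at this
  · intro x hx k hk
    have hxU := hU (Metric.mem_thickening_iff.2 ⟨_, ⟨k, rfl⟩, by rwa [Real.dist_eq]⟩)
    have hxP : (x + 1) / 2 ∉ P (t / 4) := fun hP =>
      hxU.2 ⟨_, ⟨hP, by linarith [hxU.1.1], by linarith [hxU.1.2]⟩, by simp only; ring⟩
    have hi := inf_of_not_mem_P hxP
    have ex := eq_fract_of_mem ⟨hxU.1.1.le, hxU.1.2⟩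
    refine ⟨?_, ⟨0, fun j _ => ?_⟩, ?_⟩
    · rw [ex]; exact hi.infOrbit h2 h4
    · rw [ex, ret_iterate_fract h2 h4]; exact fract_mem_Icc _
    · rw [← hL, ← hcl _ hi, ← mapClusterPt_ret h2 h4, ← ex]
  · intro q hq hq'
    obtain ⟨x, hx, y, hy, rfl⟩ := exists_E t q
    obtain ⟨hp, hix⟩ := (infiniteHalfLeaf_iff (by linarith) h4 hy).1 hq
    by_cases hN : ∃ N, (ret t)^[N] x ∈ Ico (-1 : ℝ) 1
    · obtain ⟨N, hN⟩ := hN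
      obtain ⟨v, hv, e⟩ := omega_of_trapped h2 h4 hy hp hix hN
      rw [e, hcl v hv, hL]
    · exfalso
      push Not at hN
      obtain ⟨v, hv, hv'⟩ := exists_back h2 h4 hx hix hN
      have hm : ∀ k, 2 * v k - 1 ∈ range fun k : ℕ => (ret t)^[k] x₀ := by
        intro k
        rw [← hL]
        refine ⟨v k, ?_, rfl⟩
        obtain ⟨e1, e2⟩ := h.back_mem (hv.shift k)
        rw [hcl _ e1] at e2
        simp only [zero_add] at e2
        have hm := (hv' k).1
        rwa [fract_eq_sub 0 (by push_cast; exact hm.1.le) (by push_cast; linarith [hm.2]),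
          Int.cast_zero, sub_zero] at e2
      -- An untrapped orbit lives in the image of a finite set, so it repeats a value; injectivity
      -- of the return map then makes its leaf closed.
      obtain ⟨i, -, j, -, hij, e⟩ := infinite_univ.exists_ne_map_eq_of_mapsTo
        (f := fun k => 2 * v k - 1) (s := (univ : Set ℕ)) (fun k _ => hm k) hfin
      have e' : (ret t)^[i] x = (ret t)^[j] x := by
        rw [(hv' i).2, (hv' j).2]; linarith [show 2 * v i - 1 = 2 * v j - 1 from e]
      have main : ∀ i j, i < j → (ret t)^[i] x = (ret t)^[j] x → False := by
        intro i j hij e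
        refine hq' (onClosedLeaf_of_periodic (n := j - i) (by linarith) h4 hy hp hix (by omega) ?_)
        refine red_iterate_inj (t := t) (k := i) ?_
        rw [← Function.iterate_add_apply, Nat.add_sub_cancel' hij.le, e]
      rcases lt_or_gt_of_ne hij with h | h
      · exact main i j h e'
      · exact main j i h e'.symm

/-! ### Closed saddle connections for `2 ≤ t ≤ 4` -/

lemma fract_iterate_mod {y : ℝ} {q : ℤ} (hs : (F δ)^[n] y = y + q) (k : ℕ) :
    Int.fract ((F δ)^[k] y) = Int.fract ((F δ)^[k % n] y) := by
  have h : ∀ j : ℕ, ∃ m : ℤ, (F δ)^[n * j] y = y + m := by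
    intro j
    induction j with
    | zero => exact ⟨0, by simp⟩
    | succ j ih =>
      obtain ⟨m, hm⟩ := ih
      exact ⟨q + m, by
        rw [Nat.mul_succ, add_comm, Function.iterate_add_apply, hm, F_iterate_add_int, hs]
        push_cast; ring⟩
  obtain ⟨m, hm⟩ := h (k / n)
  conv_lhs => rw [← Nat.mod_add_div k n]
  rw [Function.iterate_add_apply, hm, F_iterate_add_int, Int.fract_add_intCast]

lemma Rat.F_iterate_ne (h : Rat δ n p) {k : ℕ} (hk : k ≠ 0) (hkn : k < n) :
    Int.fract ((F δ)^[k] 0) ≠ 0 := fun h0 => by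
  obtain ⟨i, hi⟩ := fract_eq_zero h0
  have h1 := G_F_iterate δ 0 k
  rw [hi, G_iterate_int] at h1
  exact h.ne k hk hkn (-i) (by push_cast; linarith)

/-- The periodic point v = 0 is x = -1, which represents the bottom vertex 5: the separatrix issued
from there closes up. -/
lemma Rat.exists_saddle_right (h2 : 2 < t) (h4 : t ≤ 4) (h : Rat (t / 4) n p)
    (hp : (F (t / 4))^[n] 0 = -p) : ∃ L, IsClosedSaddleConnection t L ∧ ConcentratesOn t L := by
  have hn := h.ne_zero
  have hp' : (F (t / 4))^[n] 0 = 0 + (-p : ℤ) := by rw [hp]; push_cast; ring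
  have hit : ∀ k, (ret t)^[k] (-1) = 2 * Int.fract ((F (t / 4))^[k] 0) - 1 := fun k => by
    rw [← ret_iterate_fract h2.le h4]; norm_num
  refine ⟨_, isClosedSaddleConnection_susp (x₀ := -1) (n := n) (by linarith) h4 hn ?_ ?_ ?_, ?_⟩
  · exact Or.inr (Or.inr (Or.inr (red_eq_of_add (-1) (by norm_num) (by norm_num) (by norm_num))))
  · intro k hk hkn
    rw [hit, vert_fract, not_or]
    refine ⟨h.F_iterate_ne hk hkn, ?_⟩
    rw [← Nat.sub_add_cancel (Nat.one_le_iff_ne_zero.2 hk), Function.iterate_succ_apply']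
    exact fract_F_ne_half h2.le h4 (Or.inr h2)
  · rw [hit, hp', zero_add, Int.fract_intCast]; norm_num
  · have := h.concentratesOn h2.le h4 fun v hv => h.cl_eq hv
    rw [cl_of_periodic hn hp'] at this
    convert this using 2
    ext c
    constructor
    · rintro ⟨k, -, rfl⟩
      exact ⟨_, ⟨k, rfl⟩, (hit k).symm⟩
    · rintro ⟨_, ⟨k, rfl⟩, rfl⟩
      refine ⟨k % n, Nat.mod_lt _ (by omega), ?_⟩
      simp only
      rw [hit, ← fract_iterate_mod hp']

/-- In the reflected coordinate x = 1 - 2a the return map is the rotation for 1/2 - δ, except that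
the value 1 is replaced by -1, on the other side of the discontinuity. -/
lemma ret_one_sub_fract (h2 : 2 ≤ t) (h4 : t < 4) (v : ℝ) :
    (Int.fract (F (1 / 2 - t / 4) v) ≠ 0 →
      ret t (1 - 2 * Int.fract v) = 1 - 2 * Int.fract (F (1 / 2 - t / 4) v)) ∧
    (Int.fract (F (1 / 2 - t / 4) v) = 0 → ret t (1 - 2 * Int.fract v) = -1) := by
  have h0 := Int.fract_nonneg v
  have h1 := Int.fract_lt_one v
  rw [fract_F]
  generalize Int.fract v = a at *
  rcases lt_trichotomy (1 - 2 * a + t) 3 with h | h | h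
  · rw [ret_of_lt_three (by linarith) h,
      fract_eq_sub 0 (by push_cast; linarith) (by push_cast; linarith)]
    push_cast
    exact ⟨fun _ => by ring, fun h' => by linarith⟩
  · rw [ret_of_lt_five (by linarith) (by linarith),
      fract_eq_sub 0 (by push_cast; linarith) (by push_cast; linarith)]
    push_cast
    exact ⟨fun h' => absurd (by linarith) h', fun h' => by linarith⟩
  · rw [ret_of_lt_five h.le (by linarith),
      fract_eq_sub (-1) (by push_cast; linarith) (by push_cast; linarith)]
    push_cast
    exact ⟨fun _ => by ring, fun h' => by linarith⟩

lemma fract_F_neg_ne_half (h2 : 2 ≤ t) (h4 : t < 4) (v : ℝ) :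
    Int.fract (F (1 / 2 - t / 4) v) ≠ 1 / 2 := by
  have h0 := Int.fract_nonneg v
  have h1 := Int.fract_lt_one v
  rw [fract_F]
  generalize Int.fract v = a at *
  intro h
  rcases lt_or_ge (a / 2 + (1 / 2 - t / 4)) 0 with h5 | h5
  · rw [fract_eq_sub (-1) (by push_cast; linarith) (by push_cast; linarith)] at h
    push_cast at h
    linarith
  · rw [fract_eq_sub 0 (by push_cast; linarith) (by push_cast; linarith)] at h
    push_cast at h
    linarith

lemma not_vert_one_sub {a : ℝ} (h0 : 0 < a) (h1 : a < 1) (h : a ≠ 1 / 2) : ¬ Vert (1 - 2 * a) := by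
  unfold Vert
  rcases lt_or_gt_of_ne h with h | h
  · rw [red_of_mem (by linarith) (by linarith)]
    rintro (h' | h' | h' | h') <;> linarith
  · rw [red_eq_of_add (y := 7 - 2 * a) (-1) (by push_cast; ring) (by linarith) (by linarith)]
    rintro (h' | h' | h' | h') <;> linarith

lemma Inf.cl_neg (h : Inf δ v) : cl δ v = (fun c => 1 - c) '' cl (1 / 2 - δ) (-v) := by
  have hk : ∀ k, Int.fract ((F (1 / 2 - δ))^[k] (-v)) = 1 - Int.fract ((F δ)^[k] v) := fun k => by
    rw [F_iterate_neg h, Int.fract_neg (h.fract_ne k)]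
  have key : ∀ c, MapClusterPt c Filter.atTop (fun k : ℕ => 1 - Int.fract ((F δ)^[k] v)) ↔
      MapClusterPt (1 - c) Filter.atTop fun k : ℕ => Int.fract ((F δ)^[k] v) := by
    intro c
    rw [mapClusterPt_iff_abs, mapClusterPt_iff_abs]
    refine forall₃_congr fun ε _ N => exists_congr fun k => and_congr_right fun _ => ?_
    rw [← abs_neg]
    ring_nf
  ext c
  simp only [cl, hk, key, mem_image, mem_ofPred_eq]
  constructor
  · intro hc; exact ⟨1 - c, by rwa [sub_sub_cancel], sub_sub_cancel _ _⟩
  · rintro ⟨a, ha, rfl⟩; exact ha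

lemma Rat.exists_saddle_left (h2 : 2 ≤ t) (h4 : t < 4) (h : Rat (t / 4) n p)
    (hp : (F (1 / 2 - t / 4))^[n] 0 = p) :
    ∃ L, IsClosedSaddleConnection t L ∧ ConcentratesOn t L := by
  have hn := h.ne_zero
  have hp' : (F (1 / 2 - t / 4))^[n] 0 = 0 + p := by rw [hp, zero_add]
  have hit : ∀ k < n, (ret t)^[k] 1 = 1 - 2 * Int.fract ((F (1 / 2 - t / 4))^[k] 0) := by
    intro k hk
    induction k with
    | zero => simp
    | succ k ih =>
      rw [Function.iterate_succ_apply', ih (by omega), (ret_one_sub_fract h2 h4 _).1,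
        ← Function.iterate_succ_apply' (F _)]
      rw [← Function.iterate_succ_apply' (F _)]
      exact h.symm.F_iterate_ne (by omega) hk
  have hlast : (ret t)^[n] 1 = -1 := by
    obtain ⟨m, rfl⟩ := Nat.exists_eq_succ_of_ne_zero hn
    rw [Function.iterate_succ_apply', hit m (by omega), (ret_one_sub_fract h2 h4 _).2]
    rw [← Function.iterate_succ_apply' (F _), hp, Int.fract_intCast]
  refine ⟨_, isClosedSaddleConnection_susp (x₀ := 1) (n := n) (by linarith) h4.le hn ?_ ?_ ?_, ?_⟩
  · exact Or.inr (Or.inl (red_of_mem (by norm_num) (by norm_num)))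
  · intro k hk hkn
    rw [hit k hkn]
    refine not_vert_one_sub ((Int.fract_nonneg _).lt_of_ne (h.symm.F_iterate_ne hk hkn).symm)
      (Int.fract_lt_one _) ?_
    rw [← Nat.sub_add_cancel (Nat.one_le_iff_ne_zero.2 hk), Function.iterate_succ_apply']
    exact fract_F_neg_ne_half h2 h4 _
  -- The separatrix leaves from the vertex 1 and arrives at -1, that is at 5; both represent the
  -- same singular point.
  · rw [hlast, E_zero, E_zero, ← cyl_five]
    exact cyl_congr (red_eq_iff.2 ⟨-1, by norm_num⟩) 0
  · have := h.concentratesOn h2 h4.le fun v hv => by rw [hv.cl_neg, h.symm.cl_eq hv.neg]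
    rw [cl_of_periodic hn hp'] at this
    convert this using 2
    ext c
    constructor
    · rintro ⟨k, hk, rfl⟩
      exact ⟨_, ⟨_, ⟨k, rfl⟩, rfl⟩, by simp only; rw [hit k hk]; ring⟩
    · rintro ⟨_, ⟨_, ⟨k, rfl⟩, rfl⟩, rfl⟩
      have hlt : k % n < n := Nat.mod_lt _ (by omega)
      refine ⟨k % n, hlt, ?_⟩
      simp only
      rw [hit _ hlt, ← fract_iterate_mod hp']; ring

end Disco

namespace Disco

variable {t x y v δ : ℝ} {n : ℕ} {p : ℤ}

/-! ### The directions `1 ≤ t < 2` -/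

lemma ret_of_mem_Ico (h1 : 1 ≤ t) (h2 : t < 2) (hx : x ∈ Ico (0 : ℝ) 1) :
    ret t x = (x + t - 1) / 2 :=
  ret_of_lt_three (by linarith [hx.1]) (by linarith [hx.2])

lemma ret_iterate_of_mem_Ico (h1 : 1 ≤ t) (h2 : t < 2) (hx : x ∈ Ico (0 : ℝ) 1) (k : ℕ) :
    (ret t)^[k] x ∈ Ico (0 : ℝ) 1 ∧ (ret t)^[k] x = t - 1 + (x - (t - 1)) / 2 ^ k := by
  induction k with
  | zero => exact ⟨hx, by simp⟩
  | succ k ih =>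
    rw [Function.iterate_succ_apply', ret_of_mem_Ico h1 h2 ih.1]
    refine ⟨⟨by linarith [ih.1.1], by linarith [ih.1.2]⟩, ?_⟩
    rw [ih.2, pow_succ]; field_simp; ring

lemma mapClusterPt_of_mem_Ico (h1 : 1 ≤ t) (h2 : t < 2) (hx : x ∈ Ico (0 : ℝ) 1) :
    {c | MapClusterPt c Filter.atTop fun k : ℕ => (ret t)^[k] x} = {t - 1} := by
  have h : Filter.Tendsto (fun k : ℕ => (ret t)^[k] x) Filter.atTop (nhds (t - 1)) := by
    simp only [fun k => (ret_iterate_of_mem_Ico h1 h2 hx k).2]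
    simpa using (tendsto_div_two_pow (x - (t - 1))).const_add (t - 1)
  ext c
  rw [mem_ofPred_eq, mem_singleton_iff]
  constructor
  · intro hc
    have : (nhds c ⊓ nhds (t - 1)).NeBot := hc.clusterPt.neBot.mono (inf_le_inf_left _ h)
    exact eq_of_nhds_neBot this
  · rintro rfl
    exact h.mapClusterPt

lemma omega_eq_susp_singleton (h1 : 1 ≤ t) (h2 : t < 2) (hy : y ∈ Ico (0 : ℝ) 1)
    (hp : E t x y ∉ sing) (h : InfOrbit t x) {N : ℕ} (hN : (ret t)^[N] x ∈ Ico (0 : ℝ) 1) :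
    omega t (E t x y) = susp t {t - 1} := by
  rw [omega_eq_susp (a := 0) (b := 1) (N₀ := N) (by linarith) (by linarith) hy hp h fun k hkN => ?_,
    ← mapClusterPt_of_mem_Ico h1 h2 hN]
  · congr 1
    ext c
    rw [mem_ofPred_eq, ← mapClusterPt_tail N]
    simp only [Function.iterate_add_apply, mem_ofPred_eq]
  · rw [← Nat.sub_add_cancel hkN, Function.iterate_add_apply]
    exact Ico_subset_Icc_self (ret_iterate_of_mem_Ico h1 h2 hN _).1

lemma not_vert_of_mem_Ioo (h : x ∈ Ioo (0 : ℝ) 1) : ¬ Vert x := by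
  unfold Vert
  rw [red_of_mem h.1.le (by linarith [h.2])]
  rintro (h' | h' | h' | h') <;> linarith [h.1, h.2]

lemma infOrbit_of_mem_Ico (h1 : 1 < t) (h2 : t < 2) (hx : x ∈ Ico (0 : ℝ) 1) : InfOrbit t x := by
  intro k
  obtain ⟨⟨h3, h4⟩, -⟩ := ret_iterate_of_mem_Ico h1.le h2 hx k
  rw [Function.iterate_succ_apply', ret_of_mem_Ico h1.le h2 ⟨h3, h4⟩]
  exact not_vert_of_mem_Ioo ⟨by linarith, by linarith⟩

/-- A bounded orbit of an expanding affine map is constant. -/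
lemma eq_of_expanding {a : ℕ → ℝ} {c M : ℝ} (ha : ∀ k, a (k + 1) - c = 2 * (a k - c))
    (hM : ∀ k, |a k - c| ≤ M) : a 0 = c := by
  have h : ∀ k, a k - c = 2 ^ k * (a 0 - c) := by
    intro k
    induction k with
    | zero => simp
    | succ k ih => rw [ha, ih, pow_succ]; ring
  by_contra hne
  have hd : 0 < |a 0 - c| := abs_pos.2 (sub_ne_zero.2 hne)
  obtain ⟨k, hk⟩ := pow_unbounded_of_one_lt (M / |a 0 - c|) one_lt_two
  rw [div_lt_iff₀ hd] at hk
  have := hM k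
  rw [h, abs_mul, abs_of_pos (by positivity)] at this
  linarith

lemma eq_zero_of_bounded {c M : ℝ} (h : ∀ k : ℕ, |k * c| ≤ M) : c = 0 := by
  by_contra hne
  have hd : 0 < |c| := abs_pos.2 hne
  obtain ⟨k, hk⟩ := exists_nat_gt (M / |c|)
  rw [div_lt_iff₀ hd] at hk
  have := h k
  rw [abs_mul, Nat.abs_cast] at this
  linarith

/-- A negative point returns negative after two steps, translated by (3t - 4)/2; boundedness forces
t = 4/3. A non-negative orbit avoiding [0, 1) stays in [3, 5), where the return map doubles about 7
- 2t, so it is constant. -/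
lemma not_trapped_cases (h1 : 1 ≤ t) (h2 : t < 2) (hx : x ∈ Ico (-1 : ℝ) 5)
    (hN : ∀ N, (ret t)^[N] x ∉ Ico (0 : ℝ) 1) :
    (∀ k, (ret t)^[k] x = 7 - 2 * t) ∨ t = 4 / 3 ∧ red ((ret t)^[2] x) = red x := by
  have hmem : ∀ k, (ret t)^[k] x ∈ Ico (-1 : ℝ) 5 := fun k => by
    cases k with
    | zero => exact hx
    | succ k => rw [Function.iterate_succ_apply']; exact ret_mem
  have hneg : ∀ k, (ret t)^[k] x < 0 → (ret t)^[k + 2] x < 0 ∧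
      (ret t)^[k + 2] x = (ret t)^[k] x + (3 * t - 4) / 2 := by
    intro k hk
    have h3 := hN (k + 1)
    have h4 := hN (k + 2)
    have h5 := (hmem k).1
    rw [Function.iterate_succ_apply'] at h3
    rw [Function.iterate_succ_apply', Function.iterate_succ_apply'] at h4 ⊢
    generalize (ret t)^[k] x = z at *
    rcases lt_or_ge (z + t) 1 with h6 | h6
    · rw [ret_of_lt_one (by linarith) h6] at h4 ⊢
      rcases lt_or_ge (2 * (z + t) + 1 + t) 3 with h7 | h7
      · rw [ret_of_lt_three (by linarith) h7] at h4
        exact absurd ⟨by linarith, by linarith⟩ h4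
      · rw [ret_of_lt_five h7 (by linarith)]
        exact ⟨by linarith, by ring⟩
    · rw [ret_of_lt_three h6 (by linarith)] at h3
      exact absurd ⟨by linarith, by linarith⟩ h3
  by_cases hex : ∃ k, (ret t)^[k] x < 0
  · right
    obtain ⟨k, hk⟩ := hex
    have h3 : ∀ j : ℕ, (ret t)^[k + 2 * j] x < 0 ∧
        (ret t)^[k + 2 * j] x = (ret t)^[k] x + j * ((3 * t - 4) / 2) := by
      intro j
      induction j with
      | zero => exact ⟨hk, by simp⟩
      | succ j ih =>
        obtain ⟨h4, h5⟩ := hneg _ ih.1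
        rw [show k + 2 * (j + 1) = k + 2 * j + 2 by ring]
        exact ⟨h4, by rw [h5, ih.2]; push_cast; ring⟩
    have h4 := eq_zero_of_bounded (c := (3 * t - 4) / 2) (M := 1) fun j => by
      obtain ⟨h4, h5⟩ := h3 j
      have h6 := (hmem (k + 2 * j)).1
      have h7 := (hmem k).1
      rw [abs_le]; constructor <;> linarith
    refine ⟨by linarith, red_iterate_inj (t := t) (k := k) ?_⟩
    rw [← Function.iterate_add_apply, (hneg k hk).2, h4, add_zero]
  · left
    push Not at hex
    have h3 : ∀ k, 3 ≤ (ret t)^[k] x := by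
      intro k
      have h4 := hN k
      have h5 := hN (k + 1)
      have h6 := hex k
      have h7 := hex (k + 1)
      rw [Function.iterate_succ_apply'] at h5 h7
      generalize (ret t)^[k] x = z at *
      by_contra hlt
      have h8 : 1 ≤ z := by by_contra h9; exact h4 ⟨h6, not_le.1 h9⟩
      rcases lt_or_ge (z + t) 3 with h9 | h9
      · rw [ret_of_lt_three (by linarith) h9] at h5
        exact h5 ⟨by linarith, by linarith⟩
      · rw [ret_of_lt_five h9 (by linarith)] at h7
        linarith
    have h4 : ∀ k, (ret t)^[k + 1] x - (7 - 2 * t) = 2 * ((ret t)^[k] x - (7 - 2 * t)) := by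
      intro k
      have h5 := h3 k
      have h6 := h3 (k + 1)
      have h7 := (hmem k).2
      rw [Function.iterate_succ_apply'] at h6 ⊢
      generalize (ret t)^[k] x = z at *
      rcases lt_or_ge (z + t) 5 with h8 | h8
      · rw [ret_of_lt_five (by linarith) h8] at h6
        linarith
      · rcases lt_or_ge (z + t) 6 with h9 | h9
        · rw [ret_of_lt_six h8 h9]; ring
        · rw [ret_of_lt_seven h9 (by linarith)] at h6
          linarith
    intro k
    refine eq_of_expanding (a := fun j => (ret t)^[j + k] x) (c := 7 - 2 * t) (M := 2)
      (fun j => ?_) (fun j => ?_) |> fun h => by simpa using h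
    · rw [add_right_comm]; exact h4 _
    · have h5 := h3 (j + k)
      have h6 := (hmem (j + k)).2
      rw [abs_le]; constructor <;> linarith

lemma omega_eq_of_not_onClosedLeaf (h1 : 1 ≤ t) (h2 : t < 2) {q : Surface}
    (hq : InfiniteHalfLeaf t q) (hq' : ¬ OnClosedLeaf t q) : omega t q = susp t {t - 1} := by
  obtain ⟨x, hx, y, hy, rfl⟩ := exists_E t q
  obtain ⟨hp, h⟩ := (infiniteHalfLeaf_iff (by linarith) (by linarith) hy).1 hq
  by_cases hN : ∃ N, (ret t)^[N] x ∈ Ico (0 : ℝ) 1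
  · obtain ⟨N, hN⟩ := hN
    exact omega_eq_susp_singleton h1 h2 hy hp h hN
  · push Not at hN
    exfalso
    rcases not_trapped_cases h1 h2 hx hN with h3 | ⟨-, h3⟩
    · exact hq' (onClosedLeaf_of_periodic (n := 1) (by linarith) (by linarith) hy hp h one_ne_zero
        (congrArg red ((h3 1).trans (h3 0).symm)))
    · exact hq' (onClosedLeaf_of_periodic (by linarith) (by linarith) hy hp h two_ne_zero h3)

lemma concentratesOn_susp_singleton (h1 : 1 ≤ t) (h2 : t < 2) (h : t ≠ 4 / 3) :
    ConcentratesOn t (susp t {t - 1}) := by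
  intro q hq
  obtain ⟨x, hx, y, hy, rfl⟩ := exists_E t q
  obtain ⟨hp, hi⟩ := (infiniteHalfLeaf_iff (by linarith) (by linarith) hy).1 hq
  by_cases hN : ∃ N, (ret t)^[N] x ∈ Ico (0 : ℝ) 1
  · obtain ⟨N, hN⟩ := hN
    exact Or.inl (omega_eq_susp_singleton h1 h2 hy hp hi hN)
  · push Not at hN
    right
    rcases not_trapped_cases h1 h2 hx hN with h3 | ⟨h3, -⟩
    -- The half-turn takes the repelling fixed point 7 - 2t to t - 7, which is t - 1 modulo 6.
    · refine halfLeaf_subset_halfTurn (by linarith) (by linarith) hy hp hi fun k => ⟨_, rfl, ?_⟩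
      rw [h3]
      exact red_eq_iff.2 ⟨1, by push_cast; ring⟩
    · exact absurd h3 h

lemma isAttractingClosedLeaf_susp_singleton (h1 : 1 < t) (h2 : t < 2) :
    IsAttractingClosedLeaf t (susp t {t - 1}) := by
  have hm : t - 1 ∈ Ico (0 : ℝ) 1 := ⟨by linarith, by linarith⟩
  have hit : ∀ k, (ret t)^[k] (t - 1) = t - 1 := fun k => by
    rw [(ret_iterate_of_mem_Ico h1.le h2 hm k).2]; simp
  have hr : (range fun k : ℕ => (ret t)^[k] (t - 1)) = {t - 1} := by
    simp only [hit, range_const]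
  rw [← hr]
  refine isAttractingClosedLeaf_susp (n := 1) (η := min (t - 1) (2 - t)) (by linarith)
    (by linarith) one_ne_zero (hit 1) (fun k => ?_) (lt_min (by linarith) (by linarith)) ?_
  · rw [hit k]
    exact ⟨⟨by linarith, by linarith⟩, ⟨by linarith, by linarith⟩,
      not_vert_of_mem_Ioo ⟨by linarith, by linarith⟩⟩
  · intro x _ k hk
    rw [hit k, abs_lt] at hk
    have e1 := min_le_left (t - 1) (2 - t)
    have e2 := min_le_right (t - 1) (2 - t)
    have hx : x ∈ Ico (0 : ℝ) 1 := ⟨by linarith [hk.1], by linarith [hk.2]⟩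
    refine ⟨infOrbit_of_mem_Ico h1 h2 hx, ⟨0, fun j _ => ?_⟩, ?_⟩
    · have := (ret_iterate_of_mem_Ico h1.le h2 hx j).1
      exact ⟨by linarith [this.1], this.2.le⟩
    · rw [hr, mapClusterPt_of_mem_Ico h1.le h2 hx]

lemma isClosedSaddleConnection_one : IsClosedSaddleConnection 1 (susp 1 {(1 : ℝ) - 1}) := by
  have h0 : ret 1 0 = 0 := by rw [ret_of_lt_three (by norm_num) (by norm_num)]; norm_num
  convert isClosedSaddleConnection_susp (t := 1) (x₀ := 0) (n := 1) (by norm_num) (by norm_num)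
    one_ne_zero (Or.inl (red_of_mem le_rfl (by norm_num))) (fun k hk hk' => by omega)
    (by rw [Function.iterate_one, h0]) using 2
  ext c
  simp

end Disco

namespace Disco

variable {t θ : ℝ}

/-! ### The set of parameters -/

lemma zero_not_mem_gapParam : (0 : ℝ) ∉ gapParam := by
  rintro ⟨n, hn⟩
  norm_num [disp] at hn

lemma fract_disp_one_half : Int.fract (disp 1 (1 / 2)) = 1 / 2 := by
  norm_num [disp, Int.fract_eq_self]

lemma half_not_mem_gapParam : (1 / 2 : ℝ) ∉ gapParam :=
  not_mem_gapParam one_ne_zero (Or.inr fract_disp_one_half) fun k hk => by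
    rw [Nat.lt_one_iff.1 hk, disp_zero]; norm_num

lemma exists_saddle (h2 : 2 ≤ t) (h4 : t ≤ 4) (h : 1 - t / 4 ∉ gapParam) (hI : ¬ Irr (t / 4)) :
    ∃ L, IsClosedSaddleConnection t L ∧ ConcentratesOn t L := by
  have := saddle_of_not_mem_gapParam h
  rw [sub_sub_cancel] at this
  obtain ⟨n, p, hR, ⟨h0, hp⟩ | ⟨h0, hp⟩⟩ := this hI
  · refine hR.exists_saddle_right (h2.lt_of_ne fun e => ?_) h4 hp
    rw [← e, show (1 : ℝ) - 2 / 4 = 1 / 2 by norm_num] at h0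
    exact not_left_and_right one_ne_zero hR.ne_zero fract_disp_one_half h0
  · refine hR.exists_saddle_left h2 (h4.lt_of_ne fun e => ?_) hp
    rw [e] at h0
    norm_num [disp] at h0

lemma not_irr_of_fract {n : ℕ} (hn : n ≠ 0)
    (h : Int.fract (disp n (1 - t / 4)) = 0 ∨ Int.fract (disp n (1 - t / 4)) = 1 / 2) :
    ¬ Irr (t / 4) := fun hI => by
  obtain ⟨h1, h2⟩ := Irr.fract_lt (θ := 1 - t / 4) (by rwa [sub_sub_cancel]) hn
  rcases h with h | h <;> linarith

/-- The parameters with an attracting closed leaf, and the left end point `1`. -/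
def hyperbolicParam : Set ℝ := Ico 1 2 ∪ {t | t ∈ Icc 2 4 ∧ 1 - t / 4 ∈ gapParam}

lemma hyperbolicParam_subset : hyperbolicParam ⊆ Icc 1 4 := by
  rintro t (h | ⟨h, -⟩)
  · exact ⟨h.1, by linarith [h.2]⟩
  · exact ⟨by linarith [h.1], h.2⟩

lemma compl_hyperbolicParam :
    Icc 1 4 \ hyperbolicParam = Icc 2 4 ∩ (fun t : ℝ => 1 - t / 4) ⁻¹' gapParamᶜ := by
  ext t
  constructor
  · rintro ⟨h1, h2⟩
    have h3 : t ∈ Icc (2 : ℝ) 4 := ⟨by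
      by_contra h; exact h2 (Or.inl ⟨h1.1, not_le.1 h⟩), h1.2⟩
    exact ⟨h3, fun h => h2 (Or.inr ⟨h3, h⟩)⟩
  · rintro ⟨h1, h2⟩
    refine ⟨⟨by linarith [h1.1], h1.2⟩, ?_⟩
    rintro (h | ⟨-, h⟩)
    · linarith [h.2, h1.1]
    · exact h2 h

lemma volume_compl_hyperbolicParam : volume (Icc 1 4 \ hyperbolicParam) = 0 := by
  rw [compl_hyperbolicParam]
  refine measure_mono_null inter_subset_right ?_
  have e : (fun t : ℝ => 1 - t / 4) ⁻¹' gapParamᶜ =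
      (fun t : ℝ => (-(1 / 4)) * t) ⁻¹' ((fun s : ℝ => s + 1) ⁻¹' gapParamᶜ) := by
    ext t
    simp only [mem_preimage]
    rw [show (1 - t / 4 : ℝ) = -(1 / 4) * t + 1 by ring]
  rw [e, Real.volume_preimage_mul_left (by norm_num), measure_preimage_add_right,
    volume_compl_gapParam, mul_zero]

lemma isCantorSet_compl_hyperbolicParam : IsCantorSet (Icc 1 4 \ hyperbolicParam) := by
  have hcl : IsClosed ((fun t : ℝ => 1 - t / 4) ⁻¹' gapParamᶜ) :=
    isOpen_gapParam.isClosed_compl.preimage (by fun_prop)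
  refine ⟨⟨4, ?_⟩, ?_, ⟨?_, preperfect_iff_nhds.2 ?_⟩,
    isTotallyDisconnected_of_volume_eq_zero volume_compl_hyperbolicParam⟩
  all_goals rw [compl_hyperbolicParam]
  · refine ⟨by norm_num, ?_⟩
    simpa using zero_not_mem_gapParam
  · exact isCompact_Icc.inter_right hcl
  · exact isClosed_Icc.inter hcl
  · rintro t ⟨ht, htg⟩ U hU
    obtain ⟨ε, hε, hεU⟩ := Metric.mem_nhds_iff.1 hU
    obtain ⟨x, hx, hxg, hne, hlt⟩ := not_isolated (θ := 1 - t / 4) htg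
      ⟨by linarith [ht.2], by linarith [ht.1]⟩ (by linarith : 0 < ε / 4)
    refine ⟨4 * (1 - x), ⟨hεU ?_, ⟨by linarith [hx.2], by linarith [hx.1]⟩, ?_⟩, fun h => hne ?_⟩
    · rw [Metric.mem_ball, Real.dist_eq]
      rw [abs_lt] at hlt ⊢
      constructor <;> linarith [hlt.1, hlt.2]
    · simp only [mem_preimage]
      rwa [show 1 - 4 * (1 - x) / 4 = x by ring]
    · linarith

lemma Ioo_subset_interior : Ioo 1 2 ⊆ interior hyperbolicParam :=
  interior_maximal (Ioo_subset_Ico_self.trans subset_union_left) isOpen_Ioo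

lemma mem_interior_of_gapParam (h2 : 2 ≤ t) (h4 : t ≤ 4) (h : 1 - t / 4 ∈ gapParam) :
    t ∈ interior hyperbolicParam := by
  have h2' : 2 < t := h2.lt_of_ne fun e => half_not_mem_gapParam (by
    rwa [← e, show (1 : ℝ) - 2 / 4 = 1 / 2 by norm_num] at h)
  have h4' : t < 4 := h4.lt_of_ne fun e => zero_not_mem_gapParam (by
    rwa [e, show (1 : ℝ) - 4 / 4 = 0 by norm_num] at h)
  refine interior_maximal (s := hyperbolicParam)
    (t := Ioo 2 4 ∩ (fun t : ℝ => 1 - t / 4) ⁻¹' gapParam) ?_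
    (isOpen_Ioo.inter (isOpen_gapParam.preimage (by fun_prop))) ⟨⟨h2', h4'⟩, h⟩
  rintro s ⟨hs, hsg⟩
  exact Or.inr ⟨Ioo_subset_Icc_self hs, hsg⟩

/-! ### The three kinds of parameters -/

lemma exists_attracting (ht : t ∈ interior hyperbolicParam) :
    ∃ L, IsAttractingClosedLeaf t L ∧ (t ≠ 4 / 3 → ConcentratesOn t L) ∧
      ∀ p, InfiniteHalfLeaf t p → ¬ OnClosedLeaf t p → omega t p = L := by
  have h14 : t ∈ Ioo (1 : ℝ) 4 := by
    rw [← interior_Icc]; exact interior_mono hyperbolicParam_subset ht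
  rcases lt_or_ge t 2 with h2 | h2
  · exact ⟨_, isAttractingClosedLeaf_susp_singleton h14.1 h2,
      concentratesOn_susp_singleton h14.1.le h2,
      fun q hq hq' => omega_eq_of_not_onClosedLeaf h14.1.le h2 hq hq'⟩
  · rcases interior_subset ht with h | ⟨-, h⟩
    · exact absurd h.2 (not_lt.2 h2)
    · obtain ⟨n, p, hR, hg⟩ := rat_of_mem_gapParam h
      rw [sub_sub_cancel] at hR hg
      obtain ⟨L, hL, hc, ho⟩ := hR.exists_attracting h2 h14.2.le hg
      exact ⟨L, hL, fun _ => hc, ho⟩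

lemma gapParam_of_mem_hyperbolicParam (h2 : 2 ≤ t) (h : t ∈ hyperbolicParam) :
    1 - t / 4 ∈ gapParam := by
  rcases h with h | ⟨-, h⟩
  · exact absurd h.2 (not_lt.2 h2)
  · exact h

lemma not_irr_of_isEndpoint (h2 : 2 ≤ t) (h4 : t ≤ 4)
    (h : IsEndpoint hyperbolicParam t ∨ t = 4) : ¬ Irr (t / 4) := by
  rcases h4.lt_or_eq with h4' | rfl
  · rcases h2.lt_or_eq with h2' | rfl
    · obtain ⟨hi, ε, hε, hs⟩ := h.resolve_right h4'.ne
      have hg : 1 - t / 4 ∉ gapParam := fun hg => hi (mem_interior_of_gapParam h2 h4 hg)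
      rcases hs with hs | hs
      -- The change θ = 1 - t/4 reverses orientation, so a component to the right of `t` is one to
      -- the left of θ.
      · obtain ⟨n, hn, h0⟩ := fract_of_left_gap hg (ε := min (ε / 4) ((4 - t) / 4))
          (lt_min (by linarith) (by linarith)) fun x hx => by
            have e1 := min_le_left (ε / 4) ((4 - t) / 4)
            have e2 := min_le_right (ε / 4) ((4 - t) / 4)
            have := gapParam_of_mem_hyperbolicParam (by linarith [hx.2])
              (hs (⟨by linarith [hx.2], by linarith [hx.1]⟩ : 4 * (1 - x) ∈ Ioo t (t + ε)))
            rwa [show 1 - 4 * (1 - x) / 4 = x by ring] at this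
        exact not_irr_of_fract hn (Or.inl h0)
      · obtain ⟨n, hn, h0⟩ := fract_of_right_gap hg (ε := min (ε / 4) ((t - 2) / 4))
          (lt_min (by linarith) (by linarith)) fun x hx => by
            have e1 := min_le_left (ε / 4) ((t - 2) / 4)
            have e2 := min_le_right (ε / 4) ((t - 2) / 4)
            have := gapParam_of_mem_hyperbolicParam (by linarith [hx.2])
              (hs (⟨by linarith [hx.2], by linarith [hx.1]⟩ : 4 * (1 - x) ∈ Ioo (t - ε) t))
            rwa [show 1 - 4 * (1 - x) / 4 = x by ring] at this
        exact not_irr_of_fract hn (Or.inr h0)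
    · refine not_irr_of_fract one_ne_zero (Or.inr ?_)
      rw [show (1 : ℝ) - 2 / 4 = 1 / 2 by norm_num, fract_disp_one_half]
  · exact not_irr_of_fract one_ne_zero (Or.inl (by norm_num [disp]))

lemma exists_saddle_of_isEndpoint (ht : t ∈ Icc (1 : ℝ) 4)
    (h : IsEndpoint hyperbolicParam t ∨ t = 4) :
    ∃ L, IsClosedSaddleConnection t L ∧ ConcentratesOn t L := by
  have hi : t ∉ interior hyperbolicParam := by
    rcases h with h | rfl
    · exact h.1
    · intro h
      have := interior_mono hyperbolicParam_subset h
      rw [interior_Icc] at this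
      exact lt_irrefl _ this.2
  rcases lt_or_ge t 2 with h2 | h2
  · rcases ht.1.lt_or_eq with h1 | rfl
    · exact absurd (Ioo_subset_interior ⟨h1, h2⟩) hi
    · exact ⟨_, isClosedSaddleConnection_one,
        concentratesOn_susp_singleton le_rfl h2 (by norm_num)⟩
  · exact exists_saddle h2 ht.2 (fun hg => hi (mem_interior_of_gapParam h2 ht.2 hg))
      (not_irr_of_isEndpoint h2 ht.2 h)

lemma exists_cantor_of_not_isEndpoint (ht : t ∈ Icc (1 : ℝ) 4) (hi : t ∉ interior hyperbolicParam)
    (he : ¬ IsEndpoint hyperbolicParam t) (h4 : t ≠ 4) :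
    ∃ A, IsTransverselyNullCantor A ∧ ConcentratesOn t A := by
  have h4' : t < 4 := ht.2.lt_of_ne h4
  have h12 : Ioo (1 : ℝ) 2 ⊆ hyperbolicParam := Ioo_subset_interior.trans interior_subset
  have h2 : 2 < t := by
    by_contra hlt
    rcases (not_lt.1 hlt).lt_or_eq with h2 | rfl
    · rcases ht.1.lt_or_eq with h1 | rfl
      · exact hi (Ioo_subset_interior ⟨h1, h2⟩)
      · exact he ⟨hi, 1, one_pos, Or.inl (by rwa [one_add_one_eq_two])⟩
    · exact he ⟨hi, 1, one_pos, Or.inr (by rwa [show (2 : ℝ) - 1 = 1 by norm_num])⟩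
  have hg : 1 - t / 4 ∉ gapParam := fun hg => hi (mem_interior_of_gapParam h2.le ht.2 hg)
  refine Irr.exists_cantor h2.le ht.2 ?_
  -- In the rational case off `gapParam`, the displacement at the return would be 0 or 1/2 modulo 1,
  -- which makes `t` an end point.
  by_contra hI
  have := saddle_of_not_mem_gapParam hg
  rw [sub_sub_cancel] at this
  obtain ⟨n, p, hR, ⟨h0, -⟩ | ⟨h0, -⟩⟩ := this hI
  · obtain ⟨ε, hε, hs⟩ := left_gap_of_fract hR.ne_zero h0
    refine he ⟨hi, min (4 * ε) (4 - t), lt_min (by linarith) (by linarith), Or.inl fun x hx => ?_⟩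
    have e1 := min_le_left (4 * ε) (4 - t)
    have e2 := min_le_right (4 * ε) (4 - t)
    exact Or.inr ⟨⟨by linarith [hx.1], by linarith [hx.2]⟩,
      hs ⟨by linarith [hx.2], by linarith [hx.1]⟩⟩
  · obtain ⟨ε, hε, hs⟩ := right_gap_of_fract hR.ne_zero h0
    refine he ⟨hi, min (4 * ε) (t - 2), lt_min (by linarith) (by linarith), Or.inr fun x hx => ?_⟩
    have e1 := min_le_left (4 * ε) (t - 2)
    have e2 := min_le_right (4 * ε) (t - 2)
    exact Or.inr ⟨⟨by linarith [hx.1], by linarith [hx.2]⟩,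
      hs ⟨by linarith [hx.2], by linarith [hx.1]⟩⟩

end Disco

theorem mainTheorem4 :
    ∃ H : Set ℝ, H ⊆ Set.Icc 1 4 ∧
      Disco.IsCantorSet (Set.Icc 1 4 \ H) ∧
      MeasureTheory.volume (Set.Icc 1 4 \ H) = 0 ∧
      (∀ t ∈ interior H, ∃ L, Disco.IsAttractingClosedLeaf t L ∧
        (t ≠ 4 / 3 → Disco.ConcentratesOn t L) ∧
        (∀ p, Disco.InfiniteHalfLeaf t p → ¬ Disco.OnClosedLeaf t p → Disco.omega t p = L)) ∧
      (∀ t ∈ Set.Icc (1 : ℝ) 4, Disco.IsEndpoint H t ∨ t = 4 →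
        ∃ L, Disco.IsClosedSaddleConnection t L ∧ Disco.ConcentratesOn t L) ∧
      (∀ t ∈ Set.Icc (1 : ℝ) 4, t ∉ interior H → ¬ Disco.IsEndpoint H t → t ≠ 4 →
        ∃ A, Disco.IsTransverselyNullCantor A ∧ Disco.ConcentratesOn t A) :=
  ⟨Disco.hyperbolicParam, Disco.hyperbolicParam_subset, Disco.isCantorSet_compl_hyperbolicParam,
    Disco.volume_compl_hyperbolicParam, fun _ ht => Disco.exists_attracting ht,
    fun _ ht h => Disco.exists_saddle_of_isEndpoint ht h,
    fun _ ht hi he h4 => Disco.exists_cantor_of_not_isEndpoint ht hi he h4⟩
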